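/- Write $j=\sqrt{-1}$. Let $A(z)$ be an $m\times n$ complex matrix function, analytic at every point of the unit circle. For a matrix function $M$ put $M^P(z):=M(1/\overline z)^H$. Real or complex functions $f_0,\dots,f_{k-1}$ on $\mathbb R$ are called $k$-multiplexed if $f_i(\Omega+2\pi)=f_{i+1}(\Omega)$ for $0\le i<k-1$ and $f_{k-1}(\Omega+2\pi)=f_0(\Omega)$, and signed $k$-multiplexed if instead $f_{k-1}(\Omega+2\pi)=-f_0(\Omega)$. (1) There is an analytic singular value decomposition $A(e^{j\Omega})=\widetilde U(\Omega)\Sigma(\Omega)\widetilde V(\Omega)^H$, $\Omega\in\mathbb R$, with real-analytic unitary $\widetilde U,\widetilde V$ and with $\Sigma$ an $m\times n$ diagonal matrix of real-analytic real-valued functions, whose not identically zero diagonal entries are arranged in orbits: there are finitely many real-analytic, not identically zero functions $\sigma_{\nu,i}$ ($1\le\nu\le R$, $0\le i<k_\nu$) with pairwise non-identical absolute values, such that for each $\nu$ the functions $\sigma_{\nu,0},\dots,\sigma_{\nu,k_\nu-1}$ are $k_\nu$-multiplexed or signed $k_\nu$-multiplexed, and there is a finite list $\nu_1,\dots,\nu_B$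 of orbits in which every orbit occurs (as often as its multiplicity), such that the diagonal of $\Sigma$ is formed by $\sigma_{\nu_1,0},\dots,\sigma_{\nu_1,k_{\nu_1}-1},\sigma_{\nu_2,0},\dots,\sigma_{\nu_B,k_{\nu_B}-1}$ followed by zeros. (2) For every such arrangement of the analytic singular values of $A$ there are $r>1$ and matrix functions $U(z)$ ($m\times m$), $C(z)$ ($m\times n$), $V(z)$ ($n\times n$), holomorphic in $z$ on the annulus $r^{-1}<|z|<r$ (no fractional powers), such that on this annulus $$A(z)=U(z)\,C(z)\,V^P(z),\qquad U(z)U^P(z)=I,\qquad V(z)V^P(z)=I,$$ and $C(z)$ is block diagonal with consecutive square diagonal blocks $C_{\nu_1}(z),\dots,C_{\nu_B}(z)$ and zeros elsewhere. That is, there is one block for each orbit, signed or not, repeated according to the multiplicity of the orbit. Each $C_\nu$ is pseudo-circulant of size $k=k_\nu$: there are $\phi_0,\dots,\phi_{k-1}$ holomorphic on the annulus such that the $(a,b)$ entry of $C_\nu(z)$ is $\phi_{a-b}(z)$ for $a\ge b$ and $z^{-1}\phi_{k+a-b}(z)$ for $a<b$, and $C_\nu(z)$ is normal for $|z|=1$.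 The block $C_\nu$ corresponds to the orbit $\nu$ in the following sense: there are real-analytic complex-valued $k$-multiplexed (not signed) functions $s_0,\dots,s_{k-1}$ on $\mathbb R$ with $|s_i(\Omega)|=|\sigma_{\nu,i}(\Omega)|$ and $$C_\nu(e^{j\Omega})=W_k(\Omega)\,\mathrm{diag}(s_0(\Omega),\dots,s_{k-1}(\Omega))\,W_k(\Omega)^H,\qquad W_k(\Omega)=\mathrm{diag}(e^{j\Omega a/k})_{a=0}^{k-1}\,F_k,$$ where $F_k=k^{-1/2}\big(e^{2\pi j ab/k}\big)_{a,b=0}^{k-1}$ is the unitary Fourier matrix. -/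

import Mathlib

open scoped Matrix ComplexConjugate

noncomputable section

namespace AnalyticSVD

/-- The open annulus `1/r < |z| < r` around the unit circle. -/
def annulus (r : ℝ) : Set ℂ := {z | r⁻¹ < ‖z‖ ∧ ‖z‖ < r}

/-- A matrix-valued function of a variable in `𝕜` (`ℝ` or `ℂ`) is analytic at every point of `S`,
entry by entry. -/
def AnalyticEntries (𝕜 : Type) [NontriviallyNormedField 𝕜] [NormedSpace 𝕜 ℂ] {m n : ℕ}
    (M : 𝕜 → Matrix (Fin m) (Fin n) ℂ) (S : Set 𝕜) : Prop :=
  ∀ i j, AnalyticOnNhd 𝕜 (fun z => M z i j) S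

/-- The para-Hermitian operator `M^P(z) = M(1 / z̄)ᴴ`. -/
def paraH {m n : ℕ} (M : ℂ → Matrix (Fin m) (Fin n) ℂ) (z : ℂ) : Matrix (Fin n) (Fin m) ℂ :=
  (M (1 / conj z))ᴴ

/-- `U` is para-unitary on `S`: `U(z) U^P(z) = I` for every `z ∈ S`. -/
def ParaUnitaryOn {n : ℕ} (U : ℂ → Matrix (Fin n) (Fin n) ℂ) (S : Set ℂ) : Prop :=
  ∀ z ∈ S, U z * paraH U z = 1

/-- The point `e^{jΩ}` of the unit circle. -/
def circ (Ω : ℝ) : ℂ := Complex.exp (Complex.I * Ω)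

/-- `f₀, …, f_{k-1}` are `k`-multiplexed (`κ = 1`) or signed `k`-multiplexed (`κ = 2`):
`f_i(Ω + 2π) = f_{i+1}(Ω)` for `i + 1 < k` and `f_{k-1}(Ω + 2π) = (-1)^{κ-1} f₀(Ω)`. -/
def Multiplexed {E : Type} [Ring E] {k : ℕ} (κ : ℕ) (f : Fin k → ℝ → E) : Prop :=
  (∀ i j : Fin k, (i : ℕ) + 1 = j → ∀ Ω : ℝ, f i (Ω + 2 * Real.pi) = f j Ω) ∧
  (∀ i j : Fin k, (i : ℕ) + 1 = k → (j : ℕ) = 0 →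
    ∀ Ω : ℝ, f i (Ω + 2 * Real.pi) = (-1) ^ (κ - 1) * f j Ω)

/-- Row and column at which block number `b` begins, when square blocks of the given sizes are put
one after the other on the diagonal. -/
def offset {B : ℕ} (size : Fin B → ℕ) (b : Fin B) : ℕ := ∑ c : Fin B with c < b, size c

/-- The `m × n` block diagonal matrix with the given consecutive square diagonal blocks, starting
in the upper left corner, and zeros elsewhere (meant for `∑ b, size b ≤ min m n`). -/
def blockDiag (m n : ℕ) {B : ℕ} (size : Fin B → ℕ)
    (D : ∀ b, Matrix (Fin (size b)) (Fin (size b)) ℂ) : Matrix (Fin m) (Fin n) ℂ :=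
  fun p q => ∑ b, ∑ i : Fin (size b), ∑ j : Fin (size b),
    if (p : ℕ) = offset size b + i ∧ (q : ℕ) = offset size b + j then D b i j else 0

/-- `K` is an analytic pseudo-circulant `N × N` matrix on `S`: there are analytic
`φ₀, …, φ_{N-1}` with `(i, j)` entry `φ_{i-j}(z)` for `j ≤ i` and `z⁻¹ φ_{N+i-j}(z)` for `i < j`
(subtraction in `Fin N` is modulo `N`), and `K(z)` is normal on the unit circle. -/
def PseudoCirculantOn {N : ℕ} (K : ℂ → Matrix (Fin N) (Fin N) ℂ) (S : Set ℂ) : Prop :=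
  (∃ φ : Fin N → ℂ → ℂ, (∀ d, AnalyticOnNhd ℂ (φ d) S) ∧
    ∀ z ∈ S, ∀ i j, K z i j = if j ≤ i then φ (i - j) z else z⁻¹ * φ (i - j) z) ∧
  ∀ z : ℂ, ‖z‖ = 1 → K z * (K z)ᴴ = (K z)ᴴ * K z

/-- The unitary `N × N` Fourier matrix, with entries `e^{2πj a l / N} / √N`. -/
def fourierMatrix (N : ℕ) : Matrix (Fin N) (Fin N) ℂ :=
  fun a l => Complex.exp (2 * Real.pi * Complex.I * (a : ℕ) * (l : ℕ) / N) / (Real.sqrt N : ℂ)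

/-- The base change `W_N(Ω) = diag(e^{jΩa/N})_{a = 0, …, N-1} F_N`. -/
def baseChange (N : ℕ) (Ω : ℝ) : Matrix (Fin N) (Fin N) ℂ :=
  Matrix.diagonal (fun a : Fin N => Complex.exp (Complex.I * Ω * (a : ℕ) / N)) * fourierMatrix N

/-- Real functions arranged in orbits: there are `R` orbits, and orbit `ν` consists of the `k ν`
functions `σ ν 0, …, σ ν (k ν - 1)`, with sign index `κ ν`. Repetitions are recorded by the list
`orb 0, …, orb (B - 1)` of orbits: orbit `ν` is repeated as often as it occurs in the list. -/
structure OrbitSystem where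
  R : ℕ
  k : Fin R → ℕ
  κ : Fin R → ℕ
  σ : ∀ ν : Fin R, Fin (k ν) → ℝ → ℝ
  B : ℕ
  orb : Fin B → Fin R

/-- The sizes `k_ν` of the listed orbits. -/
def OrbitSystem.size (S : OrbitSystem) (b : Fin S.B) : ℕ := S.k (S.orb b)

/-- The functions of `S` are the analytic singular values of `A(e^{jΩ})` that are not identically
zero, arranged in their orbits: the `σ ν i` are analytic, not identically zero, have pairwise
different absolute values, each orbit is multiplexed (`κ = 1`) or signed multiplexed (`κ = 2`), and
`A(e^{jΩ}) = U(Ω) Σ(Ω) V(Ω)ᴴ` with analytic unitary `U`, `V` and with `Σ(Ω)` the rectangular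
diagonal matrix that lists the functions `σ ν i` orbit after orbit, each with its multiplicity,
followed by zeros. -/
structure OrbitSystem.IsSingularSystem (S : OrbitSystem) {m n : ℕ}
    (A : ℂ → Matrix (Fin m) (Fin n) ℂ) : Prop where
  size_pos : ∀ ν, 0 < S.k ν
  sign_index : ∀ ν, S.κ ν = 1 ∨ S.κ ν = 2
  analytic : ∀ ν i, AnalyticOnNhd ℝ (S.σ ν i) Set.univ
  nonzero : ∀ ν i, ∃ Ω, S.σ ν i Ω ≠ 0
  distinct : ∀ x y : (Σ ν : Fin S.R, Fin (S.k ν)), x ≠ y →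
    ∃ Ω, |S.σ x.1 x.2 Ω| ≠ |S.σ y.1 y.2 Ω|
  multiplexed : ∀ ν, Multiplexed (S.κ ν) (S.σ ν)
  listed : Function.Surjective S.orb
  fits_rows : ∑ b, S.size b ≤ m
  fits_cols : ∑ b, S.size b ≤ n
  svd : ∃ (U : ℝ → Matrix (Fin m) (Fin m) ℂ) (V : ℝ → Matrix (Fin n) (Fin n) ℂ),
    AnalyticEntries ℝ U Set.univ ∧ AnalyticEntries ℝ V Set.univ ∧
    (∀ Ω, U Ω ∈ Matrix.unitaryGroup (Fin m) ℂ) ∧ (∀ Ω, V Ω ∈ Matrix.unitaryGroup (Fin n) ℂ) ∧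
    ∀ Ω : ℝ, A (circ Ω) =
      U Ω * blockDiag m n S.size
        (fun b => Matrix.diagonal (fun i => ((S.σ (S.orb b) i Ω : ℝ) : ℂ))) * (V Ω)ᴴ

/-- The pseudo-circulant block `K` corresponds to the (signed) `k`-multiplexed orbit
`σ₀, …, σ_{k-1}`: on the unit circle it is diagonalised by `W_k(Ω)`, and its eigenvalues are
analytic `k`-multiplexed (without sign) functions `s_i` with `|s_i| = |σ_i|`. -/
def BlockOfOrbit {k : ℕ} (K : ℂ → Matrix (Fin k) (Fin k) ℂ) (σ : Fin k → ℝ → ℝ) : Prop :=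
  ∃ s : Fin k → ℝ → ℂ, (∀ i, AnalyticOnNhd ℝ (s i) Set.univ) ∧ Multiplexed 1 s ∧
    (∀ i Ω, ‖s i Ω‖ = |σ i Ω|) ∧
    ∀ Ω : ℝ, K (circ Ω) =
      baseChange k Ω * Matrix.diagonal (fun i => s i Ω) * (baseChange k Ω)ᴴ

end AnalyticSVD

end

/-!
Along the unit circle, `a(Ω) = A(e^{jΩ})` is a real-analytic matrix function of period `2π`. By
Rellich's theorem (`exists_eigenvaluesOn_univ`) the Hermitian matrix `[0 a; aᴴ 0]` has analytic
eigenvalues, the signed singular values of `a`; globally they need not have period `2π`. The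
translation by `2π` permutes the finitely many nonzero squares of these eigenvalues, and the cycles
of this permutation are the orbits. Running once through a cycle of length `k` brings a singular
value back up to a sign, which is the sign of the orbit (`exists_orbitFamily`).

The squares are pairwise different analytic functions, so `aᴴ a` has analytic spectral projections,
found by Lagrange interpolation (`exists_spectralSystem`). A translation by `2π` carries the
projection of one member of an orbit to that of the next, so the first projection of an orbit of
length `k` has period `2πk`, and by `exists_frame` its range has an analytic orthonormal basis of the
same period. The translates of this basis by multiples of `2π` are bases for the other members of
the orbit, which gives right singular vectors that are multiplexed along every orbit. The sign of a
signed orbit is removed by the phases `e^{jΩ/(2k)}`: the functions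
`s_i(Ω) = e^{j(Ω+2πi)/(2k)} σ_i(Ω)` are multiplexed without sign. The left singular vectors
are the analytic quotients `a v / s`, again multiplexed
(`OrbitSystem.IsOrbitFamily.exists_multiplexedSVD`). For the first assertion, the phases are
absorbed into the left singular vectors.

For the second assertion, the same construction is applied to the orbits of an arbitrary
arrangement, whose decomposition shows that the listed multiplicities are the ranks of the
projections (`OrbitSystem.IsSingularSystem.exists_multiplexedSVD`). The base change
`W_k(Ω) = diag(e^{jΩa/k}) F_k` has multiplexed rows, so multiplying the singular vectors of an orbit
by `W_kᴴ` produces sums over full orbits, which have period `2π` (`periodic_mul_baseChange`), while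
the diagonal of singular values becomes a pseudo-circulant matrix of period `2π`
(`exists_pseudoCirculant`). The columns so obtained are completed to analytic unitary matrices of
period `2π` by `exists_unitary_completion`. Finally, a real-analytic function of period `2π` extends
holomorphically from the circle to an annulus (`exists_extension`), and the identities on the circle
persist on the annulus by the identity theorem (`eqOn_annulus`).
-/

open scoped Matrix ComplexConjugate

noncomputable section

namespace AnalyticSVD

open Filter Topology Matrix

/-! ### Unitary diagonalisation of a single Hermitian matrix -/

/-- `H = Q diag(l) Qᴴ` for some unitary matrix `Q`: the numbers `l i` are the eigenvalues of the
Hermitian matrix `H`, with multiplicities. -/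
def UDiag {ι : Type*} [Fintype ι] [DecidableEq ι] (H : Matrix ι ι ℂ) (l : ι → ℝ) : Prop :=
  ∃ Q ∈ Matrix.unitaryGroup ι ℂ, H = Q * diagonal (fun i => (l i : ℂ)) * Qᴴ

section UDiag

variable {ι : Type*} [Fintype ι] [DecidableEq ι]

lemma mem_unitaryGroup_of_conjTranspose_mul {Q : Matrix ι ι ℂ} (h : Qᴴ * Q = 1) :
    Q ∈ Matrix.unitaryGroup ι ℂ :=
  Matrix.mem_unitaryGroup_iff'.2 h

lemma UDiag.of_isHermitian {H : Matrix ι ι ℂ} (h : H.IsHermitian) : UDiag H h.eigenvalues := by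
  refine ⟨h.eigenvectorUnitary, h.eigenvectorUnitary.2, ?_⟩
  exact h.spectral_theorem

lemma UDiag.affine {H : Matrix ι ι ℂ} {l : ι → ℝ} (h : UDiag H l) (a c : ℝ) :
    UDiag ((a : ℂ) • H + (c : ℂ) • 1) (fun i => a * l i + c) := by
  obtain ⟨Q, hQ, rfl⟩ := h
  refine ⟨Q, hQ, ?_⟩
  have h1 : Q * Qᴴ = 1 := Matrix.mem_unitaryGroup_iff.1 hQ
  have h2 : diagonal (fun i => ((a * l i + c : ℝ) : ℂ))
      = (a : ℂ) • diagonal (fun i => (l i : ℂ)) + (c : ℂ) • 1 := by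
    ext i j
    by_cases hij : i = j
    · subst hij; simp
    · simp [hij]
  rw [h2, mul_add, add_mul]
  simp [h1]

lemma UDiag.of_conj {H Q : Matrix ι ι ℂ} {l : ι → ℝ} (hQ : Qᴴ * Q = 1) (h : UDiag (Qᴴ * H * Q) l) :
    UDiag H l := by
  obtain ⟨W, hW, hWe⟩ := h
  refine ⟨Q * W, mul_mem (mem_unitaryGroup_of_conjTranspose_mul hQ) hW, ?_⟩
  have h1 : Q * Qᴴ = 1 := mul_eq_one_comm.1 hQ
  calc H = (Q * Qᴴ) * H * (Q * Qᴴ) := by simp [h1]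
    _ = Q * (Qᴴ * H * Q) * Qᴴ := by simp only [Matrix.mul_assoc]
    _ = _ := by rw [hWe, conjTranspose_mul]; simp only [Matrix.mul_assoc]

/-- A matrix that is block diagonal for a partition of the index set in two parts is diagonalised
blockwise. -/
lemma UDiag.of_blocks {H : Matrix ι ι ℂ} (p : ι → Prop) [DecidablePred p]
    (hH : ∀ i j, ¬(p i ↔ p j) → H i j = 0)
    {l₁ : {i // p i} → ℝ} {l₂ : {i // ¬p i} → ℝ}
    (h₁ : UDiag (H.submatrix (fun i : {i // p i} => (i : ι)) (fun i : {i // p i} => (i : ι))) l₁)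
    (h₂ : UDiag (H.submatrix (fun i : {i // ¬p i} => (i : ι)) (fun i : {i // ¬p i} => (i : ι))) l₂) :
    UDiag H (fun i => if h : p i then l₁ ⟨i, h⟩ else l₂ ⟨i, h⟩) := by
  obtain ⟨Q₁, hQ₁, e₁⟩ := h₁
  obtain ⟨Q₂, hQ₂, e₂⟩ := h₂
  set e := Equiv.sumCompl p
  have hB : H.submatrix e e = fromBlocks Q₁ 0 0 Q₂ *
      diagonal (Sum.elim (fun i => (l₁ i : ℂ)) (fun i => (l₂ i : ℂ))) * (fromBlocks Q₁ 0 0 Q₂)ᴴ := by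
    rw [← fromBlocks_diagonal, fromBlocks_conjTranspose, fromBlocks_multiply, fromBlocks_multiply]
    simp only [Matrix.zero_mul, Matrix.mul_zero, add_zero, zero_add, conjTranspose_zero]
    rw [← e₁, ← e₂]
    ext (i | i) (j | j)
    · rfl
    · simpa [e] using hH i j (by simp [i.2, j.2])
    · simpa [e] using hH i j (by simp [i.2, j.2])
    · rfl
  have hU : (fromBlocks Q₁ 0 0 Q₂)ᴴ * fromBlocks Q₁ 0 0 Q₂ = 1 := by
    rw [fromBlocks_conjTranspose, fromBlocks_multiply]
    have h1 : Q₁ᴴ * Q₁ = 1 := Matrix.mem_unitaryGroup_iff'.1 hQ₁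
    have h2 : Q₂ᴴ * Q₂ = 1 := Matrix.mem_unitaryGroup_iff'.1 hQ₂
    simp [h1, h2]
  refine ⟨(fromBlocks Q₁ 0 0 Q₂).submatrix e.symm e.symm,
    mem_unitaryGroup_of_conjTranspose_mul ?_, ?_⟩
  · rw [conjTranspose_submatrix, submatrix_mul_equiv, hU, submatrix_one_equiv]
  · have hd : (diagonal fun i => (((if h : p i then l₁ ⟨i, h⟩ else l₂ ⟨i, h⟩ : ℝ)) : ℂ))
        = (diagonal (Sum.elim (fun i => (l₁ i : ℂ)) (fun i => (l₂ i : ℂ)))).submatrix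
            e.symm e.symm := by
      rw [submatrix_diagonal_equiv]
      congr 1
      ext i
      by_cases h : p i
      · simp [e, h, Equiv.sumCompl_symm_apply_of_pos]
      · simp [e, h, Equiv.sumCompl_symm_apply_of_neg]
    rw [hd, conjTranspose_submatrix, submatrix_mul_equiv, submatrix_mul_equiv, ← hB]
    simp

/-- The eigenvalues of a matrix are unique up to order. -/
lemma UDiag.exists_perm {H : Matrix ι ι ℂ} {l l' : ι → ℝ} (h : UDiag H l) (h' : UDiag H l') :
    ∃ π : Equiv.Perm ι, ∀ i, l i = l' (π i) := by
  have key : ∀ {l : ι → ℝ}, UDiag H l →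
      H.charpoly.roots = (Finset.univ.val.map l).map ((↑) : ℝ → ℂ) := by
    rintro l ⟨Q, hQ, rfl⟩
    have h1 : Q * Qᴴ = 1 := Matrix.mem_unitaryGroup_iff.1 hQ
    have h2 : Qᴴ * Q = 1 := Matrix.mem_unitaryGroup_iff'.1 hQ
    have h3 := charpoly_units_conj (⟨Q, Qᴴ, h1, h2⟩ : (Matrix ι ι ℂ)ˣ)
      (diagonal (fun i => (l i : ℂ)))
    rw [Units.val_mk, Matrix.inv_eq_right_inv h1] at h3
    rw [h3, charpoly_diagonal, Finset.prod_eq_multiset_prod,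
      ← Polynomial.roots_multiset_prod_X_sub_C (Multiset.map _ (Multiset.map l _)),
      Multiset.map_map, Multiset.map_map]
    rfl
  have h3 : Finset.univ.val.map l = Finset.univ.val.map l' :=
    Multiset.map_injective Complex.ofReal_injective ((key h).symm.trans (key h'))
  have h4 : ∀ x : ℝ, Nonempty ({i // l i = x} ≃ {i // l' i = x}) := fun x => by
    refine Fintype.card_eq.1 ?_
    have := congrArg (Multiset.count x) h3
    rw [Multiset.count_map, Multiset.count_map] at this
    simp only [Fintype.card_subtype, eq_comm (b := x)]
    exact this
  exact ⟨Equiv.ofFiberEquiv fun x => (h4 x).some, fun i => (Equiv.ofFiberEquiv_map _ i).symm⟩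

end UDiag

/-! ### Local analytic eigenvalues of an analytic Hermitian matrix function -/

/-- Implicit function theorem in the analytic category, for one real parameter and
finite-dimensional unknown. -/
lemma exists_analyticAt_implicit {E : Type*} [NormedAddCommGroup E] [NormedSpace ℝ E]
    [FiniteDimensional ℝ E] {F : ℝ × E → E} {t₀ : ℝ} {x₀ : E} (hF : AnalyticAt ℝ F (t₀, x₀))
    (h0 : F (t₀, x₀) = 0) (hinj : ∀ δ, fderiv ℝ F (t₀, x₀) (0, δ) = 0 → δ = 0) :
    ∃ x : ℝ → E, AnalyticAt ℝ x t₀ ∧ x t₀ = x₀ ∧ ∀ᶠ t in 𝓝 t₀, F (t, x t) = 0 := by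
  have : CompleteSpace E := FiniteDimensional.complete ℝ E
  set Φ : ℝ × E → ℝ × E := fun p => (p.1, F p)
  set Φ' : ℝ × E →L[ℝ] ℝ × E := (ContinuousLinearMap.fst ℝ ℝ E).prod (fderiv ℝ F (t₀, x₀))
  have hΦ : ContDiffAt ℝ ⊤ Φ (t₀, x₀) := (analyticAt_fst.prod hF).contDiffAt
  have hΦ' : HasFDerivAt Φ Φ' (t₀, x₀) :=
    hasFDerivAt_fst.prodMk hF.differentiableAt.hasFDerivAt
  have hi : Function.Injective (Φ' : ℝ × E →ₗ[ℝ] ℝ × E) := by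
    rw [injective_iff_map_eq_zero]
    rintro ⟨τ, δ⟩ h
    have h1 : τ = 0 := congrArg Prod.fst h
    subst h1
    have h2 : fderiv ℝ F (t₀, x₀) (0, δ) = 0 := congrArg Prod.snd h
    rw [hinj δ h2]; rfl
  set e : (ℝ × E) ≃L[ℝ] (ℝ × E) :=
    (LinearEquiv.ofInjectiveEndo (Φ' : ℝ × E →ₗ[ℝ] ℝ × E) hi).toContinuousLinearEquiv
  have he : (e : ℝ × E →L[ℝ] ℝ × E) = Φ' := by ext x <;> rfl
  rw [← he] at hΦ'
  have hn : (⊤ : WithTop ℕ∞) ≠ 0 := by simp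
  have hs := hΦ.hasStrictFDerivAt' hΦ' hn
  have hg := hΦ.to_localInverse hΦ' hn
  have hg1 := hΦ.localInverse_apply_image hΦ' hn
  have hr := hs.eventually_right_inverse
  set g := hΦ.localInverse hΦ' hn
  have hp : Φ (t₀, x₀) = (t₀, 0) := by simp [Φ, h0]
  rw [hp] at hg hr hg1
  refine ⟨fun t => (g (t, 0)).2, ?_, by simp [hg1], ?_⟩
  · have h1 : AnalyticAt ℝ (fun t : ℝ => ((t, 0) : ℝ × E)) t₀ := analyticAt_id.prod analyticAt_const
    exact analyticAt_snd.comp (hg.analyticAt.comp_of_eq h1 rfl)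
  · have h1 : Tendsto (fun t : ℝ => ((t, 0) : ℝ × E)) (𝓝 t₀) (𝓝 (t₀, 0)) :=
      (continuous_id.prodMk continuous_const).tendsto t₀
    filter_upwards [h1.eventually hr] with t ht
    have h2 : Φ (g (t, 0)) = (t, 0) := ht
    have h3 : (g (t, 0)).1 = t := congrArg Prod.fst h2
    have h4 : F (g (t, 0)) = 0 := congrArg Prod.snd h2
    rw [show (t, (g (t, 0)).2) = g (t, 0) from Prod.ext h3.symm rfl]
    exact h4

section Splitting

open scoped Matrix.Norms.Operator

variable {ι : Type} [Fintype ι] [DecidableEq ι]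

/-- Conjugate transposition as a continuous real-linear map. -/
def conjTransposeL (ι : Type) [Fintype ι] [DecidableEq ι] :
    Matrix ι ι ℂ →L[ℝ] Matrix ι ι ℂ :=
  LinearMap.toContinuousLinearMap
    { toFun := conjTranspose
      map_add' := conjTranspose_add
      map_smul' := fun c M => by ext i j; simp }

/-- The pinching that keeps the entries `(i, j)` with `d i = d j`, as a continuous real-linear
map. -/
def pinchingL (d : ι → ℝ) : Matrix ι ι ℂ →L[ℝ] Matrix ι ι ℂ :=
  LinearMap.toContinuousLinearMap
    { toFun := fun M => Matrix.of fun i j => if d i = d j then M i j else 0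
      map_add' := fun M N => by ext i j; by_cases h : d i = d j <;> simp [h]
      map_smul' := fun c M => by ext i j; by_cases h : d i = d j <;> simp [h] }

@[simp] lemma conjTransposeL_apply (M : Matrix ι ι ℂ) : conjTransposeL ι M = Mᴴ := rfl

omit [DecidableEq ι] in
lemma pinchingL_apply (d : ι → ℝ) (M : Matrix ι ι ℂ) (i j : ι) :
    pinchingL d M i j = if d i = d j then M i j else 0 := rfl

/-- An analytic family of Hermitian matrices which is diagonal at `t₀` is, near `t₀`, unitarily
and analytically block diagonalised along the eigenspaces of its value at `t₀`. The unitary `Q` is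
the solution near `1` of `(Qᴴ Q - 1) + [D, Qᴴ H Q] + E (Q - Qᴴ) = 0`, where `D` is the value at
`t₀` and `E` the pinching to the blocks of `D`: the first term is Hermitian and the other two
are skew-Hermitian with disjoint supports, so the equation splits in three. -/
lemma exists_unitary_block (d : ι → ℝ) {H : ℝ → Matrix ι ι ℂ} {t₀ : ℝ}
    (hH : AnalyticAt ℝ H t₀) (herm : ∀ᶠ t in 𝓝 t₀, (H t).IsHermitian)
    (h0 : H t₀ = diagonal fun i => (d i : ℂ)) :
    ∃ Q : ℝ → Matrix ι ι ℂ, AnalyticAt ℝ Q t₀ ∧ ∀ᶠ t in 𝓝 t₀, (Q t)ᴴ * Q t = 1 ∧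
      ∀ i j, d i ≠ d j → ((Q t)ᴴ * H t * Q t) i j = 0 := by
  set D : Matrix ι ι ℂ := diagonal fun i => (d i : ℂ) with hD
  set F : ℝ × Matrix ι ι ℂ → Matrix ι ι ℂ := fun p =>
    (conjTransposeL ι p.2 * p.2 - 1) + (D * (conjTransposeL ι p.2 * H p.1 * p.2)
      - (conjTransposeL ι p.2 * H p.1 * p.2) * D) + pinchingL d (p.2 - conjTransposeL ι p.2)
    with hFdef
  have hF : AnalyticAt ℝ F (t₀, 1) := by
    have a2 : AnalyticAt ℝ (fun p : ℝ × Matrix ι ι ℂ => p.2) (t₀, 1) := analyticAt_snd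
    have a1 : AnalyticAt ℝ (fun p : ℝ × Matrix ι ι ℂ => H p.1) (t₀, 1) :=
      hH.comp_of_eq analyticAt_fst rfl
    have a3 : AnalyticAt ℝ (fun p : ℝ × Matrix ι ι ℂ => conjTransposeL ι p.2) (t₀, 1) :=
      ((conjTransposeL ι).analyticAt _).comp a2
    have a4 := (a3.mul a1).mul a2
    exact (((a3.mul a2).sub analyticAt_const).add
      ((analyticAt_const.mul a4).sub (a4.mul analyticAt_const))).add
      (((pinchingL d).analyticAt _).comp (a2.sub a3))
  have hF0 : F (t₀, 1) = 0 := by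
    simp [hFdef, h0]
  have hder : ∀ δ, fderiv ℝ F (t₀, 1) (0, δ) = (δᴴ + δ) + (D * (δᴴ * D + D * δ)
      - (δᴴ * D + D * δ) * D) + pinchingL d (δ - δᴴ) := by
    intro δ
    have hc : HasDerivAt (fun s : ℝ => (1 : Matrix ι ι ℂ) + s • δ) δ 0 := by
      have h := ((hasDerivAt_id (0 : ℝ)).smul_const δ).const_add (1 : Matrix ι ι ℂ)
      rw [one_smul] at h
      exact h
    have hcs : HasDerivAt (fun s : ℝ => conjTransposeL ι ((1 : Matrix ι ι ℂ) + s • δ)) δᴴ 0 :=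
      (conjTransposeL ι).hasFDerivAt.comp_hasDerivAt _ hc
    have hy := (hcs.mul_const D).mul hc
    have htot := (((hcs.mul hc).sub_const 1).add
      ((hy.const_mul D).sub (hy.mul_const D))).add
      ((pinchingL d).hasFDerivAt.comp_hasDerivAt _ (hc.sub hcs))
    have hpath : HasDerivAt (fun s : ℝ => ((t₀, (1 : Matrix ι ι ℂ) + s • δ) : ℝ × Matrix ι ι ℂ))
        (0, δ) 0 := (hasDerivAt_const _ _).prodMk hc
    have hF' : HasFDerivAt F (fderiv ℝ F (t₀, 1))
        ((fun s : ℝ => ((t₀, (1 : Matrix ι ι ℂ) + s • δ) : ℝ × Matrix ι ι ℂ)) 0) := by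
      have h : (t₀, (1 : Matrix ι ι ℂ) + (0 : ℝ) • δ) = (t₀, 1) := by simp
      simp only [h]
      exact hF.differentiableAt.hasFDerivAt
    have h1 := hF'.comp_hasDerivAt _ hpath
    have h2 := h1.unique (h₁ := by
      convert htot using 1
      ext s : 1
      simp [hFdef, h0])
    refine h2.trans ?_
    simp only [zero_smul, add_zero, conjTransposeL_apply, conjTranspose_one, mul_one, one_mul]
    rfl
  have hinj : ∀ δ, fderiv ℝ F (t₀, 1) (0, δ) = 0 → δ = 0 := by
    intro δ h
    rw [hder] at h
    ext i j
    have e1 := congrFun (congrFun h i) j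
    have e2 := congrArg conj (congrFun (congrFun h j) i)
    simp only [hD, Matrix.add_apply, Matrix.sub_apply, Matrix.mul_add, Matrix.add_mul,
      conjTranspose_apply, diagonal_mul, mul_diagonal,
      pinchingL_apply, Matrix.zero_apply, map_add, map_sub, map_mul, Complex.conj_ofReal,
      RCLike.star_def, map_zero, Complex.conj_conj, apply_ite conj] at e1 e2
    by_cases hd : d i = d j
    · simp only [hd, if_true] at e1 e2
      simp only [Matrix.zero_apply]
      linear_combination (1 / 2 : ℂ) * e1
    · simp only [if_neg hd, if_neg (Ne.symm hd)] at e1 e2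
      have hd' : ((d i : ℂ) - d j) ≠ 0 := by
        rw [sub_ne_zero]; exact_mod_cast hd
      have hsum : conj (δ j i) = - δ i j := by linear_combination (1 / 2 : ℂ) * e1 + (1 / 2 : ℂ) * e2
      rw [hsum] at e1
      have : ((d i : ℂ) - d j) ^ 2 * δ i j = 0 := by linear_combination e1
      simpa [hd'] using this
  obtain ⟨Q, hQ, -, hQ0⟩ := exists_analyticAt_implicit hF hF0 hinj
  refine ⟨Q, hQ, ?_⟩
  filter_upwards [hQ0, herm] with t ht hh
  set Y := (Q t)ᴴ * H t * Q t with hY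
  have hYh : Yᴴ = Y := by
    simp [hY, hh.eq, Matrix.mul_assoc]
  have hG : ((Q t)ᴴ * Q t - 1)ᴴ = (Q t)ᴴ * Q t - 1 := by simp
  set G := (Q t)ᴴ * Q t - 1
  have ht' : G + (D * Y - Y * D) + pinchingL d (Q t - (Q t)ᴴ) = 0 := ht
  have key : ∀ i j, G i j = 0 ∧ (d i ≠ d j → Y i j = 0) := by
    intro i j
    have e1 := congrFun (congrFun ht' i) j
    have e2 := congrArg conj (congrFun (congrFun ht' j) i)
    have hy : conj (Y j i) = Y i j := congrFun (congrFun hYh i) j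
    have hg : conj (G j i) = G i j := congrFun (congrFun hG i) j
    simp only [hD, Matrix.add_apply, Matrix.sub_apply,
      conjTranspose_apply, diagonal_mul, mul_diagonal,
      pinchingL_apply, Matrix.zero_apply, map_add, map_sub, map_mul, Complex.conj_ofReal,
      RCLike.star_def, map_zero, Complex.conj_conj, apply_ite conj, hy, hg] at e1 e2
    by_cases hd : d i = d j
    · simp only [hd, if_true] at e1 e2
      refine ⟨?_, fun h => absurd hd h⟩
      linear_combination (1 / 2 : ℂ) * e1 + (1 / 2 : ℂ) * e2
    · simp only [if_neg hd, if_neg (Ne.symm hd)] at e1 e2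
      have hd' : ((d i : ℂ) - d j) ≠ 0 := by
        rw [sub_ne_zero]; exact_mod_cast hd
      refine ⟨by linear_combination (1 / 2 : ℂ) * e1 + (1 / 2 : ℂ) * e2, fun _ => ?_⟩
      have : ((d i : ℂ) - d j) * Y i j = 0 := by
        linear_combination (1 / 2 : ℂ) * e1 - (1 / 2 : ℂ) * e2
      simpa [hd'] using this
  refine ⟨?_, fun i j h => (key i j).2 h⟩
  have : G = 0 := by ext i j; exact (key i j).1
  exact sub_eq_zero.1 this

/-- Restriction to a principal submatrix as a continuous real-linear map. -/
def submatrixL (p : ι → Prop) [DecidablePred p] :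
    Matrix ι ι ℂ →L[ℝ] Matrix {i // p i} {i // p i} ℂ :=
  LinearMap.toContinuousLinearMap
    { toFun := fun M => M.submatrix (fun i => (i : ι)) (fun i => (i : ι))
      map_add' := fun _ _ => rfl
      map_smul' := fun _ _ => rfl }

/-- The real part of the trace as a continuous real-linear map. -/
def traceReL (ι : Type) [Fintype ι] [DecidableEq ι] : Matrix ι ι ℂ →L[ℝ] ℝ :=
  LinearMap.toContinuousLinearMap
    { toFun := fun M => M.trace.re
      map_add' := fun _ _ => by simp
      map_smul' := fun _ _ => by simp }

/-- `LocalEigenvalues ι` says that Rellich's theorem near a point holds for matrices indexed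
by `ι`. -/
def LocalEigenvalues (ι : Type) [Fintype ι] [DecidableEq ι] : Prop :=
  ∀ {H : ℝ → Matrix ι ι ℂ} {t₀ : ℝ}, AnalyticAt ℝ H t₀ → (∀ᶠ t in 𝓝 t₀, (H t).IsHermitian) →
    ∃ l : ι → ℝ → ℝ, (∀ i, AnalyticAt ℝ (l i) t₀) ∧ ∀ᶠ t in 𝓝 t₀, UDiag (H t) (fun i => l i t)

/-- The inductive step: if `G t₀` has two different eigenvalues, the family splits into two smaller
families near `t₀`. -/
lemma exists_local_eigenvalues_of_ne
    (ih : ∀ (κ : Type) [Fintype κ] [DecidableEq κ], Fintype.card κ < Fintype.card ι →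
      LocalEigenvalues κ)
    {G : ℝ → Matrix ι ι ℂ} {t₀ : ℝ} (hG : AnalyticAt ℝ G t₀)
    (hherm : ∀ᶠ t in 𝓝 t₀, (G t).IsHermitian) {d : ι → ℝ} {W : Matrix ι ι ℂ} (hWW : Wᴴ * W = 1)
    (hWG : G t₀ = W * diagonal (fun i => (d i : ℂ)) * Wᴴ) {i₀ i₁ : ι} (hd : d i₁ ≠ d i₀) :
    ∃ l : ι → ℝ → ℝ, (∀ i, AnalyticAt ℝ (l i) t₀) ∧
      ∀ᶠ t in 𝓝 t₀, UDiag (G t) (fun i => l i t) := by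
  have hK : AnalyticAt ℝ (fun t => Wᴴ * G t * W) t₀ :=
    (analyticAt_const.mul hG).mul analyticAt_const
  obtain ⟨Q, hQ, hQe⟩ := exists_unitary_block d hK
    (by filter_upwards [hherm] with t ht
        exact Matrix.isHermitian_conjTranspose_mul_mul _ ht)
    (by rw [hWG]
        calc _ = (Wᴴ * W) * (diagonal fun i => (d i : ℂ)) * (Wᴴ * W) := by
              simp only [Matrix.mul_assoc]
          _ = _ := by simp [hWW])
  set K : ℝ → Matrix ι ι ℂ := fun t => (Q t)ᴴ * (Wᴴ * G t * W) * Q t with hKdef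
  have hKa : AnalyticAt ℝ K t₀ :=
    ((((conjTransposeL ι).analyticAt _).comp hQ).mul hK).mul hQ
  have hKh : ∀ᶠ t in 𝓝 t₀, (K t).IsHermitian := by
    filter_upwards [hherm] with t ht
    exact Matrix.isHermitian_conjTranspose_mul_mul _ (Matrix.isHermitian_conjTranspose_mul_mul _ ht)
  obtain ⟨p, hp⟩ : ∃ p : ι → Prop, ∀ i, p i ↔ d i = d i₀ := ⟨_, fun _ => Iff.rfl⟩
  classical
  have hc1 : Fintype.card {i // p i} < Fintype.card ι :=
    Fintype.card_subtype_lt (x := i₁) ((hp i₁).not.2 hd)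
  have hc2 : Fintype.card {i // ¬p i} < Fintype.card ι :=
    Fintype.card_subtype_lt (x := i₀) (not_not.2 ((hp i₀).2 rfl))
  obtain ⟨l₁, hl₁, hu₁⟩ := ih {i // p i} hc1 (((submatrixL p).analyticAt _).comp hKa)
    (by filter_upwards [hKh] with t ht; exact ht.submatrix _)
  obtain ⟨l₂, hl₂, hu₂⟩ := ih {i // ¬p i} hc2
    (((submatrixL fun i => ¬p i).analyticAt _).comp hKa)
    (by filter_upwards [hKh] with t ht; exact ht.submatrix _)
  refine ⟨fun i t => if h : p i then l₁ ⟨i, h⟩ t else l₂ ⟨i, h⟩ t, ?_, ?_⟩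
  · intro i
    by_cases h : p i
    · simpa only [h, dif_pos] using hl₁ ⟨i, h⟩
    · simpa only [h, dif_neg, not_false_iff] using hl₂ ⟨i, h⟩
  · filter_upwards [hu₁, hu₂, hQe] with t h1 h2 h3
    have hb : UDiag (K t) (fun i => if h : p i then l₁ ⟨i, h⟩ t else l₂ ⟨i, h⟩ t) := by
      have h4 : ∀ i j, ¬(p i ↔ p j) → K t i j = 0 :=
        fun i j hij => h3.2 i j fun h => hij (by rw [hp, hp, h])
      exact UDiag.of_blocks (l₁ := fun i => l₁ i t) (l₂ := fun i => l₂ i t) p h4 h1 h2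
    exact (hb.of_conj h3.1).of_conj hWW

/-- Rellich's theorem near a point. Subtract the mean of the eigenvalues and divide by the highest
possible power of `t - t₀`; the value at `t₀` is then a nonzero traceless Hermitian matrix, so that
it has two different eigenvalues and the family splits into two smaller ones. -/
lemma localEigenvalues (n : ℕ) : ∀ (ι : Type) [Fintype ι] [DecidableEq ι],
    Fintype.card ι = n → LocalEigenvalues ι := by
  induction n using Nat.strong_induction_on with
  | _ n ih =>
  intro ι _ _ hcard H t₀ hH herm
  set τ : ℝ → ℝ := fun t => traceReL ι (H t) / n with hτdef
  have hτ : AnalyticAt ℝ τ t₀ := (((traceReL ι).analyticAt _).comp hH).div_const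
  set g : ℝ → Matrix ι ι ℂ := fun t => H t - τ t • 1 with hgdef
  have hg : AnalyticAt ℝ g t₀ := hH.sub (hτ.smul analyticAt_const)
  by_cases hz : ∀ᶠ t in 𝓝 t₀, g t = 0
  · refine ⟨fun _ => τ, fun _ => hτ, ?_⟩
    filter_upwards [hz] with t ht
    refine ⟨1, one_mem _, ?_⟩
    have h1 : H t = τ t • 1 := sub_eq_zero.1 ht
    rw [h1]
    ext i j
    by_cases hij : i = j
    · subst hij; simp
    · simp [hij]
  obtain ⟨q, G, hG, hG0, hgG⟩ := hg.exists_eventuallyEq_pow_smul_nonzero_iff.2 hz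
  have hpow : ∀ᶠ t in 𝓝[≠] t₀, (t - t₀) ^ q ≠ 0 := by
    filter_upwards [self_mem_nhdsWithin] with t ht
    exact pow_ne_zero _ (sub_ne_zero.2 ht)
  have hherm : ∀ᶠ t in 𝓝 t₀, (G t).IsHermitian := by
    have ha : AnalyticAt ℝ (fun t => conjTransposeL ι (G t) - G t) t₀ :=
      (((conjTransposeL ι).analyticAt _).comp hG).sub hG
    have hf : ∀ᶠ t in 𝓝[≠] t₀, conjTransposeL ι (G t) - G t = 0 := by
      filter_upwards [hpow, nhdsWithin_le_nhds hgG, nhdsWithin_le_nhds herm] with t h1 h2 h3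
      have h4 : conjTransposeL ι (g t) = g t := by
        simp [hgdef, h3.eq]
      rw [h2, map_smul] at h4
      rw [sub_eq_zero]
      exact smul_right_injective _ h1 h4
    filter_upwards [ha.frequently_zero_iff_eventually_zero.1 hf.frequently] with t ht
    exact sub_eq_zero.1 ht
  have htrace : traceReL ι (G t₀) = 0 := by
    have ha : AnalyticAt ℝ (fun t => traceReL ι (G t)) t₀ := ((traceReL ι).analyticAt _).comp hG
    have hf : ∀ᶠ t in 𝓝[≠] t₀, traceReL ι (G t) = 0 := by
      filter_upwards [hpow, nhdsWithin_le_nhds hgG] with t h1 h2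
      have h4 : traceReL ι (g t) = 0 := by
        have h5 : traceReL ι (1 : Matrix ι ι ℂ) = n := by
          simp [traceReL, hcard]
        simp only [hgdef, map_sub, map_smul, h5, hτdef, smul_eq_mul]
        rcases Nat.eq_zero_or_pos n with h0 | h0
        · have : IsEmpty ι := Fintype.card_eq_zero_iff.1 (hcard.trans h0)
          simp [traceReL, h0]
        · field_simp
          ring
      rw [h2, map_smul, smul_eq_mul] at h4
      exact (mul_eq_zero.1 h4).resolve_left h1
    exact (ha.frequently_zero_iff_eventually_zero.1 hf.frequently).self_of_nhds
  have hG0h : (G t₀).IsHermitian := hherm.self_of_nhds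
  obtain ⟨W, hW, hWG⟩ := UDiag.of_isHermitian hG0h
  set d := hG0h.eigenvalues
  have hWW : Wᴴ * W = 1 := Matrix.mem_unitaryGroup_iff'.1 hW
  obtain ⟨i₀, i₁, hd⟩ : ∃ i₀ i₁, d i₁ ≠ d i₀ := by
    by_contra! hc
    have htr : (G t₀).trace.re = ∑ i, d i := by
      rw [hWG, Matrix.trace_mul_comm, ← Matrix.mul_assoc, hWW, Matrix.one_mul, trace_diagonal]
      simp
    have htr' : ∑ i, d i = 0 := htr.symm.trans htrace
    have hd0 : ∀ i, d i = 0 := fun i => by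
      have : ∑ j, d j = Fintype.card ι • d i := by
        rw [Finset.sum_congr rfl fun j _ => hc i j]; simp
      rw [this, smul_eq_zero] at htr'
      have : Nonempty ι := ⟨i⟩
      exact htr'.resolve_left Fintype.card_ne_zero
    apply hG0
    rw [hWG]
    simp [hd0]
  obtain ⟨l, hl, hu⟩ := exists_local_eigenvalues_of_ne
    (fun κ _ _ hκ => ih _ (hcard ▸ hκ) κ rfl) hG hherm hWW hWG hd
  refine ⟨fun i t => (t - t₀) ^ q * l i t + τ t,
    fun i => (((analyticAt_id.sub analyticAt_const).pow q).mul (hl i)).add hτ, ?_⟩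
  filter_upwards [hu, hgG] with t h1 h4
  have hGd := h1.affine ((t - t₀) ^ q) (τ t)
  have : H t = (((t - t₀) ^ q : ℝ) : ℂ) • G t + (τ t : ℂ) • 1 := by
    have : H t = g t + τ t • 1 := by simp [hgdef]
    rw [this, h4]
    ext i j
    simp
  rw [this]
  exact hGd

lemma exists_local_eigenvalues {H : ℝ → Matrix ι ι ℂ} {t₀ : ℝ}
    (hH : ∀ i j, AnalyticAt ℝ (fun t => H t i j) t₀) (herm : ∀ᶠ t in 𝓝 t₀, (H t).IsHermitian) :
    ∃ l : ι → ℝ → ℝ, (∀ i, AnalyticAt ℝ (l i) t₀) ∧ ∀ᶠ t in 𝓝 t₀, UDiag (H t) (fun i => l i t) := by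
  refine localEigenvalues _ ι rfl ?_ herm
  have h1 : H = fun t => ∑ i, ∑ j, H t i j • Matrix.single i j (1 : ℂ) := by
    ext t : 1
    conv_lhs => rw [matrix_eq_sum_single (H t)]
    simp
  rw [h1]
  refine Finset.analyticAt_fun_sum _ fun i _ => Finset.analyticAt_fun_sum _ fun j _ => ?_
  exact (hH i j).smul analyticAt_const

end Splitting

/-! ### Identity theorems on the real line -/

section Identity

variable {E : Type*} [NormedAddCommGroup E] [NormedSpace ℝ E]

lemma eventually_ne_zero_of_analytic {f : ℝ → E} (hf : AnalyticOnNhd ℝ f Set.univ)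
    (h : ∃ t, f t ≠ 0) (t₀ : ℝ) : ∀ᶠ t in 𝓝[≠] t₀, f t ≠ 0 := by
  by_contra hc
  obtain ⟨t, ht⟩ := h
  refine ht (congrFun (hf.eq_of_frequently_eq (g := fun _ => 0) (z₀ := t₀) analyticOnNhd_const ?_) t)
  exact fun h => hc h

lemma dense_of_eventually_nhdsNE {p : ℝ → Prop} (h : ∀ t₀, ∀ᶠ t in 𝓝[≠] t₀, p t) :
    Dense {t | p t} := by
  intro t₀
  rw [mem_closure_iff_frequently]
  exact ((h t₀).frequently).filter_mono nhdsWithin_le_nhds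

omit [NormedSpace ℝ E] in
lemma eq_of_smul_eq_smul {𝕜 : Type*} [NormedField 𝕜] [NormedSpace ℝ 𝕜] [NormedSpace 𝕜 E]
    {d : ℝ → 𝕜} (hd : AnalyticOnNhd ℝ d Set.univ)
    (h : ∃ t, d t ≠ 0) {f g : ℝ → E} (hf : Continuous f) (hg : Continuous g)
    (hfg : ∀ t, d t • f t = d t • g t) : f = g := by
  refine Continuous.ext_on
    (dense_of_eventually_nhdsNE (eventually_ne_zero_of_analytic hd h)) hf hg fun t ht => ?_
  exact smul_right_injective E ht (hfg t)

/-- An analytic function that near some point takes at each place the value of one of finitely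
many analytic functions is one of them. -/
lemma exists_eq_of_frequently {ι : Type*} [Finite ι] {g : ℝ → E} {f : ι → ℝ → E} {U : Set ℝ}
    (hU : IsPreconnected U) (hg : AnalyticOnNhd ℝ g U)
    (hf : ∀ i, AnalyticOnNhd ℝ (f i) U) {t₀ : ℝ} (ht₀ : t₀ ∈ U)
    (h : ∃ᶠ t in 𝓝[≠] t₀, ∃ i, g t = f i t) : ∃ i, Set.EqOn g (f i) U := by
  obtain ⟨i, hi⟩ := frequently_exists.1 h
  exact ⟨i, hg.eqOn_of_preconnected_of_frequently_eq (hf i) hU ht₀ hi⟩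

end Identity

/-! ### Global analytic eigenvalues -/

section Global

variable {ι : Type} [Fintype ι] [DecidableEq ι]

/-- On `s`, the functions `l i` are analytic eigenvalues of `H`, with multiplicities. -/
def EigenvaluesOn (H : ℝ → Matrix ι ι ℂ) (l : ι → ℝ → ℝ) (s : Set ℝ) : Prop :=
  (∀ i, AnalyticOnNhd ℝ (l i) s) ∧ ∀ t ∈ s, UDiag (H t) (fun i => l i t)

variable {H : ℝ → Matrix ι ι ℂ}

lemma EigenvaluesOn.mono {l : ι → ℝ → ℝ} {s t : Set ℝ} (h : EigenvaluesOn H l t) (hst : s ⊆ t) :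
    EigenvaluesOn H l s :=
  ⟨fun i => (h.1 i).mono hst, fun x hx => h.2 x (hst hx)⟩

/-- Analytic eigenvalues on two open sets with connected intersection agree there up to a
permutation, and so can be glued. -/
lemma EigenvaluesOn.glue {l l' : ι → ℝ → ℝ} {s s' : Set ℝ} (h : EigenvaluesOn H l s)
    (h' : EigenvaluesOn H l' s') (hs : IsOpen s) (hs' : IsOpen s')
    (hc : IsPreconnected (s ∩ s')) (hne : (s ∩ s').Nonempty) :
    ∃ l'' : ι → ℝ → ℝ, EigenvaluesOn H l'' (s ∪ s') ∧ ∀ i, Set.EqOn (l'' i) (l i) s := by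
  classical
  obtain ⟨t₀, ht₀⟩ := hne
  have hev : ∀ᶠ t in 𝓝[≠] t₀, ∃ π : Equiv.Perm ι,
      (fun i => l i t) = (fun i => l' (π i) t) := by
    filter_upwards [nhdsWithin_le_nhds ((hs.inter hs').mem_nhds ht₀)] with t ht
    obtain ⟨π, hπ⟩ := (h.2 t ht.1).exists_perm (h'.2 t ht.2)
    exact ⟨π, funext hπ⟩
  obtain ⟨π, hπ⟩ := exists_eq_of_frequently hc (g := fun t i => l i t)
    (f := fun (π : Equiv.Perm ι) t i => l' (π i) t)
    (analyticOnNhd_pi_iff.2 fun i => (h.1 i).mono Set.inter_subset_left)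
    (fun π => analyticOnNhd_pi_iff.2 fun i => (h'.1 (π i)).mono Set.inter_subset_right)
    ht₀ hev.frequently
  have hπ' : ∀ i, ∀ t ∈ s', (if t ∈ s then l i t else l' (π i) t) = l' (π i) t := by
    intro i t ht
    by_cases hts : t ∈ s
    · rw [if_pos hts]; exact congrFun (hπ ⟨hts, ht⟩) i
    · rw [if_neg hts]
  refine ⟨fun i t => if t ∈ s then l i t else l' (π i) t, ⟨fun i t ht => ?_, fun t ht => ?_⟩,
    fun i t ht => if_pos ht⟩
  · rcases ht with ht | ht
    · refine (h.1 i t ht).congr ?_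
      filter_upwards [hs.mem_nhds ht] with x hx
      rw [if_pos hx]
    · refine (h'.1 (π i) t ht).congr ?_
      filter_upwards [hs'.mem_nhds ht] with x hx
      rw [hπ' i x hx]
  · rcases ht with ht | ht
    · simpa only [if_pos ht] using h.2 t ht
    · simp only [fun i => hπ' i t ht]
      obtain ⟨Q, hQ, hH⟩ := h'.2 t ht
      refine ⟨Q.submatrix id π, ?_, ?_⟩
      · apply mem_unitaryGroup_of_conjTranspose_mul
        rw [conjTranspose_submatrix, ← submatrix_mul _ _ _ _ _ Function.bijective_id,
          ← star_eq_conjTranspose, Matrix.mem_unitaryGroup_iff'.1 hQ]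
        exact submatrix_one_equiv π
      · have hd : (diagonal fun i => ((l' (π i) t : ℝ) : ℂ))
            = (diagonal fun i => ((l' i t : ℝ) : ℂ)).submatrix π π := by
          rw [submatrix_diagonal_equiv]; rfl
        rw [hd, conjTranspose_submatrix, submatrix_mul_equiv, submatrix_mul_equiv]
        exact hH

/-- Rellich's theorem: an analytic Hermitian matrix function on the real line has analytic
eigenvalues. -/
theorem exists_eigenvaluesOn_univ (hH : ∀ i j, AnalyticOnNhd ℝ (fun t => H t i j) Set.univ)
    (herm : ∀ t, (H t).IsHermitian) : ∃ l : ι → ℝ → ℝ, EigenvaluesOn H l Set.univ := by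
  have hloc : ∀ t₀, ∃ ε > 0, ∃ l : ι → ℝ → ℝ, EigenvaluesOn H l (Set.Ioo (t₀ - ε) (t₀ + ε)) := by
    intro t₀
    obtain ⟨l, hl, hu⟩ := exists_local_eigenvalues (fun i j => hH i j t₀ (Set.mem_univ _))
      (Eventually.of_forall herm)
    have hl' : ∀ᶠ t in 𝓝 t₀, ∀ i, AnalyticAt ℝ (l i) t :=
      eventually_all.2 fun i => (hl i).eventually_analyticAt
    obtain ⟨ε, hε, hb⟩ := Metric.eventually_nhds_iff_ball.1 (hl'.and hu)
    rw [Real.ball_eq_Ioo] at hb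
    exact ⟨ε, hε, l, fun i t ht => (hb t ht).1 i, fun t ht => (hb t ht).2⟩
  obtain ⟨r, hr, l₀, hl₀⟩ := hloc 0
  rw [zero_sub, zero_add] at hl₀
  -- continuation from `(-r, r)`: the half-widths of the symmetric intervals to which `l₀` extends
  -- are unbounded, because at their supremum both ends could be prolonged by a local solution
  set S : Set ℝ := {c | r ≤ c ∧ ∃ l : ι → ℝ → ℝ, EigenvaluesOn H l (Set.Ioo (-c) c) ∧
    ∀ i, Set.EqOn (l i) (l₀ i) (Set.Ioo (-r) r)} with hS
  have hrS : r ∈ S := ⟨le_rfl, l₀, hl₀, fun i _ _ => rfl⟩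
  have hunb : ¬ BddAbove S := by
    intro hb
    set s := sSup S
    have hrs : r ≤ s := le_csSup hb hrS
    obtain ⟨ε₁, hε₁, l₁, hl₁⟩ := hloc s
    obtain ⟨ε₂, hε₂, l₂, hl₂⟩ := hloc (-s)
    set ε := min ε₁ ε₂
    have hε : 0 < ε := lt_min hε₁ hε₂
    have e1 : ε ≤ ε₁ := min_le_left _ _
    have e2 : ε ≤ ε₂ := min_le_right _ _
    obtain ⟨c, ⟨hrc, l, hl, hll⟩, hcs⟩ := exists_lt_of_lt_csSup ⟨r, hrS⟩ (sub_lt_self s hε)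
    have hcs' : c ≤ s := le_csSup hb ⟨hrc, l, hl, hll⟩
    obtain ⟨l₃, hl₃, h3⟩ := hl.glue hl₁ isOpen_Ioo isOpen_Ioo
      (Set.ordConnected_Ioo.inter Set.ordConnected_Ioo).isPreconnected
      ⟨max ((s - ε + c) / 2) 0, by constructor <;> constructor <;>
        first
        | exact lt_max_of_lt_left (by linarith)
        | exact lt_max_of_lt_right (by linarith)
        | exact max_lt (by linarith) (by linarith)⟩
    have hl₃' : EigenvaluesOn H l₃ (Set.Ioo (-c) (s + ε)) := hl₃.mono fun x hx => by
      rcases lt_or_ge x c with h | h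
      · exact Or.inl ⟨hx.1, h⟩
      · exact Or.inr ⟨by linarith, by linarith [hx.2]⟩
    obtain ⟨l₄, hl₄, h4⟩ := hl₃'.glue hl₂ isOpen_Ioo isOpen_Ioo
      (Set.ordConnected_Ioo.inter Set.ordConnected_Ioo).isPreconnected
      ⟨min ((-s + ε - c) / 2) 0, by constructor <;> constructor <;>
        first
        | exact min_lt_of_left_lt (by linarith)
        | exact min_lt_of_right_lt (by linarith)
        | exact lt_min (by linarith) (by linarith)⟩
    have hmem : s + ε ∈ S := by
      refine ⟨by linarith, l₄, hl₄.mono fun x hx => ?_, fun i x hx => ?_⟩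
      · rcases lt_or_ge (-c) x with h | h
        · exact Or.inl ⟨h, hx.2⟩
        · exact Or.inr ⟨by linarith [hx.1], by linarith⟩
      · have hx1 : x ∈ Set.Ioo (-c) c := ⟨by linarith [hx.1], by linarith [hx.2]⟩
        rw [h4 i ⟨hx1.1, by linarith [hx1.2]⟩, h3 i hx1, hll i hx]
    linarith [le_csSup hb hmem]
  have hext : ∀ c : ℝ, ∃ l : ι → ℝ → ℝ, EigenvaluesOn H l (Set.Ioo (-c) c) ∧
      ∀ i, Set.EqOn (l i) (l₀ i) (Set.Ioo (-r) r) := by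
    intro c
    obtain ⟨c', ⟨-, l, hl, h⟩, hc'⟩ := not_bddAbove_iff.1 hunb c
    exact ⟨l, hl.mono (Set.Ioo_subset_Ioo (by linarith) hc'.le), h⟩
  choose L hL hL0 using hext
  -- the extensions to different intervals are compatible, as all of them continue `l₀`
  have huniq : ∀ c c' : ℝ, 0 < c → c ≤ c' → ∀ i, Set.EqOn (L c i) (L c' i) (Set.Ioo (-c) c) := by
    intro c c' hc hcc i
    refine ((hL c).1 i).eqOn_of_preconnected_of_eventuallyEq
      (((hL c').1 i).mono (Set.Ioo_subset_Ioo (by linarith) hcc)) isPreconnected_Ioo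
      (z₀ := 0) ⟨by linarith, hc⟩ ?_
    filter_upwards [Ioo_mem_nhds (neg_lt_zero.2 hr) hr] with x hx
    rw [hL0 c i hx, hL0 c' i hx]
  have hloceq : ∀ c x : ℝ, x ∈ Set.Ioo (-c) c → ∀ i, L (|x| + 1) i x = L c i x := by
    intro c x hx i
    have hxc : |x| < c := abs_lt.2 hx
    have h0 := abs_nonneg x
    rcases le_total (|x| + 1) c with h | h
    · exact huniq _ _ (by linarith) h i (abs_lt.1 (by linarith))
    · exact (huniq _ _ (by linarith) h i hx).symm
  refine ⟨fun i t => L (|t| + 1) i t, fun i t _ => ?_, fun t _ => ?_⟩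
  · have ht : t ∈ Set.Ioo (-(|t| + 1)) (|t| + 1) := abs_lt.1 (by linarith)
    refine ((hL (|t| + 1)).1 i t ht).congr ?_
    filter_upwards [isOpen_Ioo.mem_nhds ht] with x hx
    exact (hloceq _ x hx i).symm
  · exact (hL (|t| + 1)).2 t (abs_lt.1 (by linarith))

end Global

/-! ### Matrix functions with real-analytic entries -/

/-- All entries of the matrix function `M` are real-analytic on the whole line. -/
def AnM {α β : Type*} (M : ℝ → Matrix α β ℂ) : Prop :=
  ∀ i j, AnalyticOnNhd ℝ (fun t => M t i j) Set.univ

section AnM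

variable {α β γ : Type*}

lemma analyticOnNhd_shift {E : Type*} [NormedAddCommGroup E] [NormedSpace ℝ E] {f : ℝ → E}
    (hf : AnalyticOnNhd ℝ f Set.univ) (c : ℝ) :
    AnalyticOnNhd ℝ (fun t => f (t + c)) Set.univ := fun t _ =>
  (hf (t + c) (Set.mem_univ _)).comp_of_eq (analyticAt_id.add analyticAt_const) rfl

lemma analyticOnNhd_conj {f : ℝ → ℂ} (hf : AnalyticOnNhd ℝ f Set.univ) :
    AnalyticOnNhd ℝ (fun t => conj (f t)) Set.univ := fun t ht =>
  ((Complex.conjCLE : ℂ →L[ℝ] ℂ).analyticAt _).comp (hf t ht)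

lemma analyticOnNhd_ofReal {f : ℝ → ℝ} (hf : AnalyticOnNhd ℝ f Set.univ) :
    AnalyticOnNhd ℝ (fun t => (f t : ℂ)) Set.univ := fun t ht =>
  (Complex.ofRealCLM.analyticAt _).comp (hf t ht)

lemma analyticOnNhd_cexp (c : ℂ) :
    AnalyticOnNhd ℝ (fun t : ℝ => Complex.exp (c * t)) Set.univ := fun t _ =>
  ((analyticAt_cexp (z := c * (t : ℂ))).restrictScalars (𝕜 := ℝ)).comp_of_eq
    (analyticAt_const.mul (Complex.ofRealCLM.analyticAt t)) rfl

lemma AnM.const (M : Matrix α β ℂ) : AnM fun _ => M := fun _ _ => analyticOnNhd_const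

lemma AnM.mul [Fintype β] {M : ℝ → Matrix α β ℂ} {N : ℝ → Matrix β γ ℂ} (hM : AnM M)
    (hN : AnM N) : AnM fun t => M t * N t := fun i j => by
  simp only [Matrix.mul_apply]
  exact Finset.analyticOnNhd_fun_sum _ fun k _ => (hM i k).mul (hN k j)

lemma AnM.sub {M N : ℝ → Matrix α β ℂ} (hM : AnM M) (hN : AnM N) : AnM fun t => M t - N t :=
  fun i j => (hM i j).sub (hN i j)

lemma AnM.smul {f : ℝ → ℂ} {M : ℝ → Matrix α β ℂ} (hf : AnalyticOnNhd ℝ f Set.univ)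
    (hM : AnM M) : AnM fun t => f t • M t :=
  fun i j => hf.mul (hM i j)

lemma AnM.conjTranspose {M : ℝ → Matrix α β ℂ} (hM : AnM M) : AnM fun t => (M t)ᴴ :=
  fun i j => analyticOnNhd_conj (hM j i)

lemma AnM.shift {M : ℝ → Matrix α β ℂ} (hM : AnM M) (c : ℝ) : AnM fun t => M (t + c) :=
  fun i j => analyticOnNhd_shift (hM i j) c

lemma AnM.sum {κ : Type*} (s : Finset κ) {M : κ → ℝ → Matrix α β ℂ} (hM : ∀ k, AnM (M k)) :
    AnM fun t => ∑ k ∈ s, M k t := fun i j => by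
  simp only [Matrix.sum_apply]
  exact Finset.analyticOnNhd_fun_sum _ fun k _ => hM k i j

lemma AnM.diagonal [DecidableEq α] {d : α → ℝ → ℂ}
    (hd : ∀ i, AnalyticOnNhd ℝ (d i) Set.univ) : AnM fun t => Matrix.diagonal fun i => d i t :=
  fun i j => by
    by_cases h : i = j
    · subst h; simpa using hd i
    · simpa [h] using analyticOnNhd_const

/-- Identity theorem for matrix functions. -/
lemma AnM.eq_of_eventually {M N : ℝ → Matrix α β ℂ} (hM : AnM M) (hN : AnM N) {t₀ : ℝ}
    (h : ∀ᶠ t in 𝓝[≠] t₀, M t = N t) (t : ℝ) : M t = N t := by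
  ext i j
  refine congrFun ((hM i j).eq_of_frequently_eq (hN i j) (z₀ := t₀) (Eventually.frequently ?_)) t
  filter_upwards [h] with t ht
  rw [ht]

/-- Cancellation of a scalar analytic factor. -/
lemma AnM.cancel {d : ℝ → ℂ} (hd : AnalyticOnNhd ℝ d Set.univ) (h : ∃ t, d t ≠ 0)
    {M N : ℝ → Matrix α β ℂ} (hM : AnM M) (hN : AnM N) (hMN : ∀ t, d t • M t = d t • N t)
    (t : ℝ) : M t = N t := by
  refine hM.eq_of_eventually hN (t₀ := 0) ?_ t
  filter_upwards [eventually_ne_zero_of_analytic hd h 0] with t ht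
  exact smul_right_injective _ ht (hMN t)

end AnM

/-! ### Division of analytic functions -/

/-- Near a point, domination bounds the order of vanishing of the divisor by that of the
dividend. -/
lemma exists_local_quotient {f d : ℝ → ℂ} {t₀ : ℝ} (hf : AnalyticAt ℝ f t₀)
    (hd : AnalyticAt ℝ d t₀) (h : ∀ᶠ t in 𝓝 t₀, ‖f t‖ ≤ ‖d t‖)
    (hd0 : ¬ ∀ᶠ t in 𝓝 t₀, d t = 0) :
    ∃ g : ℝ → ℂ, AnalyticAt ℝ g t₀ ∧ ∀ᶠ t in 𝓝 t₀, f t = d t * g t := by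
  by_cases hf0 : ∀ᶠ t in 𝓝 t₀, f t = 0
  · exact ⟨fun _ => 0, analyticAt_const, by simpa using hf0⟩
  obtain ⟨n, D, hD, hD0, hdD⟩ := hd.exists_eventuallyEq_pow_smul_nonzero_iff.2 hd0
  obtain ⟨m, F, hF, hF0, hfF⟩ := hf.exists_eventuallyEq_pow_smul_nonzero_iff.2 hf0
  have hnm : n ≤ m := by
    by_contra! hlt
    obtain ⟨k, rfl⟩ := Nat.exists_eq_add_of_lt hlt
    have h1 : ∀ᶠ t in 𝓝[≠] t₀, ‖F t‖ ≤ ‖(t - t₀) ^ (k + 1)‖ * ‖D t‖ := by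
      filter_upwards [self_mem_nhdsWithin, nhdsWithin_le_nhds h, nhdsWithin_le_nhds hdD,
        nhdsWithin_le_nhds hfF] with t ht h2 h3 h4
      have hpos : 0 < ‖(t - t₀) ^ m‖ := norm_pos_iff.2 (pow_ne_zero _ (sub_ne_zero.2 ht))
      rw [h3, h4, norm_smul, norm_smul, add_assoc, pow_add, norm_mul, mul_assoc] at h2
      exact le_of_mul_le_mul_left h2 hpos
    have h2 : Tendsto (fun t => ‖(t - t₀) ^ (k + 1)‖ * ‖D t‖) (𝓝[≠] t₀) (𝓝 0) := by
      have : ContinuousAt (fun t => ‖(t - t₀) ^ (k + 1)‖ * ‖D t‖) t₀ := by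
        have := hD.continuousAt
        fun_prop
      have h3 := this.tendsto.mono_left (nhdsWithin_le_nhds (s := {t₀}ᶜ))
      simpa using h3
    have h3 : Tendsto (fun t => ‖F t‖) (𝓝[≠] t₀) (𝓝 ‖F t₀‖) :=
      hF.continuousAt.norm.tendsto.mono_left nhdsWithin_le_nhds
    have h4 := le_of_tendsto_of_tendsto h3 h2 h1
    exact hF0 (norm_le_zero_iff.1 h4)
  refine ⟨fun t => (t - t₀) ^ (m - n) • (F t / D t), ?_, ?_⟩
  · exact ((analyticAt_id.sub analyticAt_const).pow _).smul (hF.div hD hD0)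
  · filter_upwards [hdD, hfF, hD.continuousAt.eventually_ne hD0] with t h1 h2 h3
    rw [h1, h2]
    simp only [Complex.real_smul, Complex.ofReal_pow]
    rw [show m = n + (m - n) by omega, pow_add, Nat.add_sub_cancel_left]
    field_simp

/-- An analytic function dominated in absolute value by another one is divisible by it. -/
lemma exists_analytic_quotient {f d : ℝ → ℂ} (hf : AnalyticOnNhd ℝ f Set.univ)
    (hd : AnalyticOnNhd ℝ d Set.univ) (h : ∀ t, ‖f t‖ ≤ ‖d t‖) (hd0 : ∃ t, d t ≠ 0) :
    ∃ g : ℝ → ℂ, AnalyticOnNhd ℝ g Set.univ ∧ ∀ t, f t = d t * g t := by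
  have hne := eventually_ne_zero_of_analytic hd hd0
  have hloc : ∀ t₀, ∃ g : ℝ → ℂ, AnalyticAt ℝ g t₀ ∧ ∀ᶠ t in 𝓝 t₀, f t = d t * g t := by
    intro t₀
    refine exists_local_quotient (hf t₀ (Set.mem_univ _)) (hd t₀ (Set.mem_univ _))
      (Eventually.of_forall h) fun hz => ?_
    obtain ⟨t, h1, h2⟩ := ((hne t₀).and (nhdsWithin_le_nhds hz)).exists
    exact h1 h2
  choose G hG hGe using hloc
  refine ⟨fun t => G t t, fun t₀ _ => (hG t₀).congr ?_, fun t => (hGe t).self_of_nhds⟩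
  have h1 : ∀ᶠ t in 𝓝[≠] t₀, G t₀ t = G t t := by
    filter_upwards [hne t₀, nhdsWithin_le_nhds (hGe t₀)] with t h2 h3
    exact mul_left_cancel₀ h2 (h3.symm.trans (hGe t).self_of_nhds)
  filter_upwards [eventually_nhdsWithin_iff.1 h1] with t ht
  by_cases h : t = t₀
  · rw [h]
  · exact ht h

/-- Division of an analytic matrix function by the entries of a diagonal one. -/
lemma AnM.exists_quotient {α β : Type*} {N : ℝ → Matrix α β ℂ} (hN : AnM N) {d : β → ℝ → ℂ}
    (hd : ∀ j, AnalyticOnNhd ℝ (d j) Set.univ) (h : ∀ t i j, ‖N t i j‖ ≤ ‖d j t‖)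
    (hd0 : ∀ j, ∃ t, d j t ≠ 0) :
    ∃ M : ℝ → Matrix α β ℂ, AnM M ∧ ∀ t i j, N t i j = d j t * M t i j := by
  have := fun i j => exists_analytic_quotient (hN i j) (hd j) (fun t => h t i j) (hd0 j)
  choose g hg hg' using this
  exact ⟨fun t => Matrix.of fun i j => g i j t, fun i j => hg i j, fun t i j => hg' i j t⟩

/-! ### Analytic singular values and analytic unit vectors -/

section Wielandt

variable {m n : Type} [Fintype m] [DecidableEq m] [Fintype n] [DecidableEq n]

/-- Every eigenvalue of `Bᴴ B` is the square of an eigenvalue of `[0 B; Bᴴ 0]`. -/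
lemma UDiag.wielandt_exists_sq {B : Matrix m n ℂ} {l : m ⊕ n → ℝ}
    (h : UDiag (fromBlocks 0 B Bᴴ 0) l) {v : n → ℂ} (hv : v ≠ 0) {x : ℝ}
    (hx : (Bᴴ * B) *ᵥ v = (x : ℂ) • v) : ∃ i, l i ^ 2 = x := by
  obtain ⟨Q, hQ, hJ⟩ := h
  have h2 : Qᴴ * Q = 1 := Matrix.mem_unitaryGroup_iff'.1 hQ
  have h1 : Q * Qᴴ = 1 := Matrix.mem_unitaryGroup_iff.1 hQ
  set y : m ⊕ n → ℂ := Qᴴ *ᵥ Sum.elim (0 : m → ℂ) v with hy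
  have hQy : Q *ᵥ y = Sum.elim (0 : m → ℂ) v := by rw [hy, mulVec_mulVec, h1, one_mulVec]
  have hy0 : y ≠ 0 := by
    intro h0
    rw [h0, mulVec_zero] at hQy
    exact hv (funext fun i => (congrFun hQy (Sum.inr i)).symm)
  have hJJ : (fromBlocks 0 B Bᴴ 0 * fromBlocks 0 B Bᴴ 0) *ᵥ Sum.elim 0 v
      = (x : ℂ) • (Sum.elim 0 v : m ⊕ n → ℂ) := by
    rw [fromBlocks_multiply, fromBlocks_mulVec]
    simp only [Matrix.zero_mul, Matrix.mul_zero, zero_add, add_zero, zero_mulVec, mulVec_zero,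
      Sum.elim_comp_inl, Sum.elim_comp_inr, hx]
    ext (i | i) <;> simp
  have hd : (diagonal (fun i => (l i : ℂ)) * diagonal (fun i => (l i : ℂ))) *ᵥ y = (x : ℂ) • y := by
    calc _ = Qᴴ *ᵥ ((fromBlocks 0 B Bᴴ 0 * fromBlocks 0 B Bᴴ 0) *ᵥ Sum.elim 0 v) := by
          rw [hJ, hy]
          simp only [mulVec_mulVec]
          congr 1
          calc _ = (Qᴴ * Q) * diagonal (fun i => (l i : ℂ)) * (Qᴴ * Q) *
                diagonal (fun i => (l i : ℂ)) * Qᴴ := by simp [h2]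
            _ = _ := by simp only [Matrix.mul_assoc]
      _ = _ := by rw [hJJ, mulVec_smul]
  obtain ⟨i, hi⟩ := Function.ne_iff.1 hy0
  refine ⟨i, ?_⟩
  have h3 := congrFun hd i
  rw [diagonal_mul_diagonal, mulVec_diagonal, Pi.smul_apply, smul_eq_mul] at h3
  have h4 := mul_right_cancel₀ hi h3
  rw [sq]
  exact_mod_cast h4

lemma UDiag.exists_eigenvector {ι : Type} [Fintype ι] [DecidableEq ι] {H : Matrix ι ι ℂ}
    {l : ι → ℝ} (h : UDiag H l) (i : ι) : ∃ w : ι → ℂ, w ≠ 0 ∧ H *ᵥ w = (l i : ℂ) • w := by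
  obtain ⟨Q, hQ, hJ⟩ := h
  have h2 : Qᴴ * Q = 1 := Matrix.mem_unitaryGroup_iff'.1 hQ
  refine ⟨Q *ᵥ Pi.single i 1, fun h0 => ?_, ?_⟩
  · have h3 : Qᴴ *ᵥ (Q *ᵥ Pi.single i 1) = Pi.single i 1 := by rw [mulVec_mulVec, h2, one_mulVec]
    rw [h0, mulVec_zero] at h3
    simpa using congrFun h3 i
  · rw [hJ, mulVec_mulVec, Matrix.mul_assoc, h2, Matrix.mul_one, ← mulVec_mulVec, ← mulVec_smul]
    congr 1
    ext j
    rw [mulVec_diagonal]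
    by_cases hj : j = i
    · subst hj; simp
    · simp [hj]

/-- The square of a nonzero eigenvalue of `[0 B; Bᴴ 0]` is an eigenvalue of `Bᴴ B`. -/
lemma UDiag.wielandt_exists_vec {B : Matrix m n ℂ} {l : m ⊕ n → ℝ}
    (h : UDiag (fromBlocks 0 B Bᴴ 0) l) {i : m ⊕ n} (hi : l i ≠ 0) :
    ∃ v : n → ℂ, v ≠ 0 ∧ (Bᴴ * B) *ᵥ v = ((l i ^ 2 : ℝ) : ℂ) • v := by
  obtain ⟨w, hw0, hJw⟩ := h.exists_eigenvector i
  rw [fromBlocks_mulVec] at hJw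
  have ha : B *ᵥ (w ∘ Sum.inr) = (l i : ℂ) • (w ∘ Sum.inl) := by
    ext j
    simpa using congrFun hJw (Sum.inl j)
  have hb : Bᴴ *ᵥ (w ∘ Sum.inl) = (l i : ℂ) • (w ∘ Sum.inr) := by
    ext j
    simpa using congrFun hJw (Sum.inr j)
  have hl : (l i : ℂ) ≠ 0 := by exact_mod_cast hi
  refine ⟨w ∘ Sum.inr, fun h0 => hw0 ?_, ?_⟩
  · rw [h0, mulVec_zero, eq_comm, smul_eq_zero] at ha
    have ha' := ha.resolve_left hl
    ext (j | j)
    · exact congrFun ha' j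
    · exact congrFun h0 j
  · rw [← mulVec_mulVec, ha, mulVec_smul, hb, smul_smul]
    push_cast
    rw [sq]

/-- Analytic signed singular values: the analytic eigenvalues of `[0 A; Aᴴ 0]`. -/
lemma exists_wielandt {A : ℝ → Matrix m n ℂ} (hA : AnM A) :
    ∃ l : m ⊕ n → ℝ → ℝ, (∀ i, AnalyticOnNhd ℝ (l i) Set.univ) ∧
      ∀ t, UDiag (fromBlocks 0 (A t) (A t)ᴴ 0) (fun i => l i t) := by
  obtain ⟨l, hl, hu⟩ := exists_eigenvaluesOn_univ (H := fun t => fromBlocks 0 (A t) (A t)ᴴ 0)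
    (by
      rintro (i | i) (j | j)
      · exact analyticOnNhd_const
      · exact hA i j
      · exact hA.conjTranspose i j
      · exact analyticOnNhd_const)
    (fun t => by
      rw [Matrix.IsHermitian, fromBlocks_conjTranspose]
      simp)
  exact ⟨l, hl, fun t => hu t (Set.mem_univ _)⟩

/-- The norm of an analytic vector function is, up to signs, an analytic function. -/
lemma exists_signed_norm {w : ℝ → Matrix n Unit ℂ} (hw : AnM w) :
    ∃ q : ℝ → ℝ, AnalyticOnNhd ℝ q Set.univ ∧ ∀ t, (w t)ᴴ * w t = ((q t : ℂ) ^ 2) • 1 := by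
  obtain ⟨l, hl, hu⟩ := exists_wielandt hw
  have hg : ∀ t, ∃ x : ℝ, ((w t)ᴴ * w t) () () = x := fun t =>
    ⟨∑ i, ‖w t i ()‖ ^ 2, by
      simp only [Matrix.mul_apply, conjTranspose_apply, RCLike.star_def, Complex.conj_mul']
      push_cast
      rfl⟩
  obtain ⟨i, hi⟩ := exists_eq_of_frequently (U := Set.univ) (t₀ := 0) isPreconnected_univ
    (g := fun t => ((w t)ᴴ * w t) () ()) (f := fun i t => (l i t : ℂ) ^ 2)
    ((hw.conjTranspose.mul hw) () ()) (fun i => (analyticOnNhd_ofReal (hl i)).pow 2)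
    (Set.mem_univ _) (Frequently.of_forall fun t => by
      obtain ⟨x, hx⟩ := hg t
      obtain ⟨i, hi⟩ := (hu t).wielandt_exists_sq (v := 1) one_ne_zero (x := x) (by
        ext ⟨⟩
        simp [mulVec, dotProduct, hx])
      refine ⟨i, ?_⟩
      rw [hx, ← hi]
      push_cast
      rfl)
  refine ⟨l i, hl i, fun t => ?_⟩
  refine Matrix.ext fun _ _ => (hi (Set.mem_univ t)).trans ?_
  simp

end Wielandt

/-! ### Analytic orthonormal frames of analytic orthogonal projections -/

section Frame

variable {n : Type} [Fintype n] [DecidableEq n]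

omit [DecidableEq n] in
lemma norm_projection_apply_le {P : Matrix n n ℂ} (hPh : Pᴴ = P) (hPP : P * P = P) (i j : n) :
    ‖P i j‖ ≤ 1 := by
  have h1 : Pᴴ * P = P := by rw [hPh, hPP]
  have h2 := congrFun (congrFun h1 j) j
  simp only [Matrix.mul_apply, conjTranspose_apply, RCLike.star_def, Complex.conj_mul'] at h2
  have h3 : ∑ k, ‖P k j‖ ^ 2 = (P j j).re := by
    rw [← h2]
    simp only [Complex.re_sum]
    norm_cast
  have h4 : ∀ k, ‖P k j‖ ^ 2 ≤ (P j j).re := fun k => by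
    rw [← h3]
    exact Finset.single_le_sum (f := fun k => ‖P k j‖ ^ 2) (fun _ _ => sq_nonneg _)
      (Finset.mem_univ k)
  have h5 := Complex.re_le_norm (P j j)
  have h6 : ‖P j j‖ ≤ 1 := by nlinarith [norm_nonneg (P j j), h4 j]
  nlinarith [norm_nonneg (P i j), h4 i]

/-- A nonzero `T`-periodic analytic vector function is a scalar multiple of a `T`-periodic analytic
unit vector function. For `T = 0` periodicity is no condition. -/
lemma exists_unit_vector (T : ℝ) {w : ℝ → Matrix n Unit ℂ} (hw : AnM w)
    (hwT : ∀ t, w (t + T) = w t) (hw0 : ∃ t, w t ≠ 0) :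
    ∃ (v : ℝ → Matrix n Unit ℂ) (d : ℝ → ℂ), AnM v ∧ (∀ t, v (t + T) = v t) ∧
      (∀ t, (v t)ᴴ * v t = 1) ∧ AnalyticOnNhd ℝ d Set.univ ∧ (∃ t, d t ≠ 0) ∧
      ∀ t, w t = d t • v t := by
  obtain ⟨q, hq, hqw⟩ := exists_signed_norm hw
  have hqc := analyticOnNhd_ofReal hq
  have hle : ∀ t i j, ‖w t i j‖ ≤ ‖(q t : ℂ)‖ := by
    intro t i j
    have h1 := congrFun (congrFun (hqw t) j) j
    simp only [Matrix.mul_apply, conjTranspose_apply, RCLike.star_def, Complex.conj_mul',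
      Matrix.smul_apply, one_apply_eq, smul_eq_mul, mul_one] at h1
    have h2 : ∑ k, ‖w t k j‖ ^ 2 = q t ^ 2 := by exact_mod_cast h1
    have h3 : ‖w t i j‖ ^ 2 ≤ q t ^ 2 := by
      rw [← h2]
      exact Finset.single_le_sum (f := fun k => ‖w t k j‖ ^ 2) (fun _ _ => sq_nonneg _)
        (Finset.mem_univ i)
    rw [Complex.norm_real, Real.norm_eq_abs, ← abs_norm (w t i j)]
    exact sq_le_sq.1 h3
  have hq0 : ∃ t, (q t : ℂ) ≠ 0 := by
    by_contra! h
    obtain ⟨t, ht⟩ := hw0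
    apply ht
    ext i j
    have := hle t i j
    rw [h, norm_zero] at this
    exact norm_le_zero_iff.1 this
  obtain ⟨v, hv, hwv'⟩ := hw.exists_quotient (d := fun _ t => (q t : ℂ)) (fun _ => hqc) hle
    (fun _ => hq0)
  have hwv : ∀ t, w t = (q t : ℂ) • v t := fun t => by ext i j; exact hwv' t i j
  have hvv : ∀ t, (v t)ᴴ * v t = 1 := by
    refine fun t => AnM.cancel (hqc.pow 2) ?_ (hv.conjTranspose.mul hv) (AnM.const 1) ?_ t
    · obtain ⟨t, ht⟩ := hq0
      exact ⟨t, pow_ne_zero 2 ht⟩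
    · intro t
      have := hqw t
      rw [hwv t, conjTranspose_smul, Matrix.smul_mul, Matrix.mul_smul, smul_smul] at this
      simpa [sq] using this
  -- `q ^ 2` is `T`-periodic, so `q` is `T`-periodic up to a sign
  have hsign : (∀ t, (q (t + T) : ℂ) = q t) ∨ ∀ t, (q (t + T) : ℂ) = -q t := by
    have h1 : ∀ t, ((q (t + T) : ℂ)) ^ 2 = (q t : ℂ) ^ 2 := by
      intro t
      have := (hqw (t + T)).symm.trans ((hwT t).symm ▸ hqw t)
      simpa using congrFun (congrFun this ()) ()
    obtain ⟨b, hb⟩ := exists_eq_of_frequently (U := Set.univ) (t₀ := 0) isPreconnected_univ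
      (g := fun t => (q (t + T) : ℂ)) (f := fun (b : Bool) t => if b then (q t : ℂ) else -q t)
      (analyticOnNhd_shift hqc T)
      (by rintro (_ | _); exacts [hqc.neg, hqc])
      (Set.mem_univ _) (Frequently.of_forall fun t => by
        rcases sq_eq_sq_iff_eq_or_eq_neg.1 (h1 t) with h | h
        · exact ⟨true, by simpa using h⟩
        · exact ⟨false, by simpa using h⟩)
    cases b
    · exact Or.inr fun t => by simpa using hb (Set.mem_univ t)
    · exact Or.inl fun t => by simpa using hb (Set.mem_univ t)
  rcases hsign with hs | hs
  · refine ⟨v, fun t => q t, hv, fun t => ?_, hvv, hqc, hq0, hwv⟩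
    refine AnM.cancel hqc hq0 (hv.shift T) hv (fun t => ?_) t
    have := hwT t
    rwa [hwv, hwv, hs] at this
  · have hT : T ≠ 0 := by
      rintro rfl
      obtain ⟨t, ht⟩ := hq0
      have := hs t
      rw [add_zero, self_eq_neg] at this
      exact ht this
    have hvT : ∀ t, v (t + T) = - v t := by
      have h0 : AnM fun t => -v t := fun i j => (hv i j).neg
      refine fun t => AnM.cancel hqc hq0 (hv.shift T) h0 (fun t => ?_) t
      have := hwT t
      rw [hwv, hwv, hs] at this
      rw [smul_neg, ← this]
      simp
    -- a half-turn of phase over the period compensates the sign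
    set c : ℂ := Complex.I * Real.pi / T with hc
    have hcT : c * T = Real.pi * Complex.I := by
      have : (T : ℂ) ≠ 0 := by exact_mod_cast hT
      rw [hc]; field_simp
    refine ⟨fun t => Complex.exp (c * t) • v t, fun t => Complex.exp (-c * t) * q t,
      AnM.smul (analyticOnNhd_cexp c) hv, fun t => ?_, fun t => ?_,
      (analyticOnNhd_cexp _).mul hqc, ?_, fun t => ?_⟩
    · beta_reduce
      rw [hvT, Complex.ofReal_add, mul_add, Complex.exp_add, hcT, Complex.exp_pi_mul_I]
      simp
    · rw [conjTranspose_smul, Matrix.smul_mul, Matrix.mul_smul, smul_smul, hvv]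
      have : star (Complex.exp (c * t)) * Complex.exp (c * t) = 1 := by
        rw [RCLike.star_def, ← Complex.exp_conj, ← Complex.exp_add, hc]
        simp [neg_div]
      rw [this, one_smul]
    · obtain ⟨t, ht⟩ := hq0
      exact ⟨t, mul_ne_zero (Complex.exp_ne_zero _) ht⟩
    · rw [smul_smul, mul_right_comm, ← Complex.exp_add, hwv]
      simp

/-- A `T`-periodic analytic family of orthogonal projections is `Q Qᴴ` for a `T`-periodic analytic
family of orthonormal frames `Q`: split off one analytic unit vector after the other. -/
lemma exists_frame_of_trace_le (T : ℝ) (N : ℕ) : ∀ {P : ℝ → Matrix n n ℂ}, AnM P →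
    (∀ t, (P t)ᴴ = P t) → (∀ t, P t * P t = P t) → (∀ t, P (t + T) = P t) →
    (∀ t, (P t).trace.re ≤ N) →
    ∃ (κ : Type) (_ : Fintype κ) (_ : DecidableEq κ) (Q : ℝ → Matrix n κ ℂ), AnM Q ∧
      (∀ t, Q (t + T) = Q t) ∧ (∀ t, (Q t)ᴴ * Q t = 1) ∧ ∀ t, Q t * (Q t)ᴴ = P t := by
  induction N with
  | zero =>
    intro P hP hPh hPP _ htr
    refine ⟨Empty, inferInstance, inferInstance, fun _ => 0, AnM.const 0, fun _ => rfl,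
      fun _ => by ext ⟨⟩, fun t => ?_⟩
    have h1 : (P t)ᴴ * P t = P t := by rw [hPh, hPP]
    have h2 : (P t).trace.re = ∑ j, ∑ i, ‖P t i j‖ ^ 2 := by
      conv_lhs => rw [← h1]
      simp only [Matrix.trace, diag_apply, Matrix.mul_apply, conjTranspose_apply, RCLike.star_def,
        Complex.conj_mul', Complex.re_sum]
      norm_cast
    have h3 := htr t
    rw [h2, Nat.cast_zero] at h3
    have h4 := le_antisymm h3 (Finset.sum_nonneg fun j _ => Finset.sum_nonneg fun i _ => sq_nonneg _)
    ext i j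
    have h5 := (Finset.sum_eq_zero_iff_of_nonneg
      fun j _ => Finset.sum_nonneg fun i _ => sq_nonneg _).1 h4 j (Finset.mem_univ _)
    have h6 := (Finset.sum_eq_zero_iff_of_nonneg fun i _ => sq_nonneg _).1 h5 i (Finset.mem_univ _)
    have h7 : ‖P t i j‖ ^ 2 = 0 := h6
    have h8 : P t i j = 0 := norm_eq_zero.1 ((pow_eq_zero_iff two_ne_zero).1 h7)
    simp [h8]
  | succ N ih =>
    intro P hP hPh hPP hPT htr
    by_cases h0 : ∀ t, P t = 0
    · exact ⟨Empty, inferInstance, inferInstance, fun _ => 0, AnM.const 0, fun _ => rfl,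
        fun _ => by ext ⟨⟩, fun t => by rw [h0]; simp⟩
    push Not at h0
    obtain ⟨t₁, ht₁⟩ := h0
    obtain ⟨j, hj⟩ : ∃ j, ∃ i, P t₁ i j ≠ 0 := by
      by_contra! hc
      exact ht₁ (by ext i j; exact hc j i)
    obtain ⟨v, d, hv, hvT, hvv, hd, hd0, hwv⟩ := exists_unit_vector T
      (w := fun t => (P t).submatrix id fun _ => j) (fun i _ => hP i j)
      (fun t => by simp only [hPT]) ⟨t₁, fun h => by
        obtain ⟨i, hi⟩ := hj
        exact hi (congrFun (congrFun h i) ())⟩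
    have hPv : ∀ t, P t * v t = v t := by
      refine fun t => AnM.cancel hd hd0 (hP.mul hv) hv (fun t => ?_) t
      rw [← Matrix.mul_smul, ← hwv]
      ext i k
      exact congrFun (congrFun (hPP t) i) j
    have hvP : ∀ t, (v t)ᴴ * P t = (v t)ᴴ := fun t => by
      conv_rhs => rw [← hPv t, conjTranspose_mul, hPh]
    have e1 : ∀ t, v t * (v t)ᴴ * (v t * (v t)ᴴ) = v t * (v t)ᴴ := fun t => by
      rw [Matrix.mul_assoc, ← Matrix.mul_assoc (v t)ᴴ, hvv, Matrix.one_mul]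
    have e2 : ∀ t, P t * (v t * (v t)ᴴ) = v t * (v t)ᴴ := fun t => by
      rw [← Matrix.mul_assoc, hPv]
    have e3 : ∀ t, v t * (v t)ᴴ * P t = v t * (v t)ᴴ := fun t => by
      rw [Matrix.mul_assoc, hvP]
    obtain ⟨κ, _, _, Q, hQ, hQT, hQQ, hQP⟩ := ih (P := fun t => P t - v t * (v t)ᴴ)
      (hP.sub (hv.mul hv.conjTranspose))
      (fun t => by simp [hPh])
      (fun t => by
        rw [Matrix.mul_sub, Matrix.sub_mul, Matrix.sub_mul, e1, e2, e3, hPP]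
        simp)
      (fun t => by rw [hPT, hvT])
      (fun t => by
        have h1 := htr t
        rw [trace_sub, trace_mul_comm (v t), hvv, trace_one, Complex.sub_re]
        push_cast at h1
        simp only [Fintype.card_unit, Nat.cast_one, Complex.one_re]
        linarith)
    have hQv : ∀ t, (Q t)ᴴ * v t = 0 := fun t => by
      calc (Q t)ᴴ * v t = (Q t)ᴴ * Q t * (Q t)ᴴ * v t := by rw [hQQ, Matrix.one_mul]
        _ = (Q t)ᴴ * (Q t * (Q t)ᴴ * v t) := by simp only [Matrix.mul_assoc]
        _ = 0 := by
          rw [hQP, Matrix.sub_mul, hPv, Matrix.mul_assoc, hvv, Matrix.mul_one, sub_self,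
            Matrix.mul_zero]
    have hvQ : ∀ t, (v t)ᴴ * Q t = 0 := fun t => by
      have := congrArg Matrix.conjTranspose (hQv t)
      simpa using this
    refine ⟨κ ⊕ Unit, inferInstance, inferInstance, fun t => fromCols (Q t) (v t), ?_, ?_, ?_, ?_⟩
    · rintro i (k | k)
      · exact hQ i k
      · exact hv i k
    · intro t
      beta_reduce
      rw [hQT, hvT]
    · intro t
      rw [conjTranspose_fromCols_eq_fromRows_conjTranspose, fromRows_mul_fromCols, hQQ, hQv, hvQ,
        hvv, fromBlocks_one]
    · intro t
      rw [conjTranspose_fromCols_eq_fromRows_conjTranspose, fromCols_mul_fromRows, hQP]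
      simp

lemma exists_frame (T : ℝ) {P : ℝ → Matrix n n ℂ} (hP : AnM P) (hPh : ∀ t, (P t)ᴴ = P t)
    (hPP : ∀ t, P t * P t = P t) (hPT : ∀ t, P (t + T) = P t) :
    ∃ (κ : Type) (_ : Fintype κ) (_ : DecidableEq κ) (Q : ℝ → Matrix n κ ℂ), AnM Q ∧
      (∀ t, Q (t + T) = Q t) ∧ (∀ t, (Q t)ᴴ * Q t = 1) ∧ ∀ t, Q t * (Q t)ᴴ = P t := by
  refine exists_frame_of_trace_le T (Fintype.card n) hP hPh hPP hPT fun t => ?_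
  have h1 : ∀ i, (P t i i).re ≤ 1 := fun i =>
    (Complex.re_le_norm _).trans (norm_projection_apply_le (hPh t) (hPP t) i i)
  calc (P t).trace.re = ∑ i, (P t i i).re := by simp [Matrix.trace]
    _ ≤ ∑ _i : n, (1 : ℝ) := Finset.sum_le_sum fun i _ => h1 i
    _ = _ := by simp

/-- Completion of a `T`-periodic analytic family of orthonormal columns to a `T`-periodic analytic
family of unitary matrices, the given columns being put at the places `e x`. -/
lemma exists_unitary_completion (T : ℝ) {ι : Type} [Fintype ι] [DecidableEq ι]
    {V : ℝ → Matrix n ι ℂ} (hV : AnM V) (hVT : ∀ t, V (t + T) = V t)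
    (hVV : ∀ t, (V t)ᴴ * V t = 1) {e : ι → n} (he : Function.Injective e) :
    ∃ W : ℝ → Matrix n n ℂ, AnM W ∧ (∀ t, W (t + T) = W t) ∧
      (∀ t, W t ∈ Matrix.unitaryGroup n ℂ) ∧ ∀ t, (W t).submatrix id e = V t := by
  have hVh : ∀ t, V t * (V t)ᴴ * (V t * (V t)ᴴ) = V t * (V t)ᴴ := fun t => by
    rw [Matrix.mul_assoc, ← Matrix.mul_assoc (V t)ᴴ, hVV, Matrix.one_mul]
  obtain ⟨κ, _, _, Q, hQ, hQT, hQQ, hQP⟩ := exists_frame T (P := fun t => 1 - V t * (V t)ᴴ)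
    ((AnM.const 1).sub (hV.mul hV.conjTranspose)) (fun t => by simp)
    (fun t => by simp [Matrix.mul_sub, Matrix.sub_mul, hVh]) (fun t => by rw [hVT])
  have hQV : ∀ t, (Q t)ᴴ * V t = 0 := fun t => by
    calc (Q t)ᴴ * V t = (Q t)ᴴ * Q t * (Q t)ᴴ * V t := by rw [hQQ, Matrix.one_mul]
      _ = (Q t)ᴴ * (Q t * (Q t)ᴴ * V t) := by simp only [Matrix.mul_assoc]
      _ = 0 := by
        rw [hQP, Matrix.sub_mul, Matrix.mul_assoc, hVV, Matrix.mul_one, Matrix.one_mul, sub_self,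
          Matrix.mul_zero]
  have hVQ : ∀ t, (V t)ᴴ * Q t = 0 := fun t => by
    have := congrArg Matrix.conjTranspose (hQV t)
    simpa using this
  have hM1 : ∀ t, (fromCols (V t) (Q t))ᴴ * fromCols (V t) (Q t) = 1 := fun t => by
    rw [conjTranspose_fromCols_eq_fromRows_conjTranspose, fromRows_mul_fromCols, hQQ, hQV, hVQ,
      hVV, fromBlocks_one]
  have hM2 : fromCols (V 0) (Q 0) * (fromCols (V 0) (Q 0))ᴴ = 1 := by
    rw [conjTranspose_fromCols_eq_fromRows_conjTranspose, fromCols_mul_fromRows, hQP]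
    simp
  have hcard : Fintype.card (ι ⊕ κ) = Fintype.card n := by
    have h1 := congrArg Matrix.trace (hM1 0)
    have h2 := congrArg Matrix.trace hM2
    rw [Matrix.trace_mul_comm, h2, trace_one, trace_one] at h1
    exact_mod_cast h1.symm
  have hcard' : Fintype.card κ = Fintype.card ↥(Set.range e)ᶜ := by
    rw [Fintype.card_compl_set, Set.card_range_of_injective he, ← hcard, Fintype.card_sum]
    simp
  set E : ι ⊕ κ ≃ n := (Equiv.sumCongr (Equiv.ofInjective e he)
    (Fintype.equivOfCardEq hcard')).trans (Equiv.Set.sumCompl (Set.range e)) with hE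
  refine ⟨fun t => (fromCols (V t) (Q t)).submatrix id E.symm, fun i j => ?_, fun t => ?_,
    fun t => mem_unitaryGroup_of_conjTranspose_mul ?_, fun t => ?_⟩
  · rcases h : E.symm j with k | k
    · simpa [h] using hV i k
    · simpa [h] using hQ i k
  · beta_reduce
    rw [hVT, hQT]
  · rw [conjTranspose_submatrix, ← submatrix_mul _ _ _ _ _ Function.bijective_id, hM1,
      submatrix_one_equiv]
  · ext i x
    have h : E.symm (e x) = Sum.inl x := by
      rw [Equiv.symm_apply_eq]
      simp [hE]
    simp [h]

end Frame

/-! ### Analytic spectral projections -/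

section Spectral

variable {n : Type} [Fintype n] [DecidableEq n]

omit [DecidableEq n] in
/-- Eigenvector functions belonging to different analytic eigenvalues are orthogonal, also at the
points where the eigenvalues meet. -/
lemma conjTranspose_mul_eq_zero_of_eigen {α β : Type*} {M : ℝ → Matrix n n ℂ}
    (hM : ∀ t, (M t)ᴴ = M t) {X : ℝ → Matrix n α ℂ} {Y : ℝ → Matrix n β ℂ} (hX : AnM X)
    (hY : AnM Y) {l μ : ℝ → ℝ} (hl : AnalyticOnNhd ℝ l Set.univ)
    (hμ : AnalyticOnNhd ℝ μ Set.univ) (hlμ : l ≠ μ) (hMX : ∀ t, M t * X t = (l t : ℂ) • X t)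
    (hMY : ∀ t, M t * Y t = (μ t : ℂ) • Y t) (t : ℝ) : (X t)ᴴ * Y t = 0 := by
  refine AnM.cancel (d := fun t => (l t : ℂ) - μ t)
    ((analyticOnNhd_ofReal hl).sub (analyticOnNhd_ofReal hμ)) ?_
    (hX.conjTranspose.mul hY) (AnM.const 0) (fun t => ?_) t
  · obtain ⟨t, ht⟩ := Function.ne_iff.1 hlμ
    exact ⟨t, by rw [sub_ne_zero]; exact_mod_cast ht⟩
  · have h1 : (X t)ᴴ * M t = (l t : ℂ) • (X t)ᴴ := by
      have := congrArg Matrix.conjTranspose (hMX t)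
      rw [conjTranspose_mul, hM, conjTranspose_smul] at this
      simpa using this
    have h2 : (X t)ᴴ * M t * Y t = (μ t : ℂ) • ((X t)ᴴ * Y t) := by
      rw [Matrix.mul_assoc, hMY, Matrix.mul_smul]
    rw [h1, Matrix.smul_mul] at h2
    rw [sub_smul, h2, sub_self, smul_zero]

variable {I : Type} [Fintype I]

/-- `M = ∑ i, l i • P i` is the analytic spectral decomposition of the Hermitian matrix function
`M`: the `l i` are pairwise different analytic functions (they may meet at some points, and some
`P i` may vanish), and the `P i` are analytic families of mutually orthogonal projections with
sum `1`. -/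
structure SpectralSystem (M : ℝ → Matrix n n ℂ) (l : I → ℝ → ℝ) (P : I → ℝ → Matrix n n ℂ) :
    Prop where
  hermitian : ∀ t, (M t)ᴴ = M t
  analytic_eig : ∀ i, AnalyticOnNhd ℝ (l i) Set.univ
  injective : Function.Injective l
  analytic_proj : ∀ i, AnM (P i)
  proj_conjTranspose : ∀ i t, (P i t)ᴴ = P i t
  proj_mul_self : ∀ i t, P i t * P i t = P i t
  sum_proj : ∀ t, ∑ i, P i t = 1
  mul_proj : ∀ i t, M t * P i t = (l i t : ℂ) • P i t

namespace SpectralSystem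

variable {M : ℝ → Matrix n n ℂ} {l : I → ℝ → ℝ} {P : I → ℝ → Matrix n n ℂ}

lemma proj_mul_eq_zero (h : SpectralSystem M l P) {α : Type*} {X : ℝ → Matrix n α ℂ} (hX : AnM X)
    {μ : ℝ → ℝ} (hμ : AnalyticOnNhd ℝ μ Set.univ) (hMX : ∀ t, M t * X t = (μ t : ℂ) • X t) {i : I}
    (hi : l i ≠ μ) (t : ℝ) : P i t * X t = 0 := by
  have := conjTranspose_mul_eq_zero_of_eigen h.hermitian (h.analytic_proj i) hX (h.analytic_eig i)
    hμ hi (h.mul_proj i) hMX t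
  rwa [h.proj_conjTranspose] at this

lemma proj_mul_eq_self (h : SpectralSystem M l P) {α : Type*} {X : ℝ → Matrix n α ℂ} (hX : AnM X)
    {i : I} (hMX : ∀ t, M t * X t = (l i t : ℂ) • X t) (t : ℝ) : P i t * X t = X t := by
  have h1 : (∑ j, P j t) * X t = P i t * X t := by
    rw [Matrix.sum_mul]
    refine Finset.sum_eq_single i (fun j _ hj => ?_) fun hi => absurd (Finset.mem_univ _) hi
    exact h.proj_mul_eq_zero hX (h.analytic_eig i) hMX (fun h' => hj (h.injective h')) t
  rw [← h1, h.sum_proj, Matrix.one_mul]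

/-- The projection that belongs to an eigenvalue function is determined by the matrix function. -/
lemma proj_unique (h : SpectralSystem M l P) {I' : Type} [Fintype I']
    {l' : I' → ℝ → ℝ} {P' : I' → ℝ → Matrix n n ℂ} (h' : SpectralSystem M l' P') {i : I} {i' : I'}
    (hl : l i = l' i') (t : ℝ) : P i t = P' i' t := by
  have h1 := h.proj_mul_eq_self (h'.analytic_proj i') (i := i) (fun t => by
    rw [hl]; exact h'.mul_proj i' t) t
  have h2 := h'.proj_mul_eq_self (h.analytic_proj i) (i := i') (fun t => by
    rw [← hl]; exact h.mul_proj i t) t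
  have h3 := congrArg Matrix.conjTranspose h1
  rw [conjTranspose_mul, h.proj_conjTranspose, h'.proj_conjTranspose] at h3
  rw [← h2, h3]

lemma shift (h : SpectralSystem M l P) {c : ℝ} (hM : ∀ t, M (t + c) = M t) :
    SpectralSystem M (fun i t => l i (t + c)) (fun i t => P i (t + c)) where
  hermitian := h.hermitian
  analytic_eig i := analyticOnNhd_shift (h.analytic_eig i) c
  injective i j hij := h.injective (funext fun t => by simpa using congrFun hij (t - c))
  analytic_proj i := (h.analytic_proj i).shift c
  proj_conjTranspose i t := h.proj_conjTranspose i _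
  proj_mul_self i t := h.proj_mul_self i _
  sum_proj t := h.sum_proj _
  mul_proj i t := by rw [← h.mul_proj i (t + c), hM]

end SpectralSystem

omit [Fintype I] in
/-- Products of factors `M - l j`, described by means of diagonalisations of `M`. -/
lemma exists_prod_sub [DecidableEq I] {M : ℝ → Matrix n n ℂ} (hM : AnM M) {l : I → ℝ → ℝ}
    (hl : ∀ i, AnalyticOnNhd ℝ (l i) Set.univ) (s : Finset I) :
    ∃ N : ℝ → Matrix n n ℂ, AnM N ∧ ∀ t (W : Matrix n n ℂ) (x : n → ℂ), Wᴴ * W = 1 →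
      M t = W * diagonal x * Wᴴ → N t = W * diagonal (fun k => ∏ j ∈ s, (x k - l j t)) * Wᴴ := by
  induction s using Finset.induction_on with
  | empty =>
    refine ⟨fun _ => 1, AnM.const 1, fun t W x hW _ => ?_⟩
    simp [mul_eq_one_comm.1 hW]
  | insert a s ha ih =>
    obtain ⟨N, hN, hN'⟩ := ih
    refine ⟨fun t => (M t - (l a t : ℂ) • 1) * N t,
      (hM.sub (AnM.smul (analyticOnNhd_ofReal (hl a)) (AnM.const 1))).mul hN,
      fun t W x hW hMt => ?_⟩
    have hW' : W * Wᴴ = 1 := mul_eq_one_comm.1 hW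
    have h1 : M t - (l a t : ℂ) • 1 = W * diagonal (fun k => x k - l a t) * Wᴴ := by
      have h2 : diagonal (fun k => x k - l a t) = diagonal x - (l a t : ℂ) • 1 := by
        ext i j
        by_cases hij : i = j
        · subst hij; simp
        · simp [hij]
      rw [h2, Matrix.mul_sub, Matrix.sub_mul, ← hMt]
      simp [hW']
    have h3 : diagonal (fun k => ∏ j ∈ insert a s, (x k - l j t))
        = diagonal (fun k => x k - l a t) * diagonal (fun k => ∏ j ∈ s, (x k - l j t)) := by
      rw [diagonal_mul_diagonal]
      simp [Finset.prod_insert ha]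
    beta_reduce
    rw [h1, hN' t W x hW hMt, h3]
    calc _ = W * diagonal (fun k => x k - l a t) * (Wᴴ * W) *
          diagonal (fun k => ∏ j ∈ s, (x k - l j t)) * Wᴴ := by simp only [Matrix.mul_assoc]
      _ = _ := by rw [hW, Matrix.mul_one]; simp only [Matrix.mul_assoc]

/-- Analytic spectral projections exist: by Lagrange interpolation, `∏_{j ≠ i} (M - l j)` is the
product of the scalar `∏_{j ≠ i} (l i - l j)` and a projection, hence divisible by this scalar. -/
theorem exists_spectralSystem [DecidableEq I] {M : ℝ → Matrix n n ℂ} (hM : AnM M) {l : I → ℝ → ℝ}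
    (hl : ∀ i, AnalyticOnNhd ℝ (l i) Set.univ) (hinj : Function.Injective l)
    (hspec : ∀ t, ∃ (W : Matrix n n ℂ) (c : n → I), Wᴴ * W = 1 ∧
      M t = W * diagonal (fun k => (l (c k) t : ℂ)) * Wᴴ) :
    ∃ P : I → ℝ → Matrix n n ℂ, SpectralSystem M l P := by
  choose W c hW hMW using hspec
  have hW' : ∀ t, W t * (W t)ᴴ = 1 := fun t => mul_eq_one_comm.1 (hW t)
  set E : I → ℝ → Matrix n n ℂ := fun i t =>
    W t * diagonal (fun k => if c t k = i then 1 else 0) * (W t)ᴴ with hE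
  set d : I → ℝ → ℂ := fun i t => ∏ j ∈ Finset.univ.erase i, ((l i t : ℂ) - l j t) with hd
  have hda : ∀ i, AnalyticOnNhd ℝ (d i) Set.univ := fun i =>
    Finset.analyticOnNhd_fun_prod _ fun j _ =>
      (analyticOnNhd_ofReal (hl i)).sub (analyticOnNhd_ofReal (hl j))
  have hdne : ∀ i, ∀ᶠ t in 𝓝[≠] (0 : ℝ), d i t ≠ 0 := by
    intro i
    have h1 : ∀ j, ∀ᶠ t in 𝓝[≠] (0 : ℝ), j ≠ i → ((l i t : ℂ) - l j t) ≠ 0 := by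
      intro j
      by_cases hj : j = i
      · exact Eventually.of_forall fun t h => absurd hj h
      · have h2 := eventually_ne_zero_of_analytic
          ((analyticOnNhd_ofReal (hl i)).sub (analyticOnNhd_ofReal (hl j))) (by
            obtain ⟨t, ht⟩ := Function.ne_iff.1 fun h => hj (hinj h).symm
            exact ⟨t, by simpa [sub_eq_zero] using ht⟩) 0
        filter_upwards [h2] with t ht _
        exact ht
    filter_upwards [eventually_all.2 h1] with t ht
    exact Finset.prod_ne_zero_iff.2 fun j hj => ht j (Finset.ne_of_mem_erase hj)
  have hEE : ∀ i t, E i t * E i t = E i t := fun i t => by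
    calc _ = W t * diagonal (fun k => if c t k = i then 1 else 0) * ((W t)ᴴ * W t) *
          diagonal (fun k => if c t k = i then 1 else 0) * (W t)ᴴ := by
            simp only [hE, Matrix.mul_assoc]
      _ = W t * (diagonal (fun k => if c t k = i then 1 else 0) *
          diagonal (fun k => if c t k = i then 1 else 0)) * (W t)ᴴ := by
            rw [hW, Matrix.mul_one]; simp only [Matrix.mul_assoc]
      _ = _ := by
        rw [diagonal_mul_diagonal]
        simp only [hE]
        congr 3
        ext k
        by_cases h : c t k = i <;> simp [h]
  have hEh : ∀ i t, (E i t)ᴴ = E i t := fun i t => by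
    have h1 : (diagonal (fun k => if c t k = i then (1 : ℂ) else 0))ᴴ
        = diagonal (fun k => if c t k = i then 1 else 0) := by
      rw [diagonal_conjTranspose]
      congr 1
      ext k
      by_cases h : c t k = i <;> simp [h]
    simp only [hE, conjTranspose_mul, conjTranspose_conjTranspose, h1, Matrix.mul_assoc]
  have hquot : ∀ i, ∃ P : ℝ → Matrix n n ℂ, AnM P ∧ ∀ t, d i t • P t = d i t • E i t := by
    intro i
    obtain ⟨N, hN, hN'⟩ := exists_prod_sub hM hl (Finset.univ.erase i)
    have hNE : ∀ t, N t = d i t • E i t := by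
      intro t
      rw [hN' t (W t) _ (hW t) (hMW t), hE, ← Matrix.smul_mul, ← Matrix.mul_smul]
      congr 2
      rw [← diagonal_smul]
      congr 1
      ext k
      by_cases h : c t k = i
      · simp [h, hd]
      · simp only [h, if_false, Pi.smul_apply, smul_zero]
        exact Finset.prod_eq_zero (Finset.mem_erase.2 ⟨h, Finset.mem_univ _⟩) (sub_self _)
    obtain ⟨P, hP, hPN⟩ := hN.exists_quotient (d := fun _ => d i) (fun _ => hda i)
      (fun t a b => by
        rw [hNE, Matrix.smul_apply, norm_smul]
        exact mul_le_of_le_one_right (norm_nonneg _) (norm_projection_apply_le (hEh i t) (hEE i t) a b))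
      (fun _ => (hdne i).exists)
    refine ⟨P, hP, fun t => ?_⟩
    rw [← hNE]
    ext a b
    exact (hPN t a b).symm
  choose P hP hPE using hquot
  have hev : ∀ᶠ t in 𝓝[≠] (0 : ℝ), ∀ i, P i t = E i t := by
    filter_upwards [eventually_all.2 hdne] with t ht i
    exact smul_right_injective _ (ht i) (hPE i t)
  refine ⟨P, ⟨fun t => ?_, hl, hinj, hP, fun i => ?_, fun i => ?_, ?_, fun i => ?_⟩⟩
  · have h1 : (diagonal (fun k => (l (c t k) t : ℂ)))ᴴ = diagonal (fun k => (l (c t k) t : ℂ)) := by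
      rw [diagonal_conjTranspose]
      congr 1
      ext k
      simp
    rw [hMW]
    simp only [conjTranspose_mul, conjTranspose_conjTranspose, h1, Matrix.mul_assoc]
  · refine (hP i).conjTranspose.eq_of_eventually (hP i) (t₀ := 0) ?_
    filter_upwards [hev] with t ht
    rw [ht, hEh]
  · refine ((hP i).mul (hP i)).eq_of_eventually (hP i) (t₀ := 0) ?_
    filter_upwards [hev] with t ht
    rw [ht, hEE]
  · refine (AnM.sum Finset.univ hP).eq_of_eventually (AnM.const 1) (t₀ := 0) ?_
    filter_upwards [hev] with t ht
    rw [Finset.sum_congr rfl fun i _ => ht i]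
    simp only [hE, ← Matrix.sum_mul, ← Matrix.mul_sum]
    have h1 : ∑ i, diagonal (fun k => if c t k = i then (1 : ℂ) else 0) = 1 := by
      ext a b
      rw [Matrix.sum_apply]
      by_cases hab : a = b
      · subst hab; simp
      · simp [hab]
    rw [h1, Matrix.mul_one, hW']
  · refine (hM.mul (hP i)).eq_of_eventually
      (AnM.smul (analyticOnNhd_ofReal (hl i)) (hP i)) (t₀ := 0) ?_
    filter_upwards [hev] with t ht
    rw [ht, hMW t]
    calc _ = W t * diagonal (fun k => (l (c t k) t : ℂ)) * ((W t)ᴴ * W t) *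
          diagonal (fun k => if c t k = i then 1 else 0) * (W t)ᴴ := by
            simp only [hE, Matrix.mul_assoc]
      _ = W t * (diagonal (fun k => (l (c t k) t : ℂ)) *
          diagonal (fun k => if c t k = i then 1 else 0)) * (W t)ᴴ := by
            rw [hW, Matrix.mul_one]; simp only [Matrix.mul_assoc]
      _ = _ := by
        rw [hE, ← Matrix.smul_mul, ← Matrix.mul_smul, diagonal_mul_diagonal, ← diagonal_smul]
        congr 3
        ext k
        by_cases h : c t k = i
        · simp [h]
        · simp [h]

end Spectral

/-! ### Multiplexed families -/

section Multiplexed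

variable {E : Type} [Ring E] {k κ : ℕ} {f : Fin k → ℝ → E}

/-- A multiplexed family consists of the shifts of its first member. -/
lemma Multiplexed.eq_shift (h : Multiplexed κ f) (hk : 0 < k) (i : Fin k) (t : ℝ) :
    f i t = f ⟨0, hk⟩ (t + 2 * Real.pi * i) := by
  obtain ⟨i, hi⟩ := i
  induction i generalizing t with
  | zero => simp
  | succ i ih =>
    have h1 := h.1 ⟨i, by omega⟩ ⟨i + 1, hi⟩ rfl t
    rw [← h1, ih]
    congr 1
    push_cast
    ring

lemma Multiplexed.shift_period (h : Multiplexed κ f) (hk : 0 < k) (t : ℝ) :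
    f ⟨0, hk⟩ (t + 2 * Real.pi * k) = (-1) ^ (κ - 1) * f ⟨0, hk⟩ t := by
  have h1 := h.2 ⟨k - 1, by omega⟩ ⟨0, hk⟩ (by simp; omega) rfl t
  rw [← h1, h.eq_shift hk ⟨k - 1, by omega⟩]
  congr 1
  have : ((k - 1 : ℕ) : ℝ) = k - 1 := by rw [Nat.cast_sub (by omega)]; simp
  rw [this]
  ring

lemma multiplexed_of_shift {g : ℝ → E} (hg : ∀ t, g (t + 2 * Real.pi * k) = (-1) ^ (κ - 1) * g t) :
    Multiplexed κ fun (i : Fin k) t => g (t + 2 * Real.pi * i) := by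
  refine ⟨fun i j hij t => ?_, fun i j hi hj t => ?_⟩
  · beta_reduce
    rw [← hij]
    congr 1
    push_cast
    ring
  · beta_reduce
    rw [hj, Nat.cast_zero, mul_zero, add_zero, ← hg]
    have hik : (k : ℝ) = i + 1 := by exact_mod_cast hi.symm
    rw [hik]
    congr 1
    ring

/-- `j` is the cyclic successor of `i`. -/
def Next (i j : Fin k) : Prop := (i : ℕ) + 1 = j ∨ ((i : ℕ) + 1 = k ∧ (j : ℕ) = 0)

lemma multiplexed_one_iff :
    Multiplexed 1 f ↔ ∀ i j, Next i j → ∀ t, f i (t + 2 * Real.pi) = f j t := by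
  simp only [Multiplexed, Nat.sub_self, pow_zero, one_mul, Next]
  constructor
  · rintro ⟨h1, h2⟩ i j (h | h)
    exacts [h1 i j h, h2 i j h.1 h.2]
  · exact fun h => ⟨fun i j hij => h i j (Or.inl hij), fun i j hi hj => h i j (Or.inr ⟨hi, hj⟩)⟩

lemma Multiplexed.mul {g : Fin k → ℝ → E} (hf : Multiplexed 1 f) (hg : Multiplexed 1 g) :
    Multiplexed 1 fun i t => f i t * g i t := by
  rw [multiplexed_one_iff] at *
  intro i j hij t
  rw [hf i j hij, hg i j hij]

/-- The sum of a multiplexed family has period `2π`. -/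
lemma Multiplexed.sum_periodic (hf : Multiplexed 1 f) (t : ℝ) :
    ∑ i, f i (t + 2 * Real.pi) = ∑ i, f i t := by
  rcases k with _ | k
  · simp
  rw [← Equiv.sum_comp (finRotate (k + 1)) fun i => f i t]
  refine Finset.sum_congr rfl fun i _ => multiplexed_one_iff.1 hf _ _ ?_ t
  rcases lt_or_eq_of_le (Fin.le_last i) with h | h
  · left
    rw [coe_finRotate_of_ne_last h.ne]
  · right
    subst h
    simp

end Multiplexed

/-! ### Singular vectors along the orbits -/

namespace OrbitSystem

variable (S : OrbitSystem)

/-- The conditions on an orbit system that do not refer to a matrix function. -/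
structure IsOrbitFamily : Prop where
  size_pos : ∀ ν, 0 < S.k ν
  sign_index : ∀ ν, S.κ ν = 1 ∨ S.κ ν = 2
  analytic : ∀ ν i, AnalyticOnNhd ℝ (S.σ ν i) Set.univ
  nonzero : ∀ ν i, ∃ Ω, S.σ ν i Ω ≠ 0
  distinct : ∀ x y : (Σ ν : Fin S.R, Fin (S.k ν)), x ≠ y →
    ∃ Ω, |S.σ x.1 x.2 Ω| ≠ |S.σ y.1 y.2 Ω|
  multiplexed : ∀ ν, Multiplexed (S.κ ν) (S.σ ν)

/-- The eigenvalue functions of `Aᴴ A`: the squares of the singular values and, at the index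
`none`, the zero function. -/
def eig : Option (Σ ν : Fin S.R, Fin (S.k ν)) → ℝ → ℝ
  | none => fun _ => 0
  | some x => fun t => S.σ x.1 x.2 t ^ 2

/-- The exponent `c` of the phase `e^{ct}` that turns orbit `ν` into an unsigned one: `j / (2 k_ν)`
if the orbit is signed, and `0` otherwise. -/
def phaseExp (ν : Fin S.R) : ℂ :=
  if S.κ ν = 2 then Complex.I / (2 * S.k ν) else 0

/-- The functions of orbit `ν` multiplied by phases that make the orbit multiplexed without sign. -/
def phased (ν : Fin S.R) (i : Fin (S.k ν)) (t : ℝ) : ℂ :=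
  Complex.exp (S.phaseExp ν * ((t + 2 * Real.pi * i : ℝ) : ℂ)) * S.σ ν i t

variable {S}

lemma norm_exp_phase (ν : Fin S.R) (t : ℝ) : ‖Complex.exp (S.phaseExp ν * t)‖ = 1 := by
  unfold phaseExp
  split_ifs
  · have : Complex.I / (2 * (S.k ν : ℂ)) * t = ((t / (2 * S.k ν) : ℝ) : ℂ) * Complex.I := by
      push_cast; ring
    rw [this, Complex.norm_exp_ofReal_mul_I]
  · simp

lemma norm_phased (ν : Fin S.R) (i : Fin (S.k ν)) (t : ℝ) : ‖S.phased ν i t‖ = |S.σ ν i t| := by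
  rw [phased, norm_mul, norm_exp_phase, one_mul, Complex.norm_real, Real.norm_eq_abs]

lemma conj_phased_mul (ν : Fin S.R) (i : Fin (S.k ν)) (t : ℝ) :
    conj (S.phased ν i t) * S.phased ν i t = ((S.σ ν i t ^ 2 : ℝ) : ℂ) := by
  rw [Complex.conj_mul', norm_phased]
  norm_cast
  rw [sq_abs]

namespace IsOrbitFamily

variable (hS : S.IsOrbitFamily)
include hS

lemma analytic_phased (ν : Fin S.R) (i : Fin (S.k ν)) :
    AnalyticOnNhd ℝ (S.phased ν i) Set.univ :=
  (analyticOnNhd_shift (analyticOnNhd_cexp (S.phaseExp ν)) _).mul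
    (analyticOnNhd_ofReal (hS.analytic ν i))

lemma phased_ne_zero (ν : Fin S.R) (i : Fin (S.k ν)) : ∃ t, S.phased ν i t ≠ 0 := by
  obtain ⟨t, ht⟩ := hS.nonzero ν i
  exact ⟨t, mul_ne_zero (Complex.exp_ne_zero _) (by exact_mod_cast ht)⟩

lemma multiplexed_phased (ν : Fin S.R) : Multiplexed 1 (S.phased ν) := by
  have hk := hS.size_pos ν
  set g : ℝ → ℂ := fun t => Complex.exp (S.phaseExp ν * t) * (S.σ ν ⟨0, hk⟩ t : ℂ) with hg
  have h1 : S.phased ν = fun (i : Fin (S.k ν)) t => g (t + 2 * Real.pi * (i : ℕ)) := by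
    funext i t
    rw [phased, (hS.multiplexed ν).eq_shift hk i t]
  rw [h1]
  refine multiplexed_of_shift fun t => ?_
  simp only [hg]
  rw [(hS.multiplexed ν).shift_period hk, Complex.ofReal_add, mul_add, Complex.exp_add]
  have hk' : (S.k ν : ℂ) ≠ 0 := by exact_mod_cast hk.ne'
  rcases hS.sign_index ν with h | h
  · simp [phaseExp, h]
  · have h2 : S.phaseExp ν * ((2 * Real.pi * S.k ν : ℝ) : ℂ) = Real.pi * Complex.I := by
      rw [phaseExp, if_pos h]
      push_cast
      field_simp
    rw [h2, Complex.exp_pi_mul_I, h]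
    simp

lemma analytic_eig (x : Option (Σ ν : Fin S.R, Fin (S.k ν))) :
    AnalyticOnNhd ℝ (S.eig x) Set.univ := by
  rcases x with _ | x
  · exact analyticOnNhd_const
  · exact (hS.analytic x.1 x.2).pow 2

lemma eig_some_ne_zero (x : Σ ν : Fin S.R, Fin (S.k ν)) : S.eig (some x) ≠ fun _ => 0 := by
  intro h
  obtain ⟨t, ht⟩ := hS.nonzero x.1 x.2
  exact pow_ne_zero 2 ht (congrFun h t)

lemma eig_injective : Function.Injective S.eig := by
  rintro (_ | x) (_ | y) h
  · rfl
  · exact absurd h.symm (hS.eig_some_ne_zero y)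
  · exact absurd h (hS.eig_some_ne_zero x)
  · by_contra hxy
    obtain ⟨t, ht⟩ := hS.distinct x y fun h' => hxy (congrArg some h')
    exact ht ((sq_eq_sq_iff_abs_eq_abs _ _).1 (congrFun h t))

lemma eig_shift (ν : Fin S.R) (i : Fin (S.k ν)) (t : ℝ) :
    S.eig (some ⟨ν, i⟩) t = S.eig (some ⟨ν, ⟨0, hS.size_pos ν⟩⟩) (t + 2 * Real.pi * i) := by
  simp only [eig]
  rw [(hS.multiplexed ν).eq_shift (hS.size_pos ν) i t]

lemma eig_period (ν : Fin S.R) (t : ℝ) :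
    S.eig (some ⟨ν, ⟨0, hS.size_pos ν⟩⟩) (t + 2 * Real.pi * S.k ν)
      = S.eig (some ⟨ν, ⟨0, hS.size_pos ν⟩⟩) t := by
  simp only [eig]
  rw [(hS.multiplexed ν).shift_period (hS.size_pos ν), mul_pow, ← pow_mul, mul_comm _ 2, pow_mul]
  simp

end IsOrbitFamily

section Projections

variable {n : Type} [Fintype n] [DecidableEq n] {M : ℝ → Matrix n n ℂ}
  {P : Option (Σ ν : Fin S.R, Fin (S.k ν)) → ℝ → Matrix n n ℂ}

lemma periodic_nat_mul {α : Type*} {M : ℝ → α} (hM : ∀ t, M (t + 2 * Real.pi) = M t) (i : ℕ)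
    (t : ℝ) : M (t + 2 * Real.pi * i) = M t := by
  have := Function.Periodic.nat_mul (f := M) hM i t
  rwa [mul_comm (i : ℝ)] at this

/-- The spectral projections along an orbit are the shifts of the first one. -/
lemma IsOrbitFamily.proj_shift (hS : S.IsOrbitFamily) (hM : ∀ t, M (t + 2 * Real.pi) = M t)
    (hP : SpectralSystem M S.eig P) (ν : Fin S.R) (i : Fin (S.k ν)) (t : ℝ) :
    P (some ⟨ν, i⟩) t = P (some ⟨ν, ⟨0, hS.size_pos ν⟩⟩) (t + 2 * Real.pi * i) :=
  hP.proj_unique (hP.shift (periodic_nat_mul hM i)) (i := some ⟨ν, i⟩)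
    (i' := some ⟨ν, ⟨0, hS.size_pos ν⟩⟩) (funext fun t => hS.eig_shift ν i t) t

lemma IsOrbitFamily.proj_period (hS : S.IsOrbitFamily) (hM : ∀ t, M (t + 2 * Real.pi) = M t)
    (hP : SpectralSystem M S.eig P) (ν : Fin S.R) (t : ℝ) :
    P (some ⟨ν, ⟨0, hS.size_pos ν⟩⟩) (t + 2 * Real.pi * S.k ν)
      = P (some ⟨ν, ⟨0, hS.size_pos ν⟩⟩) t :=
  ((hP.proj_unique (hP.shift (periodic_nat_mul hM (S.k ν)))
    (i := some ⟨ν, ⟨0, hS.size_pos ν⟩⟩) (i' := some ⟨ν, ⟨0, hS.size_pos ν⟩⟩)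
    (funext fun t => (hS.eig_period ν t).symm)) t).symm

end Projections

/-- The index set of the listed singular values. -/
abbrev Idx (S : OrbitSystem) : Type := Σ b : Fin S.B, Fin (S.size b)

/-- A compact singular value decomposition `a = U diag(s) Vᴴ` whose singular vectors and (complex)
singular values are multiplexed along each listed orbit. -/
structure MultiplexedSVD (S : OrbitSystem) {m n : Type} [Fintype m] [Fintype n]
    (a : ℝ → Matrix m n ℂ) (U : ℝ → Matrix m S.Idx ℂ) (V : ℝ → Matrix n S.Idx ℂ) : Prop where
  analytic_left : AnM U
  analytic_right : AnM V
  left_orthonormal : ∀ t, (U t)ᴴ * U t = 1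
  right_orthonormal : ∀ t, (V t)ᴴ * V t = 1
  left_multiplexed : ∀ b p, Multiplexed 1 fun (i : Fin (S.size b)) t => U t p ⟨b, i⟩
  right_multiplexed : ∀ b p, Multiplexed 1 fun (i : Fin (S.size b)) t => V t p ⟨b, i⟩
  eq_mul : ∀ t, a t = U t * diagonal (fun x : S.Idx => S.phased (S.orb x.1) x.2 t) * (V t)ᴴ

section Core

variable {m n : Type} [Fintype m] [Fintype n] [DecidableEq n]
  {a : ℝ → Matrix m n ℂ} {P : Option (Σ ν : Fin S.R, Fin (S.k ν)) → ℝ → Matrix n n ℂ}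

/-- The right singular vectors: in orbit `ν`, the `i`-th block of columns is the shift by `2π i` of
a frame `Q ν` of the first spectral projection of this orbit. -/
lemma IsOrbitFamily.exists_right_vectors (hS : S.IsOrbitFamily) {M : ℝ → Matrix n n ℂ}
    (hM : ∀ t, M (t + 2 * Real.pi) = M t) (hP : SpectralSystem M S.eig P)
    {Q : ∀ ν : Fin S.R, ℝ → Matrix n {b // S.orb b = ν} ℂ} (hQ : ∀ ν, AnM (Q ν))
    (hQT : ∀ ν t, Q ν (t + 2 * Real.pi * S.k ν) = Q ν t) (hQQ : ∀ ν t, (Q ν t)ᴴ * Q ν t = 1)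
    (hQP : ∀ ν t, Q ν t * (Q ν t)ᴴ = P (some ⟨ν, ⟨0, hS.size_pos ν⟩⟩) t) :
    ∃ V : ℝ → Matrix n S.Idx ℂ, AnM V ∧ (∀ t, (V t)ᴴ * V t = 1) ∧
      (∀ b p, Multiplexed 1 fun (i : Fin (S.size b)) t => V t p ⟨b, i⟩) ∧
      (∀ t, M t * V t = V t * diagonal (fun x : S.Idx =>
        ((S.σ (S.orb x.1) x.2 t ^ 2 : ℝ) : ℂ))) ∧
      ∀ t, V t * (V t)ᴴ = 1 - P none t := by
  -- the frames of all spectral projections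
  set F : ∀ x : (Σ ν : Fin S.R, Fin (S.k ν)), ℝ → Matrix n {b // S.orb b = x.1} ℂ :=
    fun x t => Q x.1 (t + 2 * Real.pi * (x.2 : ℕ)) with hF
  have hFa : ∀ x, AnM (F x) := fun x => (hQ x.1).shift _
  have hFP : ∀ x t, F x t * (F x t)ᴴ = P (some x) t := fun x t => by
    rw [hF, hQP, ← hS.proj_shift hM hP]
  have hMF : ∀ x t, M t * F x t = (S.eig (some x) t : ℂ) • F x t := fun x t => by
    have h1 : P (some x) t * F x t = F x t := by
      rw [← hFP, Matrix.mul_assoc, hF, hQQ, Matrix.mul_one]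
    rw [← h1, ← Matrix.mul_assoc, hP.mul_proj, Matrix.smul_mul]
  have hFF : ∀ x y, x ≠ y → ∀ t, (F x t)ᴴ * F y t = 0 := fun x y hxy =>
    conjTranspose_mul_eq_zero_of_eigen hP.hermitian (hFa x) (hFa y) (hS.analytic_eig _)
      (hS.analytic_eig _) (fun h => hxy (Option.some_injective _ (hS.eig_injective h)))
      (hMF x) (hMF y)
  have htransport : ∀ (x y : Σ ν : Fin S.R, Fin (S.k ν)) (h : x = y) (b : Fin S.B)
      (hb : S.orb b = y.1) t p, F y t p ⟨b, hb⟩ = F x t p ⟨b, by rw [hb, h]⟩ := by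
    rintro x y rfl b hb t p
    rfl
  set V : ℝ → Matrix n S.Idx ℂ := fun t => Matrix.of fun p x => F ⟨S.orb x.1, x.2⟩ t p ⟨x.1, rfl⟩
    with hV
  have hVF : ∀ t (x : S.Idx), (fun p => V t p x) = fun p => F ⟨S.orb x.1, x.2⟩ t p ⟨x.1, rfl⟩ :=
    fun _ _ => rfl
  refine ⟨V, fun p x => hFa _ p _, fun t => ?_, fun b p => ?_, fun t => ?_, fun t => ?_⟩
  · ext ⟨b, i⟩ ⟨b', i'⟩
    rw [Matrix.mul_apply]
    simp only [conjTranspose_apply, hV, Matrix.of_apply]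
    by_cases hxy : (⟨S.orb b, i⟩ : Σ ν : Fin S.R, Fin (S.k ν)) = ⟨S.orb b', i'⟩
    · simp only [htransport _ _ hxy b' rfl]
      have h1 := congrFun (congrFun (hQQ (S.orb b) (t + 2 * Real.pi * (i : ℕ))) ⟨b, rfl⟩)
        ⟨b', (congrArg Sigma.fst hxy).symm⟩
      rw [Matrix.mul_apply] at h1
      refine h1.trans ?_
      rw [Matrix.one_apply, Matrix.one_apply]
      congr 1
      rw [Subtype.mk_eq_mk, eq_iff_iff]
      constructor
      · rintro rfl
        exact congrArg (Sigma.mk b) (eq_of_heq (Sigma.mk.inj hxy).2)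
      · intro h
        exact congrArg Sigma.fst h
    · have h1 := congrFun (congrFun (hFF _ _ hxy t) ⟨b, rfl⟩) ⟨b', rfl⟩
      rw [Matrix.mul_apply] at h1
      refine h1.trans ?_
      rw [Matrix.one_apply_ne, Matrix.zero_apply]
      rintro h
      apply hxy
      obtain rfl : b = b' := congrArg Sigma.fst h
      exact congrArg (Sigma.mk (S.orb b)) (eq_of_heq (Sigma.mk.inj h).2)
  · exact multiplexed_of_shift (κ := 1) (g := fun t => Q (S.orb b) t p ⟨b, rfl⟩) fun t => by
      have := hQT (S.orb b) t
      simp only [OrbitSystem.size, this]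
      simp
  · ext p x
    have h1 := congrFun (congrFun (hMF ⟨S.orb x.1, x.2⟩ t) p) ⟨x.1, rfl⟩
    rw [Matrix.mul_apply, Matrix.smul_apply, smul_eq_mul] at h1
    rw [mul_diagonal, Matrix.mul_apply, mul_comm]
    exact h1
  · have h2 : ∑ x, P (some x) t = 1 - P none t := by
      rw [← hP.sum_proj t, Fintype.sum_option]
      simp
    rw [← h2]
    ext p q
    rw [Matrix.mul_apply, Matrix.sum_apply, Fintype.sum_sigma, Fintype.sum_sigma,
      ← (Equiv.sigmaFiberEquiv S.orb).sum_comp, Fintype.sum_sigma]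
    refine Finset.sum_congr rfl fun ν _ => ?_
    simp only [← hFP, Matrix.mul_apply]
    refine Eq.trans (Finset.sum_congr rfl ?_) Finset.sum_comm
    rintro ⟨b, rfl⟩ _
    rfl

open scoped ComplexOrder in
/-- The left singular vectors are the quotients `a v / s`. -/
lemma IsOrbitFamily.exists_multiplexedSVD (hS : S.IsOrbitFamily) (ha : AnM a)
    (haT : ∀ t, a (t + 2 * Real.pi) = a t)
    (hP : SpectralSystem (fun t => (a t)ᴴ * a t) S.eig P)
    {Q : ∀ ν : Fin S.R, ℝ → Matrix n {b // S.orb b = ν} ℂ} (hQ : ∀ ν, AnM (Q ν))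
    (hQT : ∀ ν t, Q ν (t + 2 * Real.pi * S.k ν) = Q ν t) (hQQ : ∀ ν t, (Q ν t)ᴴ * Q ν t = 1)
    (hQP : ∀ ν t, Q ν t * (Q ν t)ᴴ = P (some ⟨ν, ⟨0, hS.size_pos ν⟩⟩) t) :
    ∃ U V, MultiplexedSVD S a U V := by
  obtain ⟨V, hV, hVV, hVm, hMV, hVP⟩ := hS.exists_right_vectors (fun t => by rw [haT]) hP hQ hQT
    hQQ hQP
  set s : S.Idx → ℝ → ℂ := fun x t => S.phased (S.orb x.1) x.2 t with hs
  have hsa : ∀ x, AnalyticOnNhd ℝ (s x) Set.univ := fun x => hS.analytic_phased _ _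
  have hs0 : ∀ x, ∃ t, s x t ≠ 0 := fun x => hS.phased_ne_zero _ _
  have haP : ∀ t, a t * P none t = 0 := fun t => by
    rw [← Matrix.conjTranspose_mul_self_eq_zero, conjTranspose_mul, Matrix.mul_assoc,
      ← Matrix.mul_assoc _ (a t), hP.mul_proj none t]
    simp [eig]
  have haV : ∀ t, a t * (V t * (V t)ᴴ) = a t := fun t => by
    rw [hVP, Matrix.mul_sub, haP, Matrix.mul_one, sub_zero]
  have hNN : ∀ t, (a t * V t)ᴴ * (a t * V t)
      = diagonal fun x : S.Idx => ((S.σ (S.orb x.1) x.2 t ^ 2 : ℝ) : ℂ) := fun t => by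
    calc _ = (V t)ᴴ * ((a t)ᴴ * a t * V t) := by
          rw [conjTranspose_mul]; simp only [Matrix.mul_assoc]
      _ = _ := by rw [hMV, ← Matrix.mul_assoc, hVV, Matrix.one_mul]
  obtain ⟨U, hU, hNU⟩ := (ha.mul hV).exists_quotient hsa (fun t p x => by
    have h1 := congrFun (congrFun (hNN t) x) x
    rw [diagonal_apply_eq, Matrix.mul_apply] at h1
    simp only [conjTranspose_apply, RCLike.star_def, Complex.conj_mul'] at h1
    have h2 : ∑ q, ‖(a t * V t) q x‖ ^ 2 = S.σ (S.orb x.1) x.2 t ^ 2 := by exact_mod_cast h1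
    have h3 : ‖(a t * V t) p x‖ ^ 2 ≤ S.σ (S.orb x.1) x.2 t ^ 2 := by
      rw [← h2]
      exact Finset.single_le_sum (f := fun q => ‖(a t * V t) q x‖ ^ 2) (fun _ _ => sq_nonneg _)
        (Finset.mem_univ p)
    refine le_of_le_of_eq ?_ (norm_phased (S.orb x.1) x.2 t).symm
    rw [← abs_norm ((a t * V t) p x)]
    exact sq_le_sq.1 h3) hs0
  have hNU' : ∀ t, a t * V t = U t * diagonal fun x => s x t := fun t => by
    ext p x
    rw [mul_diagonal, hNU, mul_comm]
  have hev : ∀ᶠ t in 𝓝[≠] (0 : ℝ), ∀ x, s x t ≠ 0 :=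
    eventually_all.2 fun x => eventually_ne_zero_of_analytic (hsa x) (hs0 x) 0
  refine ⟨U, V, hU, hV, ?_, hVV, fun b p => ?_, hVm, fun t => ?_⟩
  · refine (hU.conjTranspose.mul hU).eq_of_eventually (AnM.const 1) (t₀ := 0) ?_
    filter_upwards [hev] with t ht
    ext x y
    have h1 := congrFun (congrFun (hNN t) x) y
    rw [hNU', conjTranspose_mul, diagonal_conjTranspose, Matrix.mul_assoc, diagonal_mul,
      ← Matrix.mul_assoc, mul_diagonal] at h1
    have h2 : star (s x t) ≠ 0 := star_ne_zero.2 (ht x)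
    apply mul_left_cancel₀ h2
    apply mul_right_cancel₀ (ht y)
    rw [mul_assoc]
    refine h1.trans ?_
    by_cases hxy : x = y
    · subst hxy
      rw [diagonal_apply_eq, one_apply_eq, mul_one]
      exact (conj_phased_mul (S.orb x.1) x.2 t).symm
    · rw [diagonal_apply_ne _ hxy, one_apply_ne hxy, mul_zero, zero_mul]
  · rw [multiplexed_one_iff]
    intro i j hij t
    have h1 := multiplexed_one_iff.1 (hS.multiplexed_phased (S.orb b)) i j hij
    have h2 := fun p => multiplexed_one_iff.1 (hVm b p) i j hij
    refine congrFun (eq_of_smul_eq_smul (hsa ⟨b, j⟩) (hs0 ⟨b, j⟩)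
      (analyticOnNhd_shift (hU p ⟨b, i⟩) _).continuous (hU p ⟨b, j⟩).continuous fun t => ?_) t
    rw [smul_eq_mul, smul_eq_mul, ← hNU]
    have h3 := hNU (t + 2 * Real.pi) p ⟨b, i⟩
    have h4 : s ⟨b, i⟩ (t + 2 * Real.pi) = s ⟨b, j⟩ t := h1 t
    rw [h4] at h3
    rw [← h3, haT, Matrix.mul_apply, Matrix.mul_apply]
    exact Finset.sum_congr rfl fun q _ => by rw [h2 q t]
  · rw [← hNU', Matrix.mul_assoc, haV]

end Core
end OrbitSystem

/-! ### Block diagonal matrices -/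

section BlockDiag

variable {B : ℕ} {size : Fin B → ℕ}

lemma offset_add_eq (x : Σ b : Fin B, Fin (size b)) :
    offset size x.1 + x.2 = (finSigmaFinEquiv x : ℕ) := by
  rw [finSigmaFinEquiv_apply, offset]
  congr 1
  refine (Finset.sum_bij (fun (i : Fin x.1) _ => Fin.castLE x.1.2.le i) ?_ ?_ ?_ ?_).symm
  · intro i _
    simp only [Finset.mem_filter, Finset.mem_univ, true_and]
    exact i.2
  · intro i _ j _ h
    simpa using h
  · intro c hc
    simp only [Finset.mem_filter, Finset.mem_univ, true_and] at hc
    exact ⟨⟨c, hc⟩, Finset.mem_univ _, rfl⟩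
  · intro i _
    rfl

/-- The row or column of a block diagonal matrix in which the row or column `x.2` of block `x.1`
lies. -/
def place {m : ℕ} (h : ∑ b, size b ≤ m) (x : Σ b : Fin B, Fin (size b)) : Fin m :=
  Fin.castLE h (finSigmaFinEquiv x)

lemma place_injective {m : ℕ} (h : ∑ b, size b ≤ m) : Function.Injective (place (size := size) h) :=
  (Fin.castLE_injective h).comp finSigmaFinEquiv.injective

lemma eq_place_iff {m : ℕ} (h : ∑ b, size b ≤ m) (x : Σ b : Fin B, Fin (size b)) (p : Fin m) :
    p = place h x ↔ (p : ℕ) = offset size x.1 + x.2 := by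
  rw [offset_add_eq, Fin.ext_iff]
  rfl

/-- A block diagonal matrix in the upper left corner of an `m × n` matrix is `blockDiagonal'` between
the inclusions of the first coordinates. -/
lemma blockDiag_eq {m n : ℕ} (hm : ∑ b, size b ≤ m) (hn : ∑ b, size b ≤ n)
    (D : ∀ b, Matrix (Fin (size b)) (Fin (size b)) ℂ) :
    blockDiag m n size D = (1 : Matrix (Fin m) (Fin m) ℂ).submatrix id (place hm) *
      blockDiagonal' D * ((1 : Matrix (Fin n) (Fin n) ℂ).submatrix id (place hn))ᴴ := by
  ext p q
  have hR : ∀ y : Σ b : Fin B, Fin (size b),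
      ((1 : Matrix (Fin m) (Fin m) ℂ).submatrix id (place hm) * blockDiagonal' D) p y =
        ∑ i : Fin (size y.1), if (p : ℕ) = offset size y.1 + i then D y.1 i y.2 else 0 := by
    rintro ⟨b, j⟩
    rw [Matrix.mul_apply, Fintype.sum_sigma, Finset.sum_eq_single b]
    · refine Finset.sum_congr rfl fun i _ => ?_
      rw [blockDiagonal'_apply_eq, submatrix_apply, Matrix.one_apply, id]
      simp only [eq_place_iff, ite_mul, one_mul, zero_mul]
    · intro c _ hc
      refine Finset.sum_eq_zero fun i _ => ?_
      rw [blockDiagonal'_apply_ne _ _ _ hc, mul_zero]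
    · simp
  rw [Matrix.mul_apply, Fintype.sum_sigma]
  refine Finset.sum_congr rfl fun b _ => ?_
  refine Finset.sum_comm.trans (Finset.sum_congr rfl fun j _ => ?_)
  rw [hR, conjTranspose_apply, submatrix_apply, Matrix.one_apply, id, Finset.sum_mul]
  refine Finset.sum_congr rfl fun i _ => ?_
  simp only [eq_place_iff]
  by_cases h1 : (p : ℕ) = offset size b + i <;> by_cases h2 : (q : ℕ) = offset size b + j <;>
    simp [h1, h2]

lemma mul_one_submatrix {α : Type*} {β : Type*} {m : ℕ} (X : Matrix α (Fin m) ℂ) (e : β → Fin m) :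
    X * (1 : Matrix (Fin m) (Fin m) ℂ).submatrix id e = X.submatrix id e := by
  ext i j
  simp [Matrix.mul_apply, Matrix.one_apply]

lemma mul_blockDiag_mul {m n : ℕ} (hm : ∑ b, size b ≤ m) (hn : ∑ b, size b ≤ n)
    (D : ∀ b, Matrix (Fin (size b)) (Fin (size b)) ℂ) {α β : Type*}
    (U : Matrix α (Fin m) ℂ) (V : Matrix β (Fin n) ℂ) :
    U * blockDiag m n size D * Vᴴ =
      U.submatrix id (place hm) * blockDiagonal' D * (V.submatrix id (place hn))ᴴ := by
  rw [blockDiag_eq hm hn, ← mul_one_submatrix U, ← mul_one_submatrix V, conjTranspose_mul]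
  simp only [Matrix.mul_assoc]

end BlockDiag

/-! ### Orbits of an injective map on a finite set -/

/-- An injective map of a finite set into itself permutes it, and the set is the disjoint union of
the cycles; `x ν` is a point of cycle `ν`, which has `k ν` elements. -/
lemma exists_orbits {α : Type*} {s : α → α} (hs : Function.Injective s) {Λ : Set α}
    (hfin : Λ.Finite) (hmap : Set.MapsTo s Λ Λ) :
    ∃ (R : ℕ) (k : Fin R → ℕ) (x : Fin R → α), (∀ ν, 0 < k ν) ∧ (∀ ν, s^[k ν] (x ν) = x ν) ∧
      (∀ ν, x ν ∈ Λ) ∧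
      Function.Injective (fun p : Σ ν, Fin (k ν) => s^[(p.2 : ℕ)] (x p.1)) ∧
      ∀ y ∈ Λ, ∃ p : Σ ν, Fin (k ν), y = s^[(p.2 : ℕ)] (x p.1) := by
  have hit : ∀ i, Set.MapsTo s^[i] Λ Λ := fun i => hmap.iterate i
  have hper : ∀ y ∈ Λ, 0 < Function.minimalPeriod s y := by
    intro y hy
    rw [Function.minimalPeriod_pos_iff_mem_periodicPts]
    obtain ⟨i, j, hij, h⟩ : ∃ i j : ℕ, i < j ∧ s^[i] y = s^[j] y := by
      by_contra! hc
      have hinj : Function.Injective fun i : ℕ => s^[i] y := by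
        intro i j h
        rcases lt_trichotomy i j with hij | hij | hij
        · exact absurd h (hc i j hij)
        · exact hij
        · exact absurd h.symm (hc j i hij)
      exact Set.infinite_range_of_injective hinj
        (hfin.subset (Set.range_subset_iff.2 fun i => hit i hy))
    refine ⟨j - i, by omega, ?_⟩
    have h2 : s^[i] (s^[j - i] y) = s^[i] y := by
      rw [← Function.iterate_add_apply, Nat.add_sub_cancel' hij.le, h]
    exact hs.iterate i h2
  let r : Setoid Λ :=
    { r := fun y z => ∃ i, s^[i] y = z
      iseqv :=
        { refl := fun y => ⟨0, rfl⟩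
          symm := by
            rintro ⟨y, hy⟩ ⟨z, hz⟩ ⟨i, rfl : s^[i] y = z⟩
            have hp := hper y hy
            refine ⟨Function.minimalPeriod s y - i % Function.minimalPeriod s y, ?_⟩
            change s^[_] (s^[i] y) = y
            rw [← Function.iterate_mod_minimalPeriod_eq (n := i), ← Function.iterate_add_apply,
              Nat.sub_add_cancel (Nat.mod_lt _ hp).le, Function.iterate_minimalPeriod]
          trans := by
            rintro ⟨y, hy⟩ ⟨z, hz⟩ ⟨w, hw⟩ ⟨i, rfl : s^[i] y = z⟩ ⟨j, rfl : s^[j] _ = w⟩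
            exact ⟨j + i, Function.iterate_add_apply _ _ _ _⟩ } }
  have : Finite Λ := hfin
  have : Fintype (Quotient r) := Fintype.ofFinite _
  set e := Fintype.equivFin (Quotient r)
  set x : Fin (Fintype.card (Quotient r)) → Λ := fun ν => (e.symm ν).out with hx
  refine ⟨Fintype.card (Quotient r), fun ν => Function.minimalPeriod s (x ν), fun ν => x ν,
    fun ν => hper _ (x ν).2, fun ν => Function.iterate_minimalPeriod, fun ν => (x ν).2, ?_, ?_⟩
  · rintro ⟨ν, i⟩ ⟨ν', i'⟩ h
    have h' : s^[(i : ℕ)] (x ν) = s^[(i' : ℕ)] (x ν') := h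
    have h1 : r (x ν) ⟨s^[(i : ℕ)] (x ν), hit _ (x ν).2⟩ := ⟨i, rfl⟩
    have h2 : r (x ν') ⟨s^[(i : ℕ)] (x ν), hit _ (x ν).2⟩ := ⟨i', h'.symm⟩
    have h3 : (e.symm ν) = e.symm ν' := by
      rw [← Quotient.out_eq (e.symm ν), ← Quotient.out_eq (e.symm ν')]
      exact Quotient.sound (r.trans h1 (r.symm h2))
    obtain rfl := e.symm.injective h3
    have h4 := Function.iterate_injOn_Iio_minimalPeriod (f := s) (x := (x ν : α)) i.2 i'.2 h'
    rw [Fin.ext h4]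
  · intro y hy
    set ν := e ⟦⟨y, hy⟩⟧ with hν
    have h1 : r (x ν) ⟨y, hy⟩ := by
      have : x ν = (⟦⟨y, hy⟩⟧ : Quotient r).out := by rw [hx, hν]; simp
      rw [this]
      exact Quotient.mk_out _
    obtain ⟨i, hi⟩ := h1
    refine ⟨⟨ν, i % Function.minimalPeriod s (x ν), Nat.mod_lt _ (hper _ (x ν).2)⟩, ?_⟩
    change y = s^[i % Function.minimalPeriod s (x ν)] (x ν)
    rw [Function.iterate_mod_minimalPeriod_eq]
    exact hi.symm

lemma card_le_of_conjTranspose_mul {m ι : Type*} [Fintype m] [Fintype ι] [DecidableEq ι]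
    {U : Matrix m ι ℂ} (h : Uᴴ * U = 1) : Fintype.card ι ≤ Fintype.card m := by
  have h1 := Matrix.rank_mul_le_right Uᴴ U
  rw [h, Matrix.rank_one] at h1
  exact h1.trans (Matrix.rank_le_card_height U)

/-! ### The analytic singular value decomposition -/

section Existence

variable {m n : Type} [Fintype m] [DecidableEq m] [Fintype n] [DecidableEq n]
  {a : ℝ → Matrix m n ℂ}

/-- The analytic singular values, arranged in orbits but not yet listed with multiplicities: every
eigenvalue of `aᴴ a` is a square of one of them or zero, and conversely. -/
lemma exists_orbitFamily (ha : AnM a) (haT : ∀ t, a (t + 2 * Real.pi) = a t) :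
    ∃ S : OrbitSystem, S.IsOrbitFamily ∧
      (∀ t (v : n → ℂ) (x : ℝ), v ≠ 0 → ((a t)ᴴ * a t) *ᵥ v = (x : ℂ) • v → ∃ o, S.eig o t = x) ∧
      ∀ ν i t, S.σ ν i t ≠ 0 →
        ∃ v : n → ℂ, v ≠ 0 ∧ ((a t)ᴴ * a t) *ᵥ v = ((S.σ ν i t ^ 2 : ℝ) : ℂ) • v := by
  obtain ⟨l, hl, hu⟩ := exists_wielandt ha
  set s : (ℝ → ℝ) → ℝ → ℝ := fun g t => g (t + 2 * Real.pi) with hs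
  have hs_inj : Function.Injective s := fun g h hgh => by
    ext t
    have := congrFun hgh (t - 2 * Real.pi)
    simpa [hs] using this
  have hit : ∀ (i : ℕ) g, s^[i] g = fun t => g (t + 2 * Real.pi * i) := by
    intro i
    induction i with
    | zero => intro g; simp
    | succ i ih =>
      intro g
      rw [Function.iterate_succ_apply, ih]
      ext t
      simp only [hs]
      congr 1
      push_cast
      ring
  set Λ : Set (ℝ → ℝ) := {g | (∃ i, g = fun t => l i t ^ 2) ∧ ∃ t, g t ≠ 0} with hΛ
  have hfin : Λ.Finite :=
    (Set.finite_range fun i t => l i t ^ 2).subset fun g hg => by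
      obtain ⟨⟨i, rfl⟩, -⟩ := hg
      exact ⟨i, rfl⟩
  have hmap : Set.MapsTo s Λ Λ := by
    rintro g ⟨⟨i, rfl⟩, t₁, ht₁⟩
    have hne := eventually_ne_zero_of_analytic (analyticOnNhd_shift (hl i) (2 * Real.pi))
      ⟨t₁ - 2 * Real.pi, by simpa using ht₁⟩ 0
    obtain ⟨j, hj⟩ := exists_eq_of_frequently (g := fun t => l i (t + 2 * Real.pi) ^ 2)
      (f := fun j t => l j t ^ 2) (t₀ := 0) isPreconnected_univ
      ((analyticOnNhd_shift (hl i) _).pow 2) (fun j => (hl j).pow 2) (Set.mem_univ _)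
      (Eventually.frequently (by
        filter_upwards [hne] with t ht
        obtain ⟨v, hv, hv'⟩ := (hu (t + 2 * Real.pi)).wielandt_exists_vec ht
        rw [haT] at hv'
        obtain ⟨j, hj⟩ := (hu t).wielandt_exists_sq hv hv'
        exact ⟨j, hj.symm⟩))
    exact ⟨⟨j, funext fun t => hj (Set.mem_univ t)⟩, t₁ - 2 * Real.pi, by simpa [hs] using ht₁⟩
  obtain ⟨R, k, x, hk, hkx, hxΛ, hinj, hsurj⟩ := exists_orbits hs_inj hfin hmap
  choose c hc using fun ν => (hxΛ ν).1
  have hsq : ∀ ν t, l (c ν) (t + 2 * Real.pi * k ν) ^ 2 = l (c ν) t ^ 2 := fun ν t => by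
    have h := congrFun (hkx ν) t
    rwa [hit, hc] at h
  have hsign : ∀ ν, ∃ κ : ℕ, (κ = 1 ∨ κ = 2) ∧
      ∀ t, l (c ν) (t + 2 * Real.pi * k ν) = (-1) ^ (κ - 1) * l (c ν) t := by
    intro ν
    obtain ⟨b, hb⟩ := exists_eq_of_frequently (g := fun t => l (c ν) (t + 2 * Real.pi * k ν))
      (f := fun (b : Bool) t => (if b then 1 else -1) * l (c ν) t) (t₀ := 0) isPreconnected_univ
      (analyticOnNhd_shift (hl _) _) (fun b => analyticOnNhd_const.mul (hl _)) (Set.mem_univ _)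
      (Eventually.frequently (Eventually.of_forall fun t => by
        rcases sq_eq_sq_iff_eq_or_eq_neg.1 (hsq ν t) with h | h
        · exact ⟨true, by simpa using h⟩
        · exact ⟨false, by simpa using h⟩))
    refine ⟨if b then 1 else 2, by cases b <;> simp, fun t => (hb (Set.mem_univ t)).trans ?_⟩
    cases b <;> simp
  choose κ hκ hκl using hsign
  set S : OrbitSystem :=
    { R := R
      k := k
      κ := κ
      σ := fun ν i t => l (c ν) (t + 2 * Real.pi * (i : ℕ))
      B := 0
      orb := Fin.elim0 } with hS
  have hσ : ∀ p : (Σ ν : Fin R, Fin (k ν)), s^[(p.2 : ℕ)] (x p.1) = S.eig (some p) := by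
    intro p
    rw [hit, hc]
    rfl
  refine ⟨S, ⟨hk, hκ, fun ν i => analyticOnNhd_shift (hl _) _, fun ν i => ?_, fun p q hpq => ?_,
    fun ν => multiplexed_of_shift (hκl ν)⟩, fun t v y hv hy => ?_, fun ν i t ht => ?_⟩
  · obtain ⟨t, ht⟩ := (hxΛ ν).2
    rw [hc] at ht
    refine ⟨t - 2 * Real.pi * (i : ℕ), ?_⟩
    change l (c ν) (t - 2 * Real.pi * (i : ℕ) + 2 * Real.pi * (i : ℕ)) ≠ 0
    simpa using ht
  · by_contra! h
    refine hpq (hinj ?_)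
    beta_reduce
    rw [hσ, hσ]
    ext t
    exact (sq_eq_sq_iff_abs_eq_abs _ _).2 (h t)
  · obtain ⟨i, rfl⟩ := (hu t).wielandt_exists_sq hv hy
    by_cases h0 : ∃ t, (fun t => l i t ^ 2) t ≠ 0
    · obtain ⟨p, hp⟩ := hsurj (fun t => l i t ^ 2) ⟨⟨i, rfl⟩, h0⟩
      exact ⟨some p, by rw [← hσ, ← hp]⟩
    · push Not at h0
      exact ⟨none, (h0 t).symm⟩
  · obtain ⟨v, hv, hv'⟩ := (hu (t + 2 * Real.pi * (i : ℕ))).wielandt_exists_vec ht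
    rw [OrbitSystem.periodic_nat_mul haT] at hv'
    exact ⟨v, hv, hv'⟩

/-- An eigenvector of `M t` for the eigenvalue `l i t` lies in the range of `P i t` when the other
eigenvalues differ. -/
lemma SpectralSystem.proj_mulVec {I : Type} [Fintype I] {M : ℝ → Matrix n n ℂ}
    {l : I → ℝ → ℝ} {P : I → ℝ → Matrix n n ℂ} (h : SpectralSystem M l P) {i : I} {t : ℝ}
    (ht : ∀ j ≠ i, l j t ≠ l i t) {v : n → ℂ} (hv : M t *ᵥ v = (l i t : ℂ) • v) :
    P i t *ᵥ v = v := by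
  have h0 : ∀ j ≠ i, P j t *ᵥ v = 0 := by
    intro j hj
    have h1 : P j t * M t = (l j t : ℂ) • P j t := by
      have := congrArg Matrix.conjTranspose (h.mul_proj j t)
      rwa [conjTranspose_mul, conjTranspose_smul, h.proj_conjTranspose, h.hermitian,
        RCLike.star_def, Complex.conj_ofReal] at this
    have h2 : (l j t : ℂ) • (P j t *ᵥ v) = (l i t : ℂ) • (P j t *ᵥ v) := by
      rw [← smul_mulVec, ← h1, ← mulVec_mulVec, hv, mulVec_smul]
    rw [← sub_eq_zero, ← sub_smul, smul_eq_zero] at h2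
    refine h2.resolve_left fun h3 => ht j hj ?_
    exact_mod_cast sub_eq_zero.1 h3
  have h1 : (∑ j, P j t) *ᵥ v = v := by rw [h.sum_proj, one_mulVec]
  rwa [Matrix.sum_mulVec, Finset.sum_eq_single i (fun j _ hj => h0 j hj) (by simp)] at h1

omit [DecidableEq m] in
lemma OrbitSystem.IsOrbitFamily.exists_spectralSystem {S : OrbitSystem} (hS : S.IsOrbitFamily)
    (ha : AnM a)
    (h : ∀ t (v : n → ℂ) (x : ℝ), v ≠ 0 → ((a t)ᴴ * a t) *ᵥ v = (x : ℂ) • v → ∃ o, S.eig o t = x) :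
    ∃ P, SpectralSystem (fun t => (a t)ᴴ * a t) S.eig P := by
  refine AnalyticSVD.exists_spectralSystem (ha.conjTranspose.mul ha) hS.analytic_eig
    hS.eig_injective fun t => ?_
  have hh : ((a t)ᴴ * a t).IsHermitian := isHermitian_conjTranspose_mul_self _
  have hd := UDiag.of_isHermitian hh
  have hc : ∀ k, ∃ o, S.eig o t = hh.eigenvalues k := fun k => by
    obtain ⟨v, hv, hv'⟩ := hd.exists_eigenvector k
    exact h t v _ hv hv'
  choose c hc using hc
  obtain ⟨Q, hQ, hJ⟩ := hd
  refine ⟨Q, c, Matrix.mem_unitaryGroup_iff'.1 hQ, hJ.trans ?_⟩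
  simp only [hc]

end Existence

open OrbitSystem in
/-- The orbits can be listed with multiplicities, the multiplicity of an orbit being the rank of
its spectral projections. -/
lemma exists_multiplexedSVD_of_periodic {m n : Type} [Fintype m] [DecidableEq m] [Fintype n]
    [DecidableEq n] {a : ℝ → Matrix m n ℂ} (ha : AnM a) (haT : ∀ t, a (t + 2 * Real.pi) = a t) :
    ∃ (S : OrbitSystem) (U : ℝ → Matrix m S.Idx ℂ) (V : ℝ → Matrix n S.Idx ℂ),
      S.IsOrbitFamily ∧ Function.Surjective S.orb ∧ MultiplexedSVD S a U V := by
  obtain ⟨S, hS, hspec, hvec⟩ := exists_orbitFamily ha haT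
  obtain ⟨P, hP⟩ := hS.exists_spectralSystem ha hspec
  have hMT : ∀ t, (a (t + 2 * Real.pi))ᴴ * a (t + 2 * Real.pi) = (a t)ᴴ * a t := fun t => by
    rw [haT]
  choose ι hι hι' Q hQ hQT hQQ hQP using fun ν => exists_frame (2 * Real.pi * S.k ν)
    (hP.analytic_proj (some ⟨ν, ⟨0, hS.size_pos ν⟩⟩)) (hP.proj_conjTranspose _) (hP.proj_mul_self _)
    (hS.proj_period hMT hP ν)
  have hne : ∀ ν, Nonempty (ι ν) := by
    intro ν
    by_contra hemp
    rw [not_nonempty_iff] at hemp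
    set y : Option (Σ ν : Fin S.R, Fin (S.k ν)) := some ⟨ν, ⟨0, hS.size_pos ν⟩⟩ with hy
    have hev : ∀ o, ∀ᶠ t in 𝓝[≠] (0 : ℝ), o ≠ y → S.eig o t ≠ S.eig y t := by
      intro o
      by_cases ho : o = y
      · exact Eventually.of_forall fun t h => absurd ho h
      · have h2 := eventually_ne_zero_of_analytic ((hS.analytic_eig o).sub (hS.analytic_eig y)) (by
            obtain ⟨t, ht⟩ := Function.ne_iff.1 fun h => ho (hS.eig_injective h)
            exact ⟨t, sub_ne_zero.2 ht⟩) 0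
        filter_upwards [h2] with t ht _
        exact sub_ne_zero.1 ht
    obtain ⟨t, ht⟩ := (eventually_all.2 hev).exists
    have h0 : S.σ ν ⟨0, hS.size_pos ν⟩ t ≠ 0 := fun h0 => ht none (by simp [hy]) (by
      simp [hy, eig, h0])
    obtain ⟨v, hv, hv'⟩ := hvec ν _ t h0
    have h1 := hP.proj_mulVec ht hv'
    have h2 : P y t = 0 := by
      rw [← hQP]
      ext i j
      simp [Matrix.mul_apply]
    rw [h2, zero_mulVec] at h1
    exact hv h1.symm
  set e := Fintype.equivFin (Σ ν, ι ν) with he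
  set S' : OrbitSystem := { S with
    B := Fintype.card (Σ ν, ι ν)
    orb := fun b => (e.symm b).1 } with hS'def
  have hS' : S'.IsOrbitFamily := ⟨hS.1, hS.2, hS.3, hS.4, hS.5, hS.6⟩
  let E : ∀ ν : Fin S.R, {b // S'.orb b = ν} ≃ ι ν := fun ν =>
    (e.symm.subtypeEquiv fun b => Iff.rfl).trans (Equiv.sigmaSubtype ν)
  have hP' : SpectralSystem (fun t => (a t)ᴴ * a t) S'.eig P := by
    have h1 : S'.eig = S.eig := by
      funext o
      cases o <;> rfl
    rw [h1]
    exact hP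
  obtain ⟨U, V, hUV⟩ := hS'.exists_multiplexedSVD ha haT hP'
    (Q := fun ν t => (Q ν t).submatrix id (E ν)) (fun ν i j => hQ ν i _)
    (fun ν t => congrArg (fun X => X.submatrix id (E ν)) (hQT ν t))
    (fun ν t => by
      rw [conjTranspose_submatrix, ← submatrix_mul _ _ _ _ _ Function.bijective_id, hQQ,
        submatrix_one_equiv])
    (fun ν t => by
      rw [conjTranspose_submatrix, submatrix_mul_equiv, hQP, submatrix_id_id])
  refine ⟨S', U, V, hS', fun ν => ?_, hUV⟩
  obtain ⟨x⟩ := hne ν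
  exact ⟨e ⟨ν, x⟩, congrArg Sigma.fst (e.symm_apply_apply ⟨ν, x⟩)⟩

/-! ### Restriction to the unit circle -/

lemma circ_add_two_pi (t : ℝ) : circ (t + 2 * Real.pi) = circ t := by
  have : Complex.I * ((t + 2 * Real.pi : ℝ) : ℂ) = Complex.I * t + 2 * Real.pi * Complex.I := by
    push_cast; ring
  rw [circ, circ, this, Complex.exp_add, Complex.exp_two_pi_mul_I, mul_one]

lemma norm_circ (t : ℝ) : ‖circ t‖ = 1 := by
  rw [circ, mul_comm, Complex.norm_exp_ofReal_mul_I]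

lemma circ_arg {z : ℂ} (hz : ‖z‖ = 1) : circ (Complex.arg z) = z := by
  conv_rhs => rw [← Complex.norm_mul_exp_arg_mul_I z, hz]
  rw [circ, Complex.ofReal_one, one_mul, mul_comm]

lemma analyticOnNhd_circ : AnalyticOnNhd ℝ circ Set.univ := analyticOnNhd_cexp Complex.I

lemma analyticOnNhd_comp_circ {f : ℂ → ℂ} (hf : AnalyticOnNhd ℂ f (Metric.sphere 0 1)) :
    AnalyticOnNhd ℝ (fun t => f (circ t)) Set.univ := fun t _ =>
  ((hf (circ t) (by simp [norm_circ])).restrictScalars (𝕜 := ℝ)).comp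
    (analyticOnNhd_circ t (Set.mem_univ t))

lemma AnalyticEntries.anM_comp_circ {m n : ℕ} {A : ℂ → Matrix (Fin m) (Fin n) ℂ}
    (hA : AnalyticEntries ℂ A (Metric.sphere 0 1)) : AnM fun t => A (circ t) :=
  fun i j => analyticOnNhd_comp_circ (hA i j)

lemma OrbitSystem.sum_size_le (S : OrbitSystem) {m : ℕ} {U : Matrix (Fin m) S.Idx ℂ}
    (h : Uᴴ * U = 1) : ∑ b, S.size b ≤ m := by
  simpa [OrbitSystem.Idx, Fintype.card_sigma] using card_le_of_conjTranspose_mul h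

/-- The phases of the multiplexed singular values are moved to the left singular vectors, and the
singular vectors are completed to unitary matrices. -/
theorem exists_isSingularSystem {m n : ℕ} {A : ℂ → Matrix (Fin m) (Fin n) ℂ}
    (hA : AnalyticEntries ℂ A (Metric.sphere 0 1)) : ∃ S : OrbitSystem, S.IsSingularSystem A := by
  obtain ⟨S, U, V, hS, horb, h⟩ := exists_multiplexedSVD_of_periodic hA.anM_comp_circ
    (fun t => by rw [circ_add_two_pi])
  have hm := S.sum_size_le (h.left_orthonormal 0)
  have hn := S.sum_size_le (h.right_orthonormal 0)
  set p : S.Idx → ℝ → ℂ := fun x t =>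
    Complex.exp (S.phaseExp (S.orb x.1) * ((t + 2 * Real.pi * (x.2 : ℕ) : ℝ) : ℂ)) with hp
  have hpa : ∀ x, AnalyticOnNhd ℝ (p x) Set.univ := fun x =>
    analyticOnNhd_shift (analyticOnNhd_cexp (S.phaseExp (S.orb x.1))) _
  obtain ⟨U', hU', -, hU'u, hU'U⟩ := exists_unitary_completion 0
    (V := fun t => U t * diagonal fun x => p x t)
    (h.analytic_left.mul (AnM.diagonal hpa)) (fun t => by rw [add_zero]) (fun t => by
      rw [conjTranspose_mul, Matrix.mul_assoc, ← Matrix.mul_assoc _ (U t), h.left_orthonormal,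
        Matrix.one_mul, diagonal_conjTranspose, diagonal_mul_diagonal, ← diagonal_one]
      congr 1
      ext x
      rw [Pi.star_apply, RCLike.star_def, Complex.conj_mul', hp, OrbitSystem.norm_exp_phase]
      simp)
    (place_injective hm)
  obtain ⟨V', hV', -, hV'u, hV'V⟩ := exists_unitary_completion 0 h.analytic_right
    (fun t => by rw [add_zero]) h.right_orthonormal (place_injective hn)
  refine ⟨S, hS.1, hS.2, hS.3, hS.4, hS.5, hS.6, horb, hm, hn, U', V', hU', hV', hU'u, hV'u,
    fun t => ?_⟩
  rw [mul_blockDiag_mul hm hn, hU'U, hV'V, h.eq_mul, blockDiagonal'_diagonal]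
  congr 1
  rw [Matrix.mul_assoc, diagonal_mul_diagonal]
  rfl

/-! ### Holomorphic extension from the unit circle to an annulus -/

/-- A complex-valued function of a real variable that is analytic at a point is, near this point,
the restriction of a holomorphic function. -/
lemma exists_analyticAt_ofReal {f : ℝ → ℂ} {t₀ : ℝ} (hf : AnalyticAt ℝ f t₀) :
    ∃ G : ℂ → ℂ, AnalyticAt ℂ G 0 ∧ ∀ᶠ y : ℝ in 𝓝 0, G y = f (t₀ + y) := by
  obtain ⟨p, hp⟩ := hf
  obtain ⟨a, ha, hap⟩ := ENNReal.lt_iff_exists_nnreal_btwn.1 hp.radius_pos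
  obtain ⟨C, hC, hCp⟩ := p.norm_mul_pow_le_of_lt_radius hap
  set q := FormalMultilinearSeries.ofScalars ℂ p.coeff with hq
  have hqr : 0 < q.radius := ha.trans_le (q.le_radius_of_bound C fun n => by
    rw [hq, FormalMultilinearSeries.ofScalars_norm,
      ← FormalMultilinearSeries.norm_apply_eq_norm_coef]
    exact hCp n)
  have hqs := (q.hasFPowerSeriesOnBall hqr).hasFPowerSeriesAt
  refine ⟨q.sum, hqs.analyticAt, ?_⟩
  have h1 := hasFPowerSeriesAt_iff.1 hp
  have h2 : ∀ᶠ y : ℝ in 𝓝 0, HasSum (fun n => (y : ℂ) ^ n • q.coeff n) (q.sum (0 + y)) :=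
    (Complex.continuous_ofReal.tendsto' 0 0 Complex.ofReal_zero).eventually
      (hasFPowerSeriesAt_iff.1 hqs)
  filter_upwards [h1, h2] with y hy1 hy2
  rw [zero_add] at hy2
  refine hy2.unique (hy1.congr_fun fun n => ?_)
  rw [hq, FormalMultilinearSeries.coeff_ofScalars, Complex.real_smul, smul_eq_mul,
    Complex.ofReal_pow]

/-- Local extension: near a point of the circle, a function on the circle that is analytic in the
angle is the restriction of a holomorphic function. -/
lemma exists_local_extension {f : ℝ → ℂ} (hf : AnalyticOnNhd ℝ f Set.univ)
    (hfT : ∀ t, f (t + 2 * Real.pi) = f t) {p : ℂ} (hp : ‖p‖ = 1) :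
    ∃ h : ℂ → ℂ, AnalyticAt ℂ h p ∧ ∀ᶠ w in 𝓝 p, ∀ t, w = circ t → h w = f t := by
  obtain ⟨G, hG, hGf⟩ := exists_analyticAt_ofReal (hf (Complex.arg p) (Set.mem_univ _))
  have hp0 : p ≠ 0 := by
    rintro rfl
    simp at hp
  have hlog : AnalyticAt ℂ (fun w => -Complex.I * Complex.log (w / p)) p := by
    refine analyticAt_const.mul (AnalyticAt.clog (analyticAt_id.div_const) ?_)
    simp [hp0]
  have hlog0 : -Complex.I * Complex.log (p / p) = 0 := by simp [hp0]
  refine ⟨fun w => G (-Complex.I * Complex.log (w / p)), ?_, ?_⟩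
  · exact AnalyticAt.comp (by rw [hlog0]; exact hG) hlog
  · have harg : ContinuousAt (fun w : ℂ => Complex.arg (w / p)) p := by
      refine ContinuousAt.comp (Complex.continuousAt_arg ?_) (continuousAt_id.div_const p)
      simp [hp0]
    have harg0 : Complex.arg (p / p) = 0 := by simp [hp0]
    have h1 : ∀ᶠ w : ℂ in 𝓝 p, G (Complex.arg (w / p) : ℝ) =
        f (Complex.arg p + Complex.arg (w / p)) :=
      Tendsto.eventually (by rw [ContinuousAt, harg0] at harg; exact harg) hGf
    filter_upwards [h1] with w hw t hwt
    have hw1 : ‖w / p‖ = 1 := by rw [norm_div, hp, hwt, norm_circ, div_one]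
    have h2 : -Complex.I * Complex.log (w / p) = ((Complex.arg (w / p) : ℝ) : ℂ) := by
      rw [Complex.log, hw1, Real.log_one, Complex.ofReal_zero, zero_add, mul_comm _ Complex.I,
        ← mul_assoc, neg_mul, Complex.I_mul_I, neg_neg, one_mul]
    rw [h2, hw]
    -- both angles belong to the same point of the circle
    have h3 : circ (Complex.arg p + Complex.arg (w / p)) = circ t := by
      rw [← hwt, circ, Complex.ofReal_add, mul_add, Complex.exp_add]
      change circ _ * circ _ = w
      rw [circ_arg hp, circ_arg hw1, mul_div_cancel₀ _ hp0]
    obtain ⟨k, hk⟩ := Complex.exp_eq_exp_iff_exists_int.1 h3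
    have h5 : Complex.arg p + Complex.arg (w / p) = t + k * (2 * Real.pi) := by
      have : Complex.I * ((Complex.arg p + Complex.arg (w / p) : ℝ) : ℂ)
          = Complex.I * ((t + k * (2 * Real.pi) : ℝ) : ℂ) := by
        rw [hk]; push_cast; ring
      exact_mod_cast mul_left_cancel₀ Complex.I_ne_zero this
    rw [h5]
    exact (Function.Periodic.int_mul hfT k) t

/-- Every point of the circle is an accumulation point of the circle. -/
lemma frequently_circ {p : ℂ} (hp : ‖p‖ = 1) : ∃ᶠ w in 𝓝[≠] p, ∃ t, w = circ t := by
  have hd : HasDerivAt circ (Complex.exp (Complex.I * (Complex.arg p)) * (Complex.I * 1))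
      (Complex.arg p) :=
    ((Complex.ofRealCLM.hasDerivAt (x := Complex.arg p)).const_mul Complex.I).cexp
  have h1 := hd.tendsto_nhdsNE (by simp)
  rw [circ_arg hp] at h1
  exact h1.frequently (Eventually.of_forall fun t => ⟨t, rfl⟩).frequently

/-! ### Thin annuli -/

lemma annulus_subset {r s : ℝ} (hr : 0 < r) (h : r ≤ s) : annulus r ⊆ annulus s := fun _ hz =>
  ⟨(inv_anti₀ hr h).trans_lt hz.1, hz.2.trans_le h⟩

lemma isOpen_annulus (r : ℝ) : IsOpen (annulus r) :=
  (isOpen_lt continuous_const continuous_norm).inter (isOpen_lt continuous_norm continuous_const)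

lemma ne_zero_of_mem_annulus {r : ℝ} (hr : 1 < r) {z : ℂ} (hz : z ∈ annulus r) : z ≠ 0 :=
  norm_pos_iff.1 ((inv_pos.2 (one_pos.trans hr)).trans hz.1)

lemma circ_mem_annulus {r : ℝ} (hr : 1 < r) (t : ℝ) : circ t ∈ annulus r := by
  rw [annulus, Set.mem_ofPred_eq, norm_circ]
  exact ⟨inv_lt_one_of_one_lt₀ hr, hr⟩

lemma norm_div_norm {z : ℂ} (hz : z ≠ 0) : ‖z / ‖z‖‖ = 1 := by
  rw [norm_div, Complex.norm_real, norm_norm, div_self (norm_ne_zero_iff.2 hz)]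

lemma mem_ball_div_norm {δ : ℝ} (hδ : 0 < δ) {z : ℂ} (hz : z ∈ annulus (1 + δ / 2)) :
    z ∈ Metric.ball (z / ‖z‖) δ := by
  have hz' : z ≠ 0 := ne_zero_of_mem_annulus (by linarith) hz
  have h1 : z - z / ‖z‖ = ((‖z‖ - 1 : ℝ) : ℂ) * (z / ‖z‖) := by
    have : (‖z‖ : ℂ) ≠ 0 := by exact_mod_cast norm_ne_zero_iff.2 hz'
    push_cast
    field_simp
  rw [Metric.mem_ball, dist_eq_norm, h1, norm_mul, norm_div_norm hz', mul_one,
    Complex.norm_real, Real.norm_eq_abs, abs_lt]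
  have h2 : 1 - δ / 2 ≤ (1 + δ / 2)⁻¹ := by
    rw [← one_div, le_div_iff₀ (by positivity)]
    nlinarith
  exact ⟨by linarith [hz.1], by linarith [hz.2]⟩

lemma eventually_of_annulus {p : Set ℂ → Prop} (hp : ∀ s t, s ⊆ t → p t → p s) {δ : ℝ} (hδ : 0 < δ)
    (h : p (annulus (1 + δ / 2))) : ∀ᶠ r in 𝓝[>] (1 : ℝ), p (annulus r) := by
  filter_upwards [Ioo_mem_nhdsGT (show (1 : ℝ) < 1 + δ / 2 by linarith)] with r hr
  exact hp _ _ (annulus_subset (by linarith [hr.1]) hr.2.le) h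

/-- A function that is analytic on the unit circle is analytic on all thin annuli. -/
lemma eventually_analyticOnNhd_annulus {f : ℂ → ℂ} (hf : AnalyticOnNhd ℂ f (Metric.sphere 0 1)) :
    ∀ᶠ r in 𝓝[>] (1 : ℝ), AnalyticOnNhd ℂ f (annulus r) := by
  obtain ⟨δ, hδ, h⟩ := (isCompact_sphere (0 : ℂ) 1).exists_thickening_subset_open
    (isOpen_analyticAt ℂ f) hf
  refine eventually_of_annulus (fun s t hst ht => ht.mono hst) hδ fun z hz => h ?_
  rw [Metric.mem_thickening_iff]
  exact ⟨z / ‖z‖, by simpa using norm_div_norm (ne_zero_of_mem_annulus (by linarith) hz),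
    mem_ball_div_norm hδ hz⟩

lemma isPreconnected_annulus {r : ℝ} (hr : 1 < r) : IsPreconnected (annulus r) := by
  have hr0 : 0 < r := by linarith
  -- the exponential function maps a vertical strip onto the annulus
  have h : annulus r = Complex.exp '' {z | z.re ∈ Set.Ioo (-Real.log r) (Real.log r)} := by
    ext z
    constructor
    · intro hz
      have hz0 := ne_zero_of_mem_annulus hr hz
      refine ⟨Complex.log z, ?_, Complex.exp_log hz0⟩
      rw [Set.mem_ofPred_eq, Complex.log_re, ← Real.log_inv]
      exact ⟨Real.log_lt_log (inv_pos.2 hr0) hz.1, Real.log_lt_log (norm_pos_iff.2 hz0) hz.2⟩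
    · rintro ⟨w, hw, rfl⟩
      rw [annulus, Set.mem_ofPred_eq, Complex.norm_exp, ← Real.exp_log hr0, ← Real.exp_neg,
        Real.exp_lt_exp, Real.exp_lt_exp]
      exact hw
  rw [h]
  exact (((convex_Ioo _ _).is_linear_preimage
    Complex.reLm.isLinear).isPreconnected).image _ Complex.continuous_exp.continuousOn

/-- Identity theorem: holomorphic functions on an annulus are determined by their values on the unit
circle. -/
lemma eqOn_annulus {r : ℝ} (hr : 1 < r) {f g : ℂ → ℂ} (hf : AnalyticOnNhd ℂ f (annulus r))
    (hg : AnalyticOnNhd ℂ g (annulus r)) (h : ∀ t, f (circ t) = g (circ t)) :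
    Set.EqOn f g (annulus r) := by
  refine hf.eqOn_of_preconnected_of_frequently_eq hg (isPreconnected_annulus hr)
    (circ_mem_annulus hr 0) ((frequently_circ (norm_circ 0)).mono ?_)
  rintro w ⟨t, rfl⟩
  exact h t

/-- An analytic function of period `2π` on the real line is the restriction to the unit circle of a
holomorphic function on an annulus. -/
theorem exists_extension {f : ℝ → ℂ} (hf : AnalyticOnNhd ℝ f Set.univ)
    (hfT : ∀ t, f (t + 2 * Real.pi) = f t) :
    ∃ g : ℂ → ℂ, (∀ t, g (circ t) = f t) ∧
      ∀ᶠ r in 𝓝[>] (1 : ℝ), AnalyticOnNhd ℂ g (annulus r) := by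
  have hloc : ∀ p : Metric.sphere (0 : ℂ) 1, ∃ (h : ℂ → ℂ) (ε : ℝ), 0 < ε ∧
      AnalyticOnNhd ℂ h (Metric.ball p ε) ∧
      ∀ w ∈ Metric.ball (p : ℂ) ε, ∀ t, w = circ t → h w = f t := by
    rintro ⟨p, hp⟩
    obtain ⟨h, hh, hhf⟩ := exists_local_extension hf hfT (by simpa using hp)
    obtain ⟨ε, hε, H⟩ := Metric.eventually_nhds_iff_ball.1 (hh.eventually_analyticAt.and hhf)
    exact ⟨h, ε, hε, fun w hw => (H w hw).1, fun w hw => (H w hw).2⟩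
  choose h ε hε hh hhf using hloc
  -- by compactness, balls of one radius `δ` serve all points of the circle
  obtain ⟨δ, hδ, hδc⟩ := lebesgue_number_lemma_of_metric (isCompact_sphere (0 : ℂ) 1)
    (c := fun p : Metric.sphere (0 : ℂ) 1 => Metric.ball (p : ℂ) (ε p))
    (fun p => Metric.isOpen_ball)
    (fun p hp => Set.mem_iUnion.2 ⟨⟨p, hp⟩, Metric.mem_ball_self (hε _)⟩)
  have hloc' : ∀ q : ℂ, ∃ H : ℂ → ℂ, ‖q‖ = 1 → AnalyticOnNhd ℂ H (Metric.ball q δ) ∧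
      ∀ w ∈ Metric.ball q δ, ∀ t, w = circ t → H w = f t := by
    intro q
    by_cases hq : ‖q‖ = 1
    · obtain ⟨p, hp⟩ := hδc q (by simpa using hq)
      exact ⟨h p, fun _ => ⟨(hh p).mono hp, fun w hw => hhf p w (hp hw)⟩⟩
    · exact ⟨0, fun h => absurd h hq⟩
  choose H hH using hloc'
  have hcompat : ∀ p q : ℂ, ‖p‖ = 1 → ‖q‖ = 1 → p ∈ Metric.ball q δ →
      Set.EqOn (H q) (H p) (Metric.ball q δ ∩ Metric.ball p δ) := by
    intro p q hp hq hpq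
    have hpm : p ∈ Metric.ball q δ ∩ Metric.ball p δ := ⟨hpq, Metric.mem_ball_self hδ⟩
    refine ((hH q hq).1.mono Set.inter_subset_left).eqOn_of_preconnected_of_frequently_eq
      ((hH p hp).1.mono Set.inter_subset_right)
      ((convex_ball q δ).inter (convex_ball p δ)).isPreconnected hpm ?_
    have hnhds : ∀ᶠ w in 𝓝[≠] p, w ∈ Metric.ball q δ ∩ Metric.ball p δ :=
      mem_nhdsWithin_of_mem_nhds ((Metric.isOpen_ball.inter Metric.isOpen_ball).mem_nhds hpm)
    refine ((frequently_circ hp).and_eventually hnhds).mono ?_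
    rintro w ⟨⟨t, rfl⟩, hw⟩
    rw [(hH q hq).2 _ hw.1 t rfl, (hH p hp).2 _ hw.2 t rfl]
  -- at `z`, use the local extension around the nearest point of the circle
  refine ⟨fun z => H (z / ‖z‖) z, fun t => ?_,
    eventually_of_annulus (fun s t hst ht => ht.mono hst) hδ fun z₀ hz₀ => ?_⟩
  · have h1 : circ t / (‖circ t‖ : ℂ) = circ t := by rw [norm_circ]; simp
    beta_reduce
    rw [h1]
    exact (hH _ (norm_circ t)).2 _ (Metric.mem_ball_self hδ) t rfl
  · have hne : ∀ z ∈ annulus (1 + δ / 2), z ≠ 0 := fun z =>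
      ne_zero_of_mem_annulus (by linarith)
    have hcont : ContinuousAt (fun z : ℂ => z / ‖z‖) z₀ :=
      continuousAt_id.div (Complex.continuous_ofReal.comp continuous_norm).continuousAt
        (by simpa using hne z₀ hz₀)
    refine ((hH _ (norm_div_norm (hne z₀ hz₀))).1 z₀ (mem_ball_div_norm hδ hz₀)).congr ?_
    filter_upwards [(isOpen_annulus _).mem_nhds hz₀,
      Metric.isOpen_ball.mem_nhds (mem_ball_div_norm hδ hz₀),
      hcont.eventually (Metric.ball_mem_nhds _ hδ)] with z hz hz1 hz2
    exact hcompat _ _ (norm_div_norm (hne z hz)) (norm_div_norm (hne z₀ hz₀)) hz2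
      ⟨hz1, mem_ball_div_norm hδ hz⟩

lemma AnM.exists_extension {m n : ℕ} {M : ℝ → Matrix (Fin m) (Fin n) ℂ} (hM : AnM M)
    (hMT : ∀ t, M (t + 2 * Real.pi) = M t) :
    ∃ G : ℂ → Matrix (Fin m) (Fin n) ℂ, (∀ t, G (circ t) = M t) ∧
      ∀ᶠ r in 𝓝[>] (1 : ℝ), AnalyticEntries ℂ G (annulus r) := by
  choose g hg hga using fun i j => AnalyticSVD.exists_extension (hM i j) fun t => by rw [hMT]
  refine ⟨fun z => Matrix.of fun i j => g i j z, fun t => ?_, ?_⟩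
  · ext i j
    exact hg i j t
  · exact eventually_all.2 fun i => eventually_all.2 fun j => hga i j

/-! ### Para-Hermitian conjugation -/

section ParaH

variable {m n : ℕ} {M : ℂ → Matrix (Fin m) (Fin n) ℂ} {r : ℝ}

lemma paraH_circ (M : ℂ → Matrix (Fin m) (Fin n) ℂ) (t : ℝ) : paraH M (circ t) = (M (circ t))ᴴ := by
  have h : 1 / conj (circ t) = circ t := by
    rw [one_div, ← Complex.inv_eq_conj (norm_circ t), inv_inv]
  rw [paraH, h]

lemma AnalyticEntries.paraH (hr : 1 < r) (hM : AnalyticEntries ℂ M (annulus r)) :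
    AnalyticEntries ℂ (paraH M) (annulus r) := by
  intro i j
  refine DifferentiableOn.analyticOnNhd (fun z hz => ?_) (isOpen_annulus r)
  have hz0 := ne_zero_of_mem_annulus hr hz
  have hmem : conj z⁻¹ ∈ annulus r := by
    rw [annulus, Set.mem_ofPred_eq, RCLike.norm_conj, norm_inv]
    exact ⟨inv_strictAnti₀ (norm_pos_iff.2 hz0) hz.2, inv_lt_of_inv_lt₀ (by linarith) hz.1⟩
  have h1 : DifferentiableAt ℂ (fun w => conj (M (conj w) j i)) z⁻¹ := by
    have h0 := ((hM j i _ hmem).differentiableAt).conj_conj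
    rwa [Complex.conj_conj] at h0
  have h2 : (fun z => AnalyticSVD.paraH M z i j) = fun z => conj (M (conj z⁻¹) j i) := by
    ext z
    rw [AnalyticSVD.paraH, conjTranspose_apply, one_div, map_inv₀]
    rfl
  rw [h2]
  exact (h1.comp z (differentiableAt_inv hz0)).differentiableWithinAt

lemma AnalyticEntries.mul {k : ℕ} {N : ℂ → Matrix (Fin n) (Fin k) ℂ} {s : Set ℂ}
    (hM : AnalyticEntries ℂ M s) (hN : AnalyticEntries ℂ N s) :
    AnalyticEntries ℂ (fun z => M z * N z) s := fun i j => by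
  simp only [Matrix.mul_apply]
  exact Finset.analyticOnNhd_fun_sum _ fun l _ => (hM i l).mul (hN l j)

lemma AnalyticEntries.eqOn_annulus {N : ℂ → Matrix (Fin m) (Fin n) ℂ} (hr : 1 < r)
    (hM : AnalyticEntries ℂ M (annulus r)) (hN : AnalyticEntries ℂ N (annulus r))
    (h : ∀ t, M (circ t) = N (circ t)) : Set.EqOn M N (annulus r) := fun z hz => by
  ext i j
  exact AnalyticSVD.eqOn_annulus hr (hM i j) (hN i j) (fun t => by rw [h]) hz

lemma AnalyticEntries.paraUnitaryOn {U : ℂ → Matrix (Fin n) (Fin n) ℂ} (hr : 1 < r)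
    (hU : AnalyticEntries ℂ U (annulus r)) (h : ∀ t, U (circ t) ∈ Matrix.unitaryGroup (Fin n) ℂ) :
    ParaUnitaryOn U (annulus r) := by
  refine (hU.mul (hU.paraH hr)).eqOn_annulus hr (fun i j => analyticOnNhd_const) fun t => ?_
  rw [paraH_circ]
  exact Matrix.mem_unitaryGroup_iff.1 (h t)

end ParaH

/-! ### Pseudo-circulant blocks -/

section BaseChange

variable {k : ℕ}

lemma baseChange_apply (t : ℝ) (a l : Fin k) :
    baseChange k t a l =
      Complex.exp (Complex.I * (a : ℕ) / k * ((t + 2 * Real.pi * (l : ℕ) : ℝ) : ℂ)) /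
        (Real.sqrt k : ℂ) := by
  rw [baseChange, diagonal_mul, fourierMatrix, mul_div_assoc', ← Complex.exp_add]
  congr 2
  push_cast
  ring

lemma exp_mul_shift {k : ℕ} (hk : 0 < k) (a : ℕ) (t : ℝ) :
    Complex.exp (Complex.I * a / k * ((t + 2 * Real.pi * k : ℝ) : ℂ)) =
      Complex.exp (Complex.I * a / k * t) := by
  have hk' : (k : ℂ) ≠ 0 := by exact_mod_cast hk.ne'
  have : Complex.I * a / k * ((t + 2 * Real.pi * k : ℝ) : ℂ) =
      Complex.I * a / k * t + a * (2 * Real.pi * Complex.I) := by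
    push_cast
    field_simp
  rw [this, Complex.exp_add, Complex.exp_nat_mul_two_pi_mul_I, mul_one]

/-- The entries in each row of `W_k` are multiplexed. -/
lemma multiplexed_baseChange (a : Fin k) : Multiplexed 1 fun l t => baseChange k t a l := by
  simp only [baseChange_apply]
  exact multiplexed_of_shift (κ := 1)
    (g := fun t : ℝ => Complex.exp (Complex.I * (a : ℕ) / k * t) / (Real.sqrt k : ℂ)) fun t => by
      rw [exp_mul_shift a.pos]
      simp

lemma conj_baseChange (t : ℝ) (b l : Fin k) :
    conj (baseChange k t b l) =
      Complex.exp (-(Complex.I * (b : ℕ) / k * ((t + 2 * Real.pi * (l : ℕ) : ℝ) : ℂ))) /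
        (Real.sqrt k : ℂ) := by
  rw [baseChange_apply, map_div₀, ← Complex.exp_conj, Complex.conj_ofReal, map_mul, map_div₀,
    map_mul, Complex.conj_I, Complex.conj_ofReal, map_natCast, map_natCast]
  congr 2
  ring

lemma baseChange_mul_conj (t : ℝ) (a b l : Fin k) :
    baseChange k t a l * conj (baseChange k t b l) =
      Complex.exp (Complex.I * ((a : ℕ) - (b : ℕ)) / k * ((t + 2 * Real.pi * (l : ℕ) : ℝ) : ℂ)) /
        k := by
  rw [conj_baseChange, baseChange_apply, div_mul_div_comm, ← Complex.exp_add, ← Complex.ofReal_mul,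
    Real.mul_self_sqrt (Nat.cast_nonneg k), Complex.ofReal_natCast]
  congr 2
  ring

lemma baseChange_mul_conjTranspose (t : ℝ) : baseChange k t * (baseChange k t)ᴴ = 1 := by
  ext a b
  have hk : (k : ℂ) ≠ 0 := by exact_mod_cast a.pos.ne'
  rw [Matrix.mul_apply]
  simp only [conjTranspose_apply, RCLike.star_def, baseChange_mul_conj]
  rcases eq_or_ne a b with rfl | hab
  · simp [hk]
  · rw [Matrix.one_apply_ne hab]
    -- a geometric sum over a nontrivial root of unity
    set ζ : ℂ := Complex.exp (2 * Real.pi * Complex.I * (((a : ℕ) : ℂ) - (b : ℕ)) / k) with hζ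
    have hterm : ∀ l : Fin k, Complex.exp (Complex.I * ((a : ℕ) - (b : ℕ)) / k *
        ((t + 2 * Real.pi * (l : ℕ) : ℝ) : ℂ)) / k =
        Complex.exp (Complex.I * ((a : ℕ) - (b : ℕ)) / k * t) / k * ζ ^ (l : ℕ) := by
      intro l
      rw [hζ, ← Complex.exp_nat_mul, div_mul_eq_mul_div (Complex.exp _), ← Complex.exp_add]
      congr 2
      push_cast
      ring
    simp only [hterm]
    rw [← Finset.mul_sum, Fin.sum_univ_eq_sum_range (fun l => ζ ^ l)]
    have hζk : ζ ^ k = 1 := by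
      rw [hζ, ← Complex.exp_nat_mul, Complex.exp_eq_one_iff]
      refine ⟨(a : ℕ) - (b : ℕ), ?_⟩
      push_cast
      field_simp
    have hζ1 : ζ - 1 ≠ 0 := by
      rw [sub_ne_zero, hζ, Ne, Complex.exp_eq_one_iff]
      rintro ⟨n, hn⟩
      have h1 : (((a : ℕ) : ℂ) - (b : ℕ)) = n * k := by
        have h2 : (2 * Real.pi * Complex.I : ℂ) ≠ 0 := Complex.two_pi_I_ne_zero
        field_simp at hn
        linear_combination hn
      have h3 : ((a : ℕ) : ℤ) - (b : ℕ) = n * k := by exact_mod_cast h1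
      have ha := a.2
      have hb := b.2
      have h4 : n = 0 := by
        by_contra hn0
        rcases lt_or_gt_of_ne hn0 with h | h
        · nlinarith
        · nlinarith
      rw [h4, zero_mul] at h3
      exact hab (Fin.ext (by omega))
    have h5 := mul_geom_sum ζ k
    rw [hζk, sub_self] at h5
    rw [(mul_eq_zero.1 h5).resolve_left hζ1, mul_zero]

lemma conjTranspose_mul_baseChange (t : ℝ) : (baseChange k t)ᴴ * baseChange k t = 1 :=
  mul_eq_one_comm.1 (baseChange_mul_conjTranspose t)

lemma anM_baseChange (k : ℕ) : AnM (baseChange k) := fun a l => by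
  simp only [baseChange_apply]
  exact (analyticOnNhd_shift (analyticOnNhd_cexp (Complex.I * (a : ℕ) / k)) _).div
    analyticOnNhd_const fun t _ => by
      simp [a.pos.ne']

/-- The entries of `W_k diag(s) W_kᴴ` are, up to a power of `z`, functions of period `2π` depending
only on the difference of the indices, hence they extend to an annulus. -/
theorem exists_pseudoCirculant {s : Fin k → ℝ → ℂ} (hs : ∀ i, AnalyticOnNhd ℝ (s i) Set.univ)
    (hm : Multiplexed 1 s) :
    ∃ K : ℂ → Matrix (Fin k) (Fin k) ℂ,
      (∀ t, K (circ t) = baseChange k t * diagonal (fun i => s i t) * (baseChange k t)ᴴ) ∧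
      (∀ᶠ r in 𝓝[>] (1 : ℝ), AnalyticEntries ℂ K (annulus r)) ∧
      ∀ᶠ r in 𝓝[>] (1 : ℝ), PseudoCirculantOn K (annulus r) := by
  set f : Fin k → ℝ → ℂ := fun d t => ∑ l : Fin k,
    Complex.exp (Complex.I * (d : ℕ) / k * ((t + 2 * Real.pi * (l : ℕ) : ℝ) : ℂ)) / k * s l t with hf
  have hfa : ∀ d, AnalyticOnNhd ℝ (f d) Set.univ := fun d =>
    Finset.analyticOnNhd_fun_sum _ fun l _ =>
      ((analyticOnNhd_shift (analyticOnNhd_cexp (Complex.I * (d : ℕ) / k)) _).div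
        analyticOnNhd_const fun t _ => by exact_mod_cast d.pos.ne').mul (hs l)
  have hfT : ∀ d t, f d (t + 2 * Real.pi) = f d t := fun d =>
    Multiplexed.sum_periodic (Multiplexed.mul (multiplexed_of_shift (κ := 1)
      (g := fun t : ℝ => Complex.exp (Complex.I * (d : ℕ) / k * t) / k) fun t => by
        rw [exp_mul_shift d.pos]
        simp) hm)
  choose φ hφ hφa using fun d => exists_extension (hfa d) (hfT d)
  set K : ℂ → Matrix (Fin k) (Fin k) ℂ := fun z => Matrix.of fun i j =>
    if j ≤ i then φ (i - j) z else z⁻¹ * φ (i - j) z with hK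
  have hKc : ∀ t, K (circ t) =
      baseChange k t * diagonal (fun i => s i t) * (baseChange k t)ᴴ := by
    intro t
    ext i j
    have hk : (k : ℂ) ≠ 0 := by exact_mod_cast i.pos.ne'
    have hR : (baseChange k t * diagonal (fun i => s i t) * (baseChange k t)ᴴ) i j =
        ∑ l : Fin k, Complex.exp (Complex.I * ((i : ℕ) - (j : ℕ)) / k *
          ((t + 2 * Real.pi * (l : ℕ) : ℝ) : ℂ)) / k * s l t := by
      rw [Matrix.mul_apply]
      refine Finset.sum_congr rfl fun l _ => ?_
      rw [mul_diagonal, conjTranspose_apply, RCLike.star_def, ← baseChange_mul_conj]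
      ring
    rw [hR]
    change (if j ≤ i then φ (i - j) (circ t) else (circ t)⁻¹ * φ (i - j) (circ t)) = _
    rw [hφ]
    split_ifs with hij
    · refine Finset.sum_congr rfl fun l _ => ?_
      rw [Fin.coe_sub_iff_le.2 hij, Nat.cast_sub hij]
    · rw [Finset.mul_sum]
      refine Finset.sum_congr rfl fun l _ => ?_
      have hji : (i : ℕ) < j := lt_of_not_ge hij
      have hl : circ t = circ (t + 2 * Real.pi * (l : ℕ)) :=
        (OrbitSystem.periodic_nat_mul circ_add_two_pi _ _).symm
      rw [Fin.coe_sub_iff_lt.2 hji, Nat.cast_sub (by omega), hl, circ, ← Complex.exp_neg,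
        ← mul_assoc, mul_div_assoc', ← Complex.exp_add]
      congr 3
      push_cast
      field_simp
      ring
  refine ⟨K, hKc, ?_, ?_⟩
  · filter_upwards [eventually_all.2 hφa, self_mem_nhdsWithin] with r hr hr1 i j
    simp only [hK, Matrix.of_apply]
    split_ifs
    · exact hr _
    · exact (analyticOnNhd_id.inv fun z hz => ne_zero_of_mem_annulus hr1 hz).mul (hr _)
  · filter_upwards [eventually_all.2 hφa] with r hr
    refine ⟨⟨φ, hr, fun z _ i j => rfl⟩, fun z hz => ?_⟩
    obtain ⟨t, rfl⟩ : ∃ t, circ t = z := ⟨_, circ_arg hz⟩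
    have hW := conjTranspose_mul_baseChange (k := k) t
    have hmul : ∀ D E : Matrix (Fin k) (Fin k) ℂ,
        baseChange k t * D * (baseChange k t)ᴴ * (baseChange k t * E * (baseChange k t)ᴴ) =
          baseChange k t * (D * E) * (baseChange k t)ᴴ := fun D E => by
      calc _ = baseChange k t * D * ((baseChange k t)ᴴ * baseChange k t) * E *
            (baseChange k t)ᴴ := by simp only [Matrix.mul_assoc]
        _ = _ := by rw [hW, Matrix.mul_one]; simp only [Matrix.mul_assoc]
    have hH : (K (circ t))ᴴ =
        baseChange k t * diagonal (fun i => star (s i t)) * (baseChange k t)ᴴ := by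
      rw [hKc, conjTranspose_mul, conjTranspose_mul, conjTranspose_conjTranspose,
        diagonal_conjTranspose, Matrix.mul_assoc]
      rfl
    rw [hH, hKc, hmul, hmul, diagonal_mul_diagonal, diagonal_mul_diagonal]
    simp only [mul_comm]

end BaseChange

/-! ### From an arrangement of the singular values to the factorization -/

open OrbitSystem

variable {m n : ℕ} {A : ℂ → Matrix (Fin m) (Fin n) ℂ} {S : OrbitSystem}

lemma OrbitSystem.IsSingularSystem.isOrbitFamily (hS : S.IsSingularSystem A) : S.IsOrbitFamily :=
  ⟨hS.1, hS.2, hS.3, hS.4, hS.5, hS.6⟩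

/-- A diagonalisation `M = v diag(l) vᴴ` with orthonormal columns `v`, the column `j` belonging to the
nonzero eigenvalue function with label `c j`, determines the spectral projections: that of label `x`
projects onto the span of the columns `j` with `c j = x`, and that of the zero eigenvalue onto the
orthogonal complement of all columns. -/
lemma spectralSystem_of_columns {n J X : Type} [Fintype n] [DecidableEq n] [Fintype J]
    [DecidableEq J] [Fintype X] [DecidableEq X] {M : ℝ → Matrix n n ℂ} {l : Option X → ℝ → ℝ}
    (hl : ∀ o, AnalyticOnNhd ℝ (l o) Set.univ) (hinj : Function.Injective l)
    (hl0 : l none = fun _ => 0) {v : ℝ → Matrix n J ℂ} (hv : AnM v) (hvv : ∀ t, (v t)ᴴ * v t = 1)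
    (c : J → X) (hM : ∀ t, M t = v t * diagonal (fun j => (l (some (c j)) t : ℂ)) * (v t)ᴴ) :
    SpectralSystem M l (fun o t => o.elim (1 - v t * (v t)ᴴ)
      fun x => v t * diagonal (fun j => if c j = x then (1 : ℂ) else 0) * (v t)ᴴ) := by
  have hmul : ∀ t (D E : Matrix J J ℂ),
      v t * D * (v t)ᴴ * (v t * E * (v t)ᴴ) = v t * (D * E) * (v t)ᴴ := fun t D E => by
    calc _ = v t * D * ((v t)ᴴ * v t) * E * (v t)ᴴ := by simp only [Matrix.mul_assoc]
      _ = _ := by rw [hvv, Matrix.mul_one]; simp only [Matrix.mul_assoc]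
  have hconj : ∀ t (d : J → ℝ), (v t * diagonal (fun j => (d j : ℂ)) * (v t)ᴴ)ᴴ =
      v t * diagonal (fun j => (d j : ℂ)) * (v t)ᴴ := fun t d => by
    rw [conjTranspose_mul, conjTranspose_mul, conjTranspose_conjTranspose, diagonal_conjTranspose,
      Matrix.mul_assoc]
    congr 3
    ext j
    simp
  have hvP : ∀ t, v t * (v t)ᴴ = v t * (1 : Matrix J J ℂ) * (v t)ᴴ := fun t => by rw [Matrix.mul_one]
  have hind : ∀ x, (fun j => if c j = x then (1 : ℂ) else 0) =
      fun j => (((if c j = x then 1 else 0 : ℝ)) : ℂ) := fun x => by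
    ext j
    split_ifs <;> simp
  refine ⟨fun t => by rw [hM, hconj], hl, hinj, ?_, ?_, ?_, fun t => ?_, ?_⟩
  · rintro (_ | x)
    · exact (AnM.const 1).sub (hv.mul hv.conjTranspose)
    · exact (hv.mul (AnM.const _)).mul hv.conjTranspose
  · rintro (_ | x) t
    · simp
    · simp only [Option.elim, hind, hconj]
  · rintro (_ | x) t
    · have h1 := hmul t 1 1
      rw [Matrix.mul_one (1 : Matrix J J ℂ), ← hvP] at h1
      simp [Matrix.mul_sub, Matrix.sub_mul, h1]
    · simp only [Option.elim, hmul, diagonal_mul_diagonal]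
      congr 3
      ext j
      by_cases h : c j = x <;> simp [h]
  · rw [Fintype.sum_option]
    simp only [Option.elim]
    have h1 : ∑ x, v t * diagonal (fun j => if c j = x then (1 : ℂ) else 0) * (v t)ᴴ =
        v t * (v t)ᴴ := by
      rw [← Matrix.sum_mul, ← Matrix.mul_sum, hvP]
      congr 2
      ext i j
      rw [Matrix.sum_apply]
      by_cases hij : i = j
      · subst hij; simp
      · simp [hij]
    rw [h1, sub_add_cancel]
  · rintro (_ | x) t
    · have h1 := hmul t (diagonal fun j => (l (some (c j)) t : ℂ)) 1
      rw [Matrix.mul_one (diagonal _), ← hvP] at h1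
      simp only [Option.elim, hl0, Matrix.mul_sub, Matrix.mul_one, hM, h1, sub_self,
        Complex.ofReal_zero, zero_smul]
    · simp only [Option.elim]
      rw [hM, hmul, diagonal_mul_diagonal, ← Matrix.smul_mul, ← Matrix.mul_smul, ← diagonal_smul]
      congr 3
      ext j
      by_cases h : c j = x <;> simp [h]

/-- The number of columns in the frame of the first spectral projection of an orbit is the
multiplicity of the orbit in the given arrangement. -/
theorem OrbitSystem.IsSingularSystem.exists_multiplexedSVD (hS : S.IsSingularSystem A)
    (ha : AnM fun t => A (circ t)) :
    ∃ (U : ℝ → Matrix (Fin m) S.Idx ℂ) (V : ℝ → Matrix (Fin n) S.Idx ℂ),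
      MultiplexedSVD S (fun t => A (circ t)) U V := by
  have hF := hS.isOrbitFamily
  obtain ⟨U₀, V₀, hU₀, hV₀, hU₀u, hV₀u, hA⟩ := hS.svd
  have haT : ∀ t, A (circ (t + 2 * Real.pi)) = A (circ t) := fun t => by rw [circ_add_two_pi]
  have horth : ∀ {k : ℕ} (W : Matrix (Fin k) (Fin k) ℂ) (_ : W ∈ Matrix.unitaryGroup (Fin k) ℂ)
      (e : S.Idx → Fin k), Function.Injective e →
      (W.submatrix id e)ᴴ * W.submatrix id e = 1 := fun W hW e he => by
    rw [conjTranspose_submatrix, ← submatrix_mul _ _ _ _ _ Function.bijective_id,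
      ← Matrix.star_eq_conjTranspose, Matrix.mem_unitaryGroup_iff'.1 hW, submatrix_one _ he]
  set v : ℝ → Matrix (Fin n) S.Idx ℂ := fun t => (V₀ t).submatrix id (place hS.fits_cols) with hv
  have hva : AnM v := fun i j => hV₀ i _
  have hvv : ∀ t, (v t)ᴴ * v t = 1 := fun t => horth _ (hV₀u t) _ (place_injective hS.fits_cols)
  set c : S.Idx → Σ ν : Fin S.R, Fin (S.k ν) := fun y => ⟨S.orb y.1, y.2⟩ with hc
  have hP := spectralSystem_of_columns (M := fun t => (A (circ t))ᴴ * A (circ t)) hF.analytic_eig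
    hF.eig_injective rfl hva hvv c (fun t => by
      have h1 := horth _ (hU₀u t) _ (place_injective hS.fits_rows)
      rw [hA, mul_blockDiag_mul hS.fits_rows hS.fits_cols, blockDiagonal'_diagonal,
        conjTranspose_mul, conjTranspose_mul, conjTranspose_conjTranspose]
      set u := (U₀ t).submatrix id (place hS.fits_rows)
      set D : Matrix S.Idx S.Idx ℂ := diagonal fun y => ((S.σ (S.orb y.1) y.2 t : ℝ) : ℂ) with hD
      calc _ = v t * (Dᴴ * (uᴴ * u) * D) * (v t)ᴴ := by simp only [Matrix.mul_assoc]; rfl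
        _ = _ := by
          rw [h1, Matrix.mul_one, hD, diagonal_conjTranspose, diagonal_mul_diagonal]
          congr 3
          ext y
          simp only [Pi.star_apply, RCLike.star_def, Complex.conj_ofReal, eig, sq,
            Complex.ofReal_mul]
          rfl)
  have hMT : ∀ t, (A (circ (t + 2 * Real.pi)))ᴴ * A (circ (t + 2 * Real.pi)) =
      (A (circ t))ᴴ * A (circ t) := fun t => by rw [haT]
  choose ι hι hι' Q hQ hQT hQQ hQP using fun ν => exists_frame (2 * Real.pi * S.k ν)
    (hP.analytic_proj (some ⟨ν, ⟨0, hF.size_pos ν⟩⟩)) (hP.proj_conjTranspose _) (hP.proj_mul_self _)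
    (hF.proj_period hMT hP ν)
  have hcard : ∀ ν, Fintype.card {b // S.orb b = ν} = Fintype.card (ι ν) := by
    intro ν
    have h1 := congrArg Matrix.trace (hQP ν 0)
    rw [Matrix.trace_mul_comm, hQQ, Matrix.trace_one, Option.elim, Matrix.mul_assoc,
      Matrix.trace_mul_comm, Matrix.mul_assoc, hvv, Matrix.mul_one, Matrix.trace_diagonal,
      Fintype.sum_sigma] at h1
    have h2 : ∀ b, (∑ i : Fin (S.size b), if c ⟨b, i⟩ = ⟨ν, ⟨0, hF.size_pos ν⟩⟩ then (1 : ℂ) else 0)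
        = if S.orb b = ν then 1 else 0 := by
      intro b
      split_ifs with hb
      · subst hb
        rw [Finset.sum_eq_single (⟨0, hF.size_pos _⟩ : Fin (S.size b))]
        · exact if_pos rfl
        · intro i _ hi
          rw [if_neg]
          intro h
          exact hi (eq_of_heq (Sigma.mk.inj h).2)
        · simp
      · refine Finset.sum_eq_zero fun i _ => if_neg fun h => hb (congrArg Sigma.fst h)
    simp only [h2, Finset.sum_boole] at h1
    rw [Fintype.card_subtype]
    exact_mod_cast h1.symm
  let E : ∀ ν : Fin S.R, {b // S.orb b = ν} ≃ ι ν := fun ν => Fintype.equivOfCardEq (hcard ν)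
  exact hF.exists_multiplexedSVD ha haT hP
    (Q := fun ν t => (Q ν t).submatrix id (E ν)) (fun ν i j => hQ ν i _)
    (fun ν t => congrArg (fun X => X.submatrix id (E ν)) (hQT ν t))
    (fun ν t => by
      rw [conjTranspose_submatrix, ← submatrix_mul _ _ _ _ _ Function.bijective_id, hQQ,
        submatrix_one_equiv])
    (fun ν t => by
      rw [conjTranspose_submatrix, submatrix_mul_equiv, hQP, submatrix_id_id])

/-- The columns of `U Wᴴ` are sums of a multiplexed family over a full orbit. -/
lemma periodic_mul_baseChange {α : Type*} {U : ℝ → Matrix α S.Idx ℂ}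
    (hU : ∀ b p, Multiplexed 1 fun (i : Fin (S.size b)) t => U t p ⟨b, i⟩) (t : ℝ) :
    U (t + 2 * Real.pi) * (blockDiagonal' fun b => baseChange (S.size b) (t + 2 * Real.pi))ᴴ =
      U t * (blockDiagonal' fun b => baseChange (S.size b) t)ᴴ := by
  have key : ∀ t p b a, (U t * (blockDiagonal' fun b => baseChange (S.size b) t)ᴴ) p ⟨b, a⟩ =
      ∑ i : Fin (S.size b), U t p ⟨b, i⟩ * conj (baseChange (S.size b) t a i) := by
    intro t p b a
    rw [Matrix.mul_apply, Fintype.sum_sigma, Finset.sum_eq_single b]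
    · refine Finset.sum_congr rfl fun i _ => ?_
      rw [conjTranspose_apply, blockDiagonal'_apply_eq]
      rfl
    · intro b' _ hb'
      refine Finset.sum_eq_zero fun i _ => ?_
      rw [conjTranspose_apply, blockDiagonal'_apply_ne _ _ _ hb'.symm, star_zero, mul_zero]
    · simp
  ext p ⟨b, a⟩
  rw [key, key]
  have h1 : Multiplexed 1 fun (i : Fin (S.size b)) t => conj (baseChange (S.size b) t a i) := by
    have h := multiplexed_baseChange a
    rw [multiplexed_one_iff] at h ⊢
    intro i j hij t
    rw [h i j hij]
  exact ((hU b p).mul h1).sum_periodic t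

lemma blockDiagonal'_baseChange_mul (S : OrbitSystem) (t : ℝ) :
    (blockDiagonal' fun b => baseChange (S.size b) t) *
      (blockDiagonal' fun b => baseChange (S.size b) t)ᴴ = 1 := by
  rw [blockDiagonal'_conjTranspose, ← blockDiagonal'_mul]
  simp only [baseChange_mul_conjTranspose]
  exact blockDiagonal'_one

lemma blockDiagonal'_conjTranspose_mul_baseChange (S : OrbitSystem) (t : ℝ) :
    (blockDiagonal' fun b => baseChange (S.size b) t)ᴴ *
      (blockDiagonal' fun b => baseChange (S.size b) t) = 1 :=
  mul_eq_one_comm.1 (blockDiagonal'_baseChange_mul S t)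

lemma anM_blockDiagonal'_baseChange (S : OrbitSystem) :
    AnM fun t => blockDiagonal' fun b => baseChange (S.size b) t := by
  rintro ⟨b, i⟩ ⟨b', j⟩
  by_cases h : b = b'
  · subst h
    simp only [blockDiagonal'_apply_eq]
    exact anM_baseChange _ i j
  · simp only [blockDiagonal'_apply_ne _ _ _ h]
    exact analyticOnNhd_const

/-- The base change turns the multiplexed singular vectors into vectors of period `2π`, which are
completed to unitary matrices of the same period. -/
lemma exists_periodic_completion {k : ℕ} {U : ℝ → Matrix (Fin k) S.Idx ℂ} (hU : AnM U)
    (hUU : ∀ t, (U t)ᴴ * U t = 1)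
    (hUm : ∀ b p, Multiplexed 1 fun (i : Fin (S.size b)) t => U t p ⟨b, i⟩)
    (hk : ∑ b, S.size b ≤ k) :
    ∃ W : ℝ → Matrix (Fin k) (Fin k) ℂ, AnM W ∧ (∀ t, W (t + 2 * Real.pi) = W t) ∧
      (∀ t, W t ∈ Matrix.unitaryGroup (Fin k) ℂ) ∧ ∀ t, (W t).submatrix id (place hk) =
        U t * (blockDiagonal' fun b => baseChange (S.size b) t)ᴴ :=
  exists_unitary_completion (2 * Real.pi)
    (hU.mul (anM_blockDiagonal'_baseChange S).conjTranspose) (periodic_mul_baseChange hUm)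
    (fun t => by
      rw [conjTranspose_mul, conjTranspose_conjTranspose, Matrix.mul_assoc,
        ← Matrix.mul_assoc _ (U t), hUU, Matrix.one_mul, blockDiagonal'_baseChange_mul])
    (place_injective hk)

/-- On the circle, `U diag(s) Vᴴ = (U Wᴴ) (W diag(s) Wᴴ) (V Wᴴ)ᴴ` with `W` the block diagonal matrix
of the base changes, and all three factors on the right have period `2π`. -/
theorem OrbitSystem.IsSingularSystem.exists_factorization
    (hA : AnalyticEntries ℂ A (Metric.sphere 0 1)) (hS : S.IsSingularSystem A) :
    ∃ (r : ℝ) (U : ℂ → Matrix (Fin m) (Fin m) ℂ) (C : ℂ → Matrix (Fin m) (Fin n) ℂ)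
      (V : ℂ → Matrix (Fin n) (Fin n) ℂ)
      (K : ∀ ν : Fin S.R, ℂ → Matrix (Fin (S.k ν)) (Fin (S.k ν)) ℂ),
      1 < r ∧ AnalyticEntries ℂ U (annulus r) ∧ AnalyticEntries ℂ C (annulus r) ∧
      AnalyticEntries ℂ V (annulus r) ∧ ParaUnitaryOn U (annulus r) ∧
      ParaUnitaryOn V (annulus r) ∧ (∀ z ∈ annulus r, A z = U z * C z * paraH V z) ∧
      (∀ z ∈ annulus r, C z = blockDiag m n S.size (fun b => K (S.orb b) z)) ∧
      (∀ ν, PseudoCirculantOn (K ν) (annulus r)) ∧ ∀ ν, BlockOfOrbit (K ν) (S.σ ν) := by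
  have hF := hS.isOrbitFamily
  obtain ⟨u, v, h⟩ := hS.exists_multiplexedSVD hA.anM_comp_circ
  obtain ⟨u', hu', hu'T, hu'u, hu'e⟩ := exists_periodic_completion h.analytic_left
    h.left_orthonormal h.left_multiplexed hS.fits_rows
  obtain ⟨v', hv', hv'T, hv'u, hv'e⟩ := exists_periodic_completion h.analytic_right
    h.right_orthonormal h.right_multiplexed hS.fits_cols
  choose K hKc hKa hKp using fun ν =>
    exists_pseudoCirculant (hF.analytic_phased ν) (hF.multiplexed_phased ν)
  obtain ⟨U, hUc, hUa⟩ := hu'.exists_extension hu'T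
  obtain ⟨V, hVc, hVa⟩ := hv'.exists_extension hv'T
  have hAa : ∀ᶠ r in 𝓝[>] (1 : ℝ), AnalyticEntries ℂ A (annulus r) :=
    eventually_all.2 fun i => eventually_all.2 fun j => eventually_analyticOnNhd_annulus (hA i j)
  have hgt : ∀ᶠ r in 𝓝[>] (1 : ℝ), 1 < r := self_mem_nhdsWithin
  obtain ⟨r, hr, hUr, hVr, hAr, hKr, hKpr⟩ := (hgt.and (hUa.and (hVa.and
    (hAa.and ((eventually_all.2 hKa).and (eventually_all.2 hKp)))))).exists
  let C : ℂ → Matrix (Fin m) (Fin n) ℂ := fun z => blockDiag m n S.size fun b => K (S.orb b) z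
  have hCr : AnalyticEntries ℂ C (annulus r) := fun p q => by
    refine Finset.analyticOnNhd_fun_sum _ fun b _ => Finset.analyticOnNhd_fun_sum _ fun i _ =>
      Finset.analyticOnNhd_fun_sum _ fun j _ => ?_
    split_ifs
    · exact hKr (S.orb b) i j
    · exact analyticOnNhd_const
  refine ⟨r, U, C, V, K, hr, hUr, hCr, hVr, hUr.paraUnitaryOn hr fun t => hUc t ▸ hu'u t,
    hVr.paraUnitaryOn hr fun t => hVc t ▸ hv'u t, ?_, fun z _ => rfl, hKpr, fun ν =>
    ⟨S.phased ν, hF.analytic_phased ν, hF.multiplexed_phased ν, norm_phased ν, hKc ν⟩⟩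
  refine hAr.eqOn_annulus hr ((hUr.mul hCr).mul (hVr.paraH hr)) fun t => ?_
  let D : ∀ b, Matrix (Fin (S.size b)) (Fin (S.size b)) ℂ := fun b => K (S.orb b) (circ t)
  have hCc : C (circ t) = blockDiag m n S.size D := rfl
  rw [paraH_circ, hUc, hVc, hCc, mul_blockDiag_mul hS.fits_rows hS.fits_cols, hu'e, hv'e]
  set W := blockDiagonal' fun b => baseChange (S.size b) t with hW
  have hWW : Wᴴ * W = 1 := blockDiagonal'_conjTranspose_mul_baseChange S t
  have hKW : blockDiagonal' D =
      W * diagonal (fun x : S.Idx => S.phased (S.orb x.1) x.2 t) * Wᴴ := by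
    have h1 := blockDiagonal'_diagonal
      (fun b (i : Fin (S.size b)) => S.phased (S.orb b) i t)
    rw [← h1, hW, blockDiagonal'_conjTranspose, ← blockDiagonal'_mul, ← blockDiagonal'_mul]
    congr 1
    ext1 b
    exact hKc (S.orb b) t
  rw [hKW, conjTranspose_mul, conjTranspose_conjTranspose]
  calc _ = u t * diagonal (fun x : S.Idx => S.phased (S.orb x.1) x.2 t) * (v t)ᴴ := h.eq_mul t
    _ = u t * (Wᴴ * W) * diagonal (fun x : S.Idx => S.phased (S.orb x.1) x.2 t) * (Wᴴ * W) *
        (v t)ᴴ := by rw [hWW, Matrix.mul_one, Matrix.mul_one]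
    _ = _ := by simp only [Matrix.mul_assoc]

end AnalyticSVD

end

theorem theorem4 {m n : ℕ} (A : ℂ → Matrix (Fin m) (Fin n) ℂ)
    (hA : AnalyticSVD.AnalyticEntries ℂ A (Metric.sphere 0 1)) :
    (∃ S : AnalyticSVD.OrbitSystem, S.IsSingularSystem A) ∧
    ∀ S : AnalyticSVD.OrbitSystem, S.IsSingularSystem A →
      ∃ (r : ℝ) (U : ℂ → Matrix (Fin m) (Fin m) ℂ) (C : ℂ → Matrix (Fin m) (Fin n) ℂ)
        (V : ℂ → Matrix (Fin n) (Fin n) ℂ)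
        (K : ∀ ν : Fin S.R, ℂ → Matrix (Fin (S.k ν)) (Fin (S.k ν)) ℂ),
        1 < r ∧
        AnalyticSVD.AnalyticEntries ℂ U (AnalyticSVD.annulus r) ∧
        AnalyticSVD.AnalyticEntries ℂ C (AnalyticSVD.annulus r) ∧
        AnalyticSVD.AnalyticEntries ℂ V (AnalyticSVD.annulus r) ∧
        AnalyticSVD.ParaUnitaryOn U (AnalyticSVD.annulus r) ∧
        AnalyticSVD.ParaUnitaryOn V (AnalyticSVD.annulus r) ∧
        (∀ z ∈ AnalyticSVD.annulus r, A z = U z * C z * AnalyticSVD.paraH V z) ∧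
        (∀ z ∈ AnalyticSVD.annulus r,
          C z = AnalyticSVD.blockDiag m n S.size (fun b => K (S.orb b) z)) ∧
        (∀ ν, AnalyticSVD.PseudoCirculantOn (K ν) (AnalyticSVD.annulus r)) ∧
        (∀ ν, AnalyticSVD.BlockOfOrbit (K ν) (S.σ ν)) :=
  ⟨AnalyticSVD.exists_isSingularSystem hA, fun _ hS => hS.exists_factorization hA⟩
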